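/- **Model.** A dynamic network has $n \ge 2$ nodes with distinct identifiers of $O(\log n)$ bits. Every node knows $b$, $d$ and a common estimate $N$ of $n$ with $n/2 \le N \le 2n$, where $b \ge \log n$ and $d \le b$ (logarithms to base 2); local computation is unrestricted. Before the first round, an adversary gives each node a (possibly empty) set of $d$-bit tokens; let $k \le n$ be the number of distinct tokens in the union of these sets ($k$ is not known to the nodes). In each synchronous round the adversary first chooses a connected graph on the nodes, which may depend on the inputs and on all random choices, actions and states of the nodes up to the end of the previous round. Then each node, without knowing its neighbours, draws fresh independent randomness and broadcasts an $O(b)$-bit message, which may be an arbitrary (randomized) function of all it knows (so tokens may be coded together); it receives the messages of its neighbours in the graph, without sender information. A node that has terminated sends nothing more. A (Las Vegas) algorithm *solves $k$-token dissemination* if in every execution every node eventually terminates, with the union of all tokens as its output. **Theorem.** For all constants $c, u \in \mathbb{N}$ there are a constant $C$ and a randomized (network coding) algorithm with $O(b)$-bit messages which, for all $n \ge 2$, $N$, $b$, $d$, $k$ as above, all distinct identifiers in $\{0,\dots,n^u-1\}$, all initial token distributions and every adaptive adversary, solves $k$-token dissemination and such that, with probability at least $1 - n^{-c}$, all nodes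 terminate within $$C \cdot \min\Big\{ \frac{1}{b}\cdot\frac{nkd}{b} + nb,\ \ \frac{\log n}{b}\cdot\frac{nkd}{b} + n\log n \Big\}$$ rounds. Here $C$ and the constant in the message size depend only on $c$ and $u$. -/

import Mathlib

/-- A token of `d` bits. -/
abbrev Token (d : ℕ) : Type := Fin d → Bool

/-- A message of `m` bits. -/
abbrev Message (m : ℕ) : Type := Fin m → Bool

/-- A randomized distributed algorithm for nodes that broadcast `m`-bit messages and start with
sets of `d`-bit tokens. Every node runs the same algorithm; local computation is unrestricted and
a message may be any function of the node's state and of its random choice.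
In each round a node draws a fresh, uniformly distributed element of the finite set `Coin`,
computes its message from its state and this element, and then computes its new state from its
state, the same element and the multiset of the messages of its neighbours
(without information about the senders). -/
structure Algorithm (m d : ℕ) where
  State : Type
  Coin : Type
  coinFintype : Fintype Coin
  coinNonempty : Nonempty Coin
  /-- initial state of a node, from its UID and the tokens that it holds -/
  init : ℕ → Finset (Token d) → State
  message : State → Coin → Message m
  update : State → Coin → Multiset (Message m) → State
  /-- `none` while the node is running; `some S` if it has terminated with the token set `S` -/
  output : State → Option (Finset (Token d))

attribute [instance] Algorithm.coinFintype Algorithm.coinNonempty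

/-- An adaptive adversary for a network with `n` nodes: the (connected) graph of round `t` is
a function of all random choices of all nodes in the rounds before `t`. As the inputs are fixed,
these determine all past actions and the current states; the random choices of round `t` itself
are not available. -/
structure Adversary (n : ℕ) (Coin : Type) where
  graph : (t : ℕ) → (Fin t → Fin n → Coin) → SimpleGraph (Fin n)
  connected : ∀ (t : ℕ) (h : Fin t → Fin n → Coin), (graph t h).Connected

namespace Algorithm

variable {m d n : ℕ}

/-- The node in state `s` has terminated. -/
def Halted (A : Algorithm m d) (s : A.State) : Prop :=
  (A.output s).isSome = true

open Classical in
/-- One round on the graph `G`, from the states `s` with the random choices `x`.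
A node that has terminated sends nothing and keeps its state. -/
noncomputable def step (A : Algorithm m d) (G : SimpleGraph (Fin n)) (s : Fin n → A.State)
    (x : Fin n → A.Coin) : Fin n → A.State := fun v =>
  if A.Halted (s v) then s v
  else A.update (s v) (x v)
    ((Finset.univ.filter fun w => G.Adj v w ∧ ¬ A.Halted (s w)).val.map
      fun w => A.message (s w) (x w))

/-- The states of all nodes after `t` rounds, given the random choices of these rounds. -/
noncomputable def run (A : Algorithm m d) (uid : Fin n → ℕ) (tok : Fin n → Finset (Token d))
    (adv : Adversary n A.Coin) : (t : ℕ) → (Fin t → Fin n → A.Coin) → Fin n → A.State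
  | 0, _ => fun v => A.init (uid v) (tok v)
  | t + 1, x =>
      A.step (adv.graph t (Fin.init x)) (run A uid tok adv t (Fin.init x)) (x (Fin.last t))

/-- All nodes have terminated after `t` rounds. -/
def AllHalted (A : Algorithm m d) (uid : Fin n → ℕ) (tok : Fin n → Finset (Token d))
    (adv : Adversary n A.Coin) (t : ℕ) (x : Fin t → Fin n → A.Coin) : Prop :=
  ∀ v, A.Halted (A.run uid tok adv t x v)

/-- Las Vegas token dissemination: whatever the random choices are, a node that terminates outputs
exactly the union of all initial token sets, and eventually all nodes terminate. -/
structure Disseminates (A : Algorithm m d) (uid : Fin n → ℕ) (tok : Fin n → Finset (Token d))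
    (adv : Adversary n A.Coin) : Prop where
  correct : ∀ (t : ℕ) (x : Fin t → Fin n → A.Coin) (v : Fin n) (S : Finset (Token d)),
    A.output (A.run uid tok adv t x v) = some S → S = Finset.univ.biUnion tok
  terminates : ∀ x : ℕ → Fin n → A.Coin, ∃ t : ℕ, A.AllHalted uid tok adv t fun i => x i

/-- The probability that all nodes have terminated after at most `t` rounds, where the random
choices of all nodes in all rounds are independent and uniform. (As terminated nodes stay
terminated, this is the proportion of the outcomes of the first `t` rounds after which all nodes
have terminated.) -/
noncomputable def haltProb (A : Algorithm m d) (uid : Fin n → ℕ) (tok : Fin n → Finset (Token d))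
    (adv : Adversary n A.Coin) (t : ℕ) : ℝ :=
  (Nat.card {x : Fin t → Fin n → A.Coin // A.AllHalted uid tok adv t x} : ℝ) /
    (Nat.card (Fin t → Fin n → A.Coin) : ℝ)

end Algorithm

/-- `min {(1/b)·(nkd/b) + nb, (log n/b)·(nkd/b) + n log n}`, with the logarithm to base 2. -/
noncomputable def roundBound (n k d b : ℕ) : ℝ :=
  min (1 / (b : ℝ) * ((n : ℝ) * k * d / b) + (n : ℝ) * b)
    (Real.logb 2 n / (b : ℝ) * ((n : ℝ) * k * d / b) + (n : ℝ) * Real.logb 2 n)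

/-! Time is divided into phases of `O(n)` rounds. In a phase the nodes first forward random blocks
of tokens, until each undelivered token is known to a fraction `1 / numBlocks` of the nodes or some
node is heavy, that is, it knows too many undelivered tokens to announce them at once. A leader is
then elected by flooding, together with the largest of random keys of the blocks, which tells all
nodes the scale of the number of blocks and lets them sample about `numBlocks` of these without
coordination. The sampled blocks spread by random linear coding over `ZMod 2`. Since nobody knows
which blocks are sampled, the block `x` is accompanied by the hash value `(a + x)⁻¹`, where `a` is
a common random seed: for most `a`, no sum of several such vectors is the vector of a block. The
leader numbers the blocks and broadcasts them by coding once more; a heavy leader broadcasts its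
own blocks instead. Nodes that could not decode report this by flooding, and then the phase
delivers only the largest token, which has been flooded too. Hence the output is never wrong.

If `mass` is the number of pairs of a node and an undelivered token that it knows, the potential
`mass * exp (rate * (number of undelivered tokens))` falls by a constant factor in expectation in
every phase, against any adaptive adversary. So `O(k / (numBlocks * blockSize) + log n)` phases
suffice with high probability. With `blockSize ≈ b / d` and `numBlocks ≈ min b (n / log n)` this
is `O(n * (k * d / b ^ 2 + log n))` rounds, which is below both terms of the minimum. -/

namespace NetCoding

open Finset BigOperators

/-! ### Indicators and expectations -/

open Classical in
/-- The indicator of a proposition, as a random variable. -/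
noncomputable def ind (P : Prop) : ℝ := if P then 1 else 0

theorem ind_pos {P : Prop} (h : P) : ind P = 1 := if_pos h

theorem ind_neg {P : Prop} (h : ¬ P) : ind P = 0 := if_neg h

theorem ind_nonneg (P : Prop) : 0 ≤ ind P := by
  unfold ind; split_ifs <;> norm_num

theorem ind_le_one (P : Prop) : ind P ≤ 1 := by
  unfold ind; split_ifs <;> norm_num

theorem ind_mono {P Q : Prop} (h : P → Q) : ind P ≤ ind Q := by
  by_cases hP : P
  · rw [ind_pos hP, ind_pos (h hP)]
  · rw [ind_neg hP]; exact ind_nonneg Q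

theorem ind_exists_le_sum {ι : Type*} (t : Finset ι) (P : ι → Prop) :
    ind (∃ i ∈ t, P i) ≤ ∑ i ∈ t, ind (P i) := by
  by_cases h : ∃ i ∈ t, P i
  · obtain ⟨i, hi, hPi⟩ := h
    calc _ ≤ 1 := ind_le_one _
      _ = ind (P i) := (ind_pos hPi).symm
      _ ≤ _ := single_le_sum (f := fun i => ind (P i)) (fun _ _ => ind_nonneg _) hi
  · rw [ind_neg h]
    exact sum_nonneg fun _ _ => ind_nonneg _

theorem sum_mul_ind_mem_sdiff {α : Type*} [DecidableEq α] {S U : Finset α} (hS : S ⊆ U)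
    (f : α → ℝ) : ∑ τ ∈ U, f τ * ind (τ ∈ U \ S) = ∑ τ ∈ U, f τ - ∑ τ ∈ S, f τ := by
  have hzero : ∑ τ ∈ S, f τ * ind (τ ∈ U \ S) = 0 := sum_eq_zero fun τ hτ => by
    rw [ind_neg fun h => (mem_sdiff.1 h).2 hτ, mul_zero]
  rw [← sum_sdiff hS, hzero, add_zero, ← sum_sdiff hS (f := f), add_sub_cancel_right]
  exact sum_congr rfl fun τ hτ => by rw [ind_pos hτ, mul_one]

theorem mul_ind_le_expect_ind_and {Ω : Type*} [Fintype Ω] {P : Prop} {R : Ω → Prop} {c : ℝ}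
    (h : P → c ≤ 𝔼 ω, ind (R ω)) : c * ind P ≤ 𝔼 ω, ind (P ∧ R ω) := by
  by_cases hP : P
  · rw [ind_pos hP, mul_one]
    simpa only [hP, true_and] using h hP
  · rw [ind_neg hP, mul_zero]
    exact expect_nonneg fun ω _ => ind_nonneg _

theorem expect_ind_mem {Ω : Type*} [Fintype Ω] (A : Finset Ω) :
    (𝔼 y : Ω, ind (y ∈ A)) = A.dens := by
  rw [Fintype.expect_eq_sum_div_card, nnratCast_dens]
  simp only [ind, sum_boole]
  congr 3
  ext
  simp

theorem expect_ind_eq {Ω : Type*} [Fintype Ω] (i : Ω) :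
    (𝔼 y : Ω, ind (y = i)) = 1 / Fintype.card Ω := by
  simpa [nnratCast_dens] using expect_ind_mem ({i} : Finset Ω)

theorem ind_sub_ind_not_le (P Q : Prop) : ind P - ind (¬ Q) ≤ ind (Q ∧ P) := by
  by_cases hQ : Q
  · simp [hQ, ind_neg]
  · rw [ind_pos hQ]
    exact (sub_nonpos.2 (ind_le_one _)).trans (ind_nonneg _)

theorem expect_half_of_flip {Ω : Type*} [Fintype Ω] [Nonempty Ω] (e : Ω ≃ Ω) (f : Ω → ℝ)
    (h : ∀ x, f x + f (e x) = 1) : 𝔼 x, f x = 1 / 2 := by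
  have h1 : 𝔼 x, f (e x) = 𝔼 x, f x := Fintype.expect_equiv e _ _ fun _ => rfl
  have h2 : 𝔼 x, (f x + f (e x)) = 1 := by simp [h]
  rw [expect_add_distrib, h1] at h2
  linarith

section Product

variable {ι Ω : Type*} [Fintype ι] [DecidableEq ι] [Fintype Ω] [Nonempty Ω]

theorem expect_eval (a : ι) (f : Ω → ℝ) : 𝔼 x : ι → Ω, f (x a) = 𝔼 y, f y := by
  rw [Fintype.expect_equiv (Equiv.funSplitAt a Ω) (fun x => f (x a)) (fun y => f y.1)
    (fun x => by simp [Equiv.funSplitAt]), ← univ_product_univ, expect_product]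
  simp

theorem expect_eval_mul {a b : ι} (hab : a ≠ b) (f g : Ω → ℝ) :
    𝔼 x : ι → Ω, f (x a) * g (x b) = (𝔼 y, f y) * 𝔼 y, g y := by
  rw [Fintype.expect_equiv (Equiv.funSplitAt a Ω) (fun x => f (x a) * g (x b))
    (fun y => f y.1 * g (y.2 ⟨b, hab.symm⟩)) (fun x => by simp [Equiv.funSplitAt]),
    ← univ_product_univ, expect_product]
  simp only [← mul_expect]
  rw [← expect_mul]
  congr 1
  exact expect_eval (⟨b, hab.symm⟩ : {j // j ≠ a}) g

end Product

/-! ### Elementary inequalities -/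

theorem div_one_add_mono {a b : ℝ} (ha : 0 ≤ a) (hab : a ≤ b) : a / (1 + a) ≤ b / (1 + b) := by
  rw [div_le_div_iff₀ (by linarith) (by linarith)]
  nlinarith

theorem exp_neg_le_one_sub_half {y : ℝ} (h0 : 0 ≤ y) (h1 : y ≤ 1) : Real.exp (-y) ≤ 1 - y / 2 := by
  rw [Real.exp_neg]
  calc (Real.exp y)⁻¹ ≤ (1 + y)⁻¹ := by
        gcongr
        linarith [Real.add_one_le_exp y]
    _ ≤ 1 - y / 2 := by
        rw [inv_le_iff_one_le_mul₀ (by linarith)]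
        nlinarith

theorem sub_mul_exp_neg_le {M a z : ℝ} (ha : 0 ≤ a) (haM : a ≤ M) (hz0 : 0 ≤ z) (hz1 : z ≤ 1) :
    (M - a) * Real.exp (-z) ≤ M - 1 / 2 * (a + M * z / 2) := by
  have hMa : 0 ≤ M - a := sub_nonneg.2 haM
  calc (M - a) * Real.exp (-z) ≤ (M - a) * (1 - z / 2) := by
        gcongr
        exact exp_neg_le_one_sub_half hz0 hz1
    _ ≤ _ := by nlinarith [mul_nonneg hMa hz0, mul_nonneg ha hz0]

theorem mul_le_add_mul_div_one_add {c h q w : ℝ} (hc : c ≤ 1 / 2) (hh : 0 ≤ h) (hq : 0 ≤ q)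
    (hw : c ≤ h * q / 2 + w * q) : c * h ≤ (h + w) * (h * q / (1 + h * q)) := by
  have hhq : 0 ≤ h * q := by positivity
  rw [mul_div_assoc', le_div_iff₀ (by positivity)]
  nlinarith [mul_le_mul_of_nonneg_left hw hh, mul_nonneg (sub_nonneg.2 hc) (mul_nonneg hh hhq)]

theorem le_mul_min_one_div_add {h g Φ M s n : ℝ} (hg : 0 < g) (hs : 0 < s) (hΦ : 0 < Φ)
    (hM : 0 ≤ M) (hn : 0 ≤ n) (h1 : 1 ≤ h) (hh : n ≤ g * h) (hΦM : Φ ≤ M / s + n) :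
    1 / 168 ≤ h * min 1 (g / (4 * Φ)) / 2 +
      M * (1 / (21 * (g * s))) / 2 * min 1 (g / (4 * Φ)) := by
  rcases min_choice 1 (g / (4 * Φ)) with hmin | hmin <;> rw [hmin]
  · have : 0 ≤ M * (1 / (21 * (g * s))) / 2 * 1 := by positivity
    linarith
  · have hfirst : 1 / 168 * (n / Φ) ≤ h * (g / (4 * Φ)) / 2 := by
      calc 1 / 168 * (n / Φ) ≤ 1 / 8 * (n / Φ) := by gcongr; norm_num
        _ ≤ 1 / 8 * (g * h / Φ) := by gcongr
        _ = _ := by field_simp; ring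
    have hsecond : M * (1 / (21 * (g * s))) / 2 * (g / (4 * Φ)) = 1 / 168 * (M / s / Φ) := by
      field_simp
      ring
    have hone : 1 ≤ M / s / Φ + n / Φ := by
      rw [← add_div, le_div_iff₀ hΦ]
      linarith
    rw [hsecond]
    linarith

theorem two_pow_le_exp (m : ℕ) : (2 : ℝ) ^ m ≤ Real.exp m := by
  rw [← Real.exp_one_pow]
  exact pow_le_pow_left₀ two_pos.le Real.exp_one_gt_two.le m

theorem one_sub_pow_le_exp_neg {x : ℝ} (hx : x ≤ 1) (m : ℕ) :
    (1 - x) ^ m ≤ Real.exp (-(m * x)) :=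
  calc (1 - x) ^ m ≤ Real.exp (-x) ^ m :=
        pow_le_pow_left₀ (sub_nonneg.2 hx) (Real.one_sub_le_exp_neg x) m
    _ = Real.exp (-(m * x)) := by rw [← Real.exp_nat_mul, mul_neg]

theorem one_le_logb_two {x : ℝ} (hx : 2 ≤ x) : 1 ≤ Real.logb 2 x := by
  rwa [Real.le_logb_iff_rpow_le one_lt_two (by linarith), Real.rpow_one]

theorem pos_of_logb_le {n b : ℕ} (h2 : 2 ≤ n) (h : Real.logb 2 n ≤ b) : 0 < b := by
  have hone := one_le_logb_two (show (2 : ℝ) ≤ n by exact_mod_cast h2)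
  exact_mod_cast zero_lt_one.trans_le (hone.trans h)

theorem le_two_pow_of_logb_le {n b : ℕ} (hn : 0 < n) (h : Real.logb 2 n ≤ b) : n ≤ 2 ^ b := by
  rw [Real.logb_le_iff_le_rpow one_lt_two (by exact_mod_cast hn), Real.rpow_natCast] at h
  exact_mod_cast h

theorem two_pow_add_one_pow_div_le (d b : ℕ) : (2 ^ d + 1) ^ (b / max d 1) ≤ 2 ^ (2 * b) :=
  calc (2 ^ d + 1) ^ (b / max d 1) ≤ (2 ^ (d + 1)) ^ (b / max d 1) := by
        gcongr
        have := Nat.one_le_two_pow (n := d)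
        omega
    _ = 2 ^ ((d + 1) * (b / max d 1)) := (pow_mul _ _ _).symm
    _ ≤ 2 ^ (2 * (max d 1 * (b / max d 1))) := by
        rw [← mul_assoc]
        gcongr
        · norm_num
        · omega
    _ ≤ 2 ^ (2 * b) := by
        gcongr
        · norm_num
        · exact Nat.mul_div_le _ _

theorem add_two_le_two_pow {b x k : ℕ} (hb : 0 < b) (h : x ≤ 2 ^ (k * b)) :
    x + 2 ≤ 2 ^ ((k + 2) * b) := by
  have hone : 1 ≤ 2 ^ (k * b) := Nat.one_le_two_pow
  calc x + 2 ≤ 2 ^ (k * b) * 4 := by omega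
    _ = 2 ^ (k * b + 2) := by ring
    _ ≤ _ := Nat.pow_le_pow_right (by norm_num) (by nlinarith)

theorem two_pow_mul_three_quarters_pow_le {a n N : ℕ} (hN : 0 < N) (ha : a ≤ 40 * N)
    (hn : n ≤ 2 * N) : (2 : ℝ) ^ a * (2 ^ n * (3 / 4) ^ (132 * N)) ≤ 1 / 4 := by
  have hcube : ((3 : ℝ) / 4) ^ (132 * N) ≤ (1 / 2) ^ (44 * N) := by
    rw [show 132 * N = 3 * (44 * N) by ring, pow_mul]
    exact pow_le_pow_left₀ (by norm_num) (by norm_num) _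
  calc (2 : ℝ) ^ a * (2 ^ n * (3 / 4) ^ (132 * N))
      ≤ (2 : ℝ) ^ (40 * N) * (2 ^ (2 * N) * (1 / 2) ^ (44 * N)) := by
        gcongr
        · norm_num
        · norm_num
    _ = (2 * (1 / 2) : ℝ) ^ (42 * N) * (1 / 2) ^ (2 * N) := by
        rw [mul_pow]
        ring
    _ = (1 / 2 : ℝ) ^ (2 * N) := by norm_num
    _ ≤ (1 / 2) ^ 2 := pow_le_pow_of_le_one (by norm_num) (by norm_num) (by omega)
    _ = 1 / 4 := by norm_num

/-! ### Enumerations and suprema -/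

open Classical in
/-- An injection of `α` into `β` if there is one, and an arbitrary function otherwise. It encodes
the messages as bit strings and the blocks as elements of a finite field. -/
noncomputable def someInj (α β : Type*) [Nonempty β] : α → β :=
  if h : ∃ f : α → β, Function.Injective f then h.choose else fun _ => Classical.arbitrary β

theorem someInj_injective {α β : Type*} [Fintype α] [Fintype β] [Nonempty β]
    (h : Fintype.card α ≤ Fintype.card β) : Function.Injective (someInj α β) := by
  have h' : ∃ f : α → β, Function.Injective f :=
    let ⟨f⟩ := Function.Embedding.nonempty_of_card_le h
    ⟨f, f.injective⟩
  rw [someInj, dif_pos h']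
  exact h'.choose_spec

open Classical in
/-- The position of `a` in a fixed enumeration of `T`, with the junk value `0` outside `T`. -/
noncomputable def rank {α : Type*} (T : Finset α) (a : α) : ℕ :=
  if h : a ∈ T then T.equivFin ⟨a, h⟩ else 0

section Rank

variable {α : Type*} {T : Finset α}

theorem rank_lt {a : α} (h : a ∈ T) : rank T a < T.card := by
  rw [rank, dif_pos h]; exact Fin.is_lt _

theorem rank_injOn (T : Finset α) : Set.InjOn (rank T) T := by
  intro a ha b hb h
  rw [rank, rank, dif_pos (mem_coe.1 ha), dif_pos (mem_coe.1 hb)] at h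
  simpa using T.equivFin.injective (Fin.ext h)

theorem exists_rank_eq {i : ℕ} (hi : i < T.card) : ∃ a ∈ T, rank T a = i := by
  refine ⟨(T.equivFin.symm ⟨i, hi⟩ : T), (T.equivFin.symm ⟨i, hi⟩).2, ?_⟩
  rw [rank, dif_pos (T.equivFin.symm ⟨i, hi⟩).2]
  simp

end Rank

section FinsetSup

variable {α β ι : Type*}

theorem sup_fst [SemilatticeSup α] [OrderBot α] [SemilatticeSup β] [OrderBot β] (s : Finset ι)
    (f : ι → α × β) : (s.sup f).1 = s.sup fun i => (f i).1 :=
  apply_sup_eq_sup_comp Prod.fst (fun _ _ => rfl) rfl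

theorem sup_snd [SemilatticeSup α] [OrderBot α] [SemilatticeSup β] [OrderBot β] (s : Finset ι)
    (f : ι → α × β) : (s.sup f).2 = s.sup fun i => (f i).2 :=
  apply_sup_eq_sup_comp Prod.snd (fun _ _ => rfl) rfl

theorem exists_eq_of_sup_ne_bot [LinearOrder α] [OrderBot α] {s : Finset ι} {f : ι → α}
    (h : s.sup f ≠ ⊥) : ∃ i ∈ s, s.sup f = f i := by
  rcases s.eq_empty_or_nonempty with rfl | hs
  · exact absurd sup_empty h
  · exact exists_mem_eq_sup s hs f

end FinsetSup

/-! ### Processes driven by an adversary -/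

section Reachability

variable {K M S X : Type*} (step : K → M → S → X → S)

/-- The state `s'` can be reached from `s` in rounds whose kinds are listed in `l`. In each round
the adversary makes a move in `M` and the random choice is an element of `X`. -/
def Reach : List K → S → S → Prop
  | [], s, s' => s' = s
  | k :: l, s, s' => ∃ (a : M) (x : X), Reach l (step k a s x) s'

variable {step}

theorem reach_append {l₁ l₂ : List K} {s s' : S} :
    Reach step (l₁ ++ l₂) s s' ↔ ∃ s₁, Reach step l₁ s s₁ ∧ Reach step l₂ s₁ s' := by
  induction l₁ generalizing s with
  | nil => simp [Reach]
  | cons k l ih =>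
    simp only [List.cons_append, Reach, ih]
    constructor
    · rintro ⟨a, x, s₁, h, h'⟩
      exact ⟨s₁, ⟨a, x, h⟩, h'⟩
    · rintro ⟨s₁, ⟨a, x, h⟩, h'⟩
      exact ⟨a, x, s₁, h, h'⟩

theorem Reach.invariant {I : S → Prop} {l : List K}
    (hI : ∀ k ∈ l, ∀ (a : M) s x, I s → I (step k a s x)) {s s' : S}
    (h : Reach step l s s') (hs : I s) : I s' := by
  induction l generalizing s with
  | nil => rw [show s' = s from h]; exact hs
  | cons k l ih =>
    obtain ⟨a, x, h⟩ := h
    exact ih (fun k hk => hI k (List.mem_cons_of_mem _ hk)) h (hI k (by simp) a s x hs)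

end Reachability

section SupExpect

variable {K M S X : Type*} [Fintype X] (step : K → M → S → X → S)

/-- The largest expectation of `f` that an adaptive adversary can enforce in the rounds whose
kinds are listed in `l`, from the state `s`. -/
noncomputable def supExpect : List K → (S → ℝ) → S → ℝ
  | [], f, s => f s
  | k :: l, f, s => ⨆ a : M, 𝔼 x, supExpect l f (step k a s x)

variable {step}

theorem supExpect_append (l₁ l₂ : List K) (f : S → ℝ) (s : S) :
    supExpect step (l₁ ++ l₂) f s = supExpect step l₁ (supExpect step l₂ f) s := by
  induction l₁ generalizing s with
  | nil => rfl
  | cons k l ih => simp only [List.cons_append, supExpect, ih]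

theorem expect_le_supExpect_cons [Finite M] (k : K) (l : List K) (f : S → ℝ) (s : S) (a : M) :
    𝔼 x, supExpect step l f (step k a s x) ≤ supExpect step (k :: l) f s :=
  le_ciSup (f := fun a : M => 𝔼 x, supExpect step l f (step k a s x))
    (Set.finite_range _).bddAbove a

variable [Nonempty M]

theorem supExpect_cons_le {k : K} {l : List K} {f : S → ℝ} {s : S} {c : ℝ}
    (h : ∀ a : M, 𝔼 x, supExpect step l f (step k a s x) ≤ c) :
    supExpect step (k :: l) f s ≤ c :=
  ciSup_le h

theorem supExpect_replicate_le {k : K} {I : S → Prop} {V : S → ℝ} {ρ : ℝ} (hρ : 0 ≤ ρ)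
    (hI : ∀ (a : M) s x, I s → I (step k a s x))
    (hV : ∀ (a : M) s, I s → 𝔼 x, V (step k a s x) ≤ ρ * V s) (r : ℕ) {s : S}
    (hs : I s) : supExpect step (List.replicate r k) V s ≤ ρ ^ r * V s := by
  induction r generalizing s with
  | zero => simp [supExpect]
  | succ r ih =>
    rw [List.replicate_succ]
    refine supExpect_cons_le fun a => ?_
    calc 𝔼 x, supExpect step (List.replicate r k) V (step k a s x)
        ≤ 𝔼 x, ρ ^ r * V (step k a s x) := expect_le_expect fun x _ => ih (hI a s x hs)
      _ = ρ ^ r * 𝔼 x, V (step k a s x) := (mul_expect _ _ _).symm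
      _ ≤ ρ ^ r * (ρ * V s) := by gcongr; exact hV a s hs
      _ = ρ ^ (r + 1) * V s := by ring

theorem supExpect_le_of_forall [Nonempty X] {l : List K} {f : S → ℝ} {s : S} {c : ℝ}
    (h : ∀ s', Reach step l s s' → f s' ≤ c) : supExpect step l f s ≤ c := by
  induction l generalizing s with
  | nil => exact h s rfl
  | cons k l ih =>
    exact supExpect_cons_le fun a =>
      expect_le univ_nonempty fun x _ => ih fun s' hs' => h s' ⟨a, x, hs'⟩

variable [Finite M]

theorem supExpect_mono {l : List K} {f g : S → ℝ} {s : S}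
    (hfg : ∀ s', Reach step l s s' → f s' ≤ g s') :
    supExpect step l f s ≤ supExpect step l g s := by
  induction l generalizing s with
  | nil => exact hfg s rfl
  | cons k l ih =>
    refine supExpect_cons_le fun a => le_trans ?_ (expect_le_supExpect_cons k l g s a)
    exact expect_le_expect fun x _ => ih fun s' hs' => hfg s' ⟨a, x, hs'⟩

theorem supExpect_add_le (l : List K) (f g : S → ℝ) (s : S) :
    supExpect step l (fun s => f s + g s) s ≤ supExpect step l f s + supExpect step l g s := by
  induction l generalizing s with
  | nil => exact le_rfl
  | cons k l ih =>
    refine supExpect_cons_le fun a => ?_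
    calc 𝔼 x, supExpect step l (fun s => f s + g s) (step k a s x)
        ≤ 𝔼 x, (supExpect step l f (step k a s x) + supExpect step l g (step k a s x)) :=
          expect_le_expect fun x _ => ih _
      _ = _ := expect_add_distrib _ _ _
      _ ≤ _ := add_le_add (expect_le_supExpect_cons k l f s a) (expect_le_supExpect_cons k l g s a)

theorem supExpect_mul_le (l : List K) {c : ℝ} (hc : 0 ≤ c) (f : S → ℝ) (s : S) :
    supExpect step l (fun s => c * f s) s ≤ c * supExpect step l f s := by
  induction l generalizing s with
  | nil => exact le_rfl
  | cons k l ih =>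
    refine supExpect_cons_le fun a => ?_
    calc 𝔼 x, supExpect step l (fun s => c * f s) (step k a s x)
        ≤ 𝔼 x, c * supExpect step l f (step k a s x) := expect_le_expect fun x _ => ih _
      _ = c * 𝔼 x, supExpect step l f (step k a s x) := (mul_expect _ _ _).symm
      _ ≤ _ := mul_le_mul_of_nonneg_left (expect_le_supExpect_cons k l f s a) hc

variable [Nonempty X]

theorem supExpect_sum_le {ι : Type*} (t : Finset ι) (l : List K) (f : ι → S → ℝ) (s : S) :
    supExpect step l (fun s => ∑ i ∈ t, f i s) s ≤ ∑ i ∈ t, supExpect step l (f i) s := by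
  classical
  induction t using Finset.induction_on with
  | empty =>
    simp only [sum_empty]
    exact supExpect_le_of_forall fun _ _ => le_rfl
  | insert i t hi ih =>
    simp only [sum_insert hi]
    exact (supExpect_add_le l (f i) _ s).trans (add_le_add_right ih _)

theorem supExpect_affine_le {ι : Type*} (t : Finset ι) (l : List K) (c : ℝ) (a : ι → ℝ)
    (ha : ∀ i ∈ t, 0 ≤ a i) (f : ι → S → ℝ) (s : S) :
    supExpect step l (fun s => c + ∑ i ∈ t, a i * f i s) s ≤
      c + ∑ i ∈ t, a i * supExpect step l (f i) s := by
  refine (supExpect_add_le l (fun _ => c) _ s).trans (add_le_add ?_ ?_)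
  · exact supExpect_le_of_forall fun _ _ => le_rfl
  · exact (supExpect_sum_le t l _ s).trans (sum_le_sum fun i hi => supExpect_mul_le l (ha i hi) _ s)

end SupExpect

/-! ### Spreading in connected graphs -/

/-- The connected graphs on `V`, which are the moves of the adversary. -/
abbrev ConnectedGraph (V : Type*) : Type _ := {G : SimpleGraph V // G.Connected}

instance ConnectedGraph.finite (V : Type*) [Finite V] : Finite (ConnectedGraph V) := by
  classical
  exact Subtype.finite

instance ConnectedGraph.nonempty (V : Type*) [Nonempty V] : Nonempty (ConnectedGraph V) :=
  ⟨⟨⊤, SimpleGraph.connected_top⟩⟩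

theorem ConnectedGraph.exists_adj_mem_notMem {V : Type*} [Fintype V] (G : ConnectedGraph V)
    {s : Finset V} (hs : s.Nonempty) (hs' : s ≠ univ) : ∃ w ∈ s, ∃ v ∉ s, G.1.Adj v w := by
  obtain ⟨u, hu⟩ := hs
  obtain ⟨v, hv⟩ : ∃ v, v ∉ s := by
    by_contra! h
    exact hs' (eq_univ_iff_forall.2 h)
  obtain ⟨p⟩ := G.2.preconnected u v
  obtain ⟨e, -, h1, h2⟩ := p.exists_boundary_dart (s : Set V) (by simpa using hu)
    (by simpa using hv)
  exact ⟨e.fst, by simpa using h1, e.snd, by simpa using h2, e.adj.symm⟩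

section Spread

variable {V K S X : Type*} {step : K → ConnectedGraph V → S → X → S}

/-- In the rounds of kind `k`, the nonempty set `A s` of nodes grows as long as the property `I`
of the states holds, and `I` is preserved. -/
structure Grows (step : K → ConnectedGraph V → S → X → S) (k : K) (I : S → Prop)
    (A : S → Finset V) : Prop where
  preserves : ∀ (G : ConnectedGraph V) s x, I s → I (step k G s x)
  subset : ∀ (G : ConnectedGraph V) s x, I s → A s ⊆ A (step k G s x)
  nonempty : ∀ s, I s → (A s).Nonempty

variable [Fintype V]

theorem Grows.card_add_le {k : K} {I : S → Prop} {A : S → Finset V} (hA : Grows step k I A)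
    (hadj : ∀ (G : ConnectedGraph V) s x v w, I s → w ∈ A s → G.1.Adj v w → v ∈ A (step k G s x))
    (r : ℕ) {s s' : S} (hs : I s) (h : Reach step (List.replicate r k) s s') :
    A s' = univ ∨ (A s).card + r ≤ (A s').card := by
  induction r generalizing s with
  | zero => right; rw [show s' = s from h]; simp
  | succ r ih =>
    obtain ⟨G, x, h⟩ := h
    rcases ih (hA.preserves G s x hs) h with h1 | h1
    · exact Or.inl h1
    by_cases hu : A s = univ
    · have hsubset : A s ⊆ A s' := by
        refine (hA.subset G s x hs).trans ?_
        exact (Reach.invariant (I := fun s₁ => I s₁ ∧ A (step k G s x) ⊆ A s₁)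
          (fun k' hk' G' s₁ x' h' => by
            rw [List.eq_of_mem_replicate hk']
            exact ⟨hA.preserves _ _ _ h'.1, h'.2.trans (hA.subset _ _ _ h'.1)⟩) h
          ⟨hA.preserves G s x hs, Subset.rfl⟩).2
      exact Or.inl (univ_subset_iff.1 (hu ▸ hsubset))
    · obtain ⟨w, hw, v, hv, hvw⟩ := G.exists_adj_mem_notMem (hA.nonempty s hs) hu
      have : (A s).card < (A (step k G s x)).card :=
        card_lt_card ((ssubset_iff_of_subset (hA.subset G s x hs)).2
          ⟨v, hadj G s x v w hs hw hvw, hv⟩)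
      exact Or.inr (by omega)

/-- The quantity that decreases geometrically, in expectation, while a set of nodes spreads: it
vanishes as soon as the process has stopped or all nodes are reached. -/
noncomputable def spreadPotential (stopped : Prop) (A : Finset V) : ℝ :=
  ind (¬ stopped ∧ A ≠ univ) * (1 / 2) ^ A.card

theorem spreadPotential_nonneg (stopped : Prop) (A : Finset V) : 0 ≤ spreadPotential stopped A :=
  mul_nonneg (ind_nonneg _) (by positivity)

theorem spreadPotential_le_pow (stopped : Prop) (A : Finset V) :
    spreadPotential stopped A ≤ (1 / 2) ^ A.card :=
  mul_le_of_le_one_left (by positivity) (ind_le_one _)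

theorem ind_card_le_spreadPotential (stopped : Prop) (A : Finset V) (h : ℕ) :
    ind (¬ stopped ∧ A ≠ univ ∧ A.card ≤ h) ≤ 2 ^ h * spreadPotential stopped A := by
  by_cases hA : ¬ stopped ∧ A ≠ univ ∧ A.card ≤ h
  · rw [ind_pos hA, spreadPotential, ind_pos ⟨hA.1, hA.2.1⟩, one_mul, one_div, inv_pow,
      ← div_eq_mul_inv, le_div_iff₀ (by positivity), one_mul]
    exact pow_le_pow_right₀ (by norm_num) hA.2.2
  · rw [ind_neg hA]
    exact mul_nonneg (by positivity) (spreadPotential_nonneg _ _)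

theorem spreadPotential_le_of_subset {stopped stopped' : Prop} {A A' : Finset V} {v : V}
    (h : ¬ stopped ∧ A ≠ univ) (hA : A ⊆ A') (hv : v ∉ A) :
    spreadPotential stopped' A' ≤ spreadPotential stopped A * (1 - 1 / 2 * ind (v ∈ A')) := by
  rw [show spreadPotential stopped A = (1 / 2) ^ A.card by
    rw [spreadPotential, ind_pos h, one_mul]]
  refine (spreadPotential_le_pow _ _).trans ?_
  by_cases hv' : v ∈ A'
  · have hcard : A.card + 1 ≤ A'.card :=
      card_lt_card ((ssubset_iff_of_subset hA).2 ⟨v, hv', hv⟩)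
    calc ((1 : ℝ) / 2) ^ A'.card ≤ (1 / 2) ^ (A.card + 1) :=
          pow_le_pow_of_le_one (by norm_num) (by norm_num) hcard
      _ = _ := by rw [ind_pos hv']; ring
  · rw [ind_neg hv', mul_zero, sub_zero, mul_one]
    exact pow_le_pow_of_le_one (by norm_num) (by norm_num) (card_le_card hA)

variable [Fintype X] [Nonempty X] {k : K} {I : S → Prop} {stopped : S → Prop}
  {A : S → Finset V} {q : ℝ}

theorem Grows.expect_spreadPotential_le (hA : Grows step k I A)
    (hstopped : ∀ (G : ConnectedGraph V) s x, I s → stopped s → stopped (step k G s x))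
    (hq : ∀ (G : ConnectedGraph V) s v w, I s → ¬ stopped s → w ∈ A s → v ∉ A s → G.1.Adj v w →
      q ≤ 𝔼 x, ind (v ∈ A (step k G s x)))
    (G : ConnectedGraph V) {s : S} (hs : I s) :
    𝔼 x, spreadPotential (stopped (step k G s x)) (A (step k G s x)) ≤
      (1 - q / 2) * spreadPotential (stopped s) (A s) := by
  by_cases h : ¬ stopped s ∧ A s ≠ univ
  · obtain ⟨w, hw, v, hv, hvw⟩ := G.exists_adj_mem_notMem (hA.nonempty s hs) h.2
    calc 𝔼 x, spreadPotential (stopped (step k G s x)) (A (step k G s x))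
        ≤ 𝔼 x, spreadPotential (stopped s) (A s) *
            (1 - 1 / 2 * ind (v ∈ A (step k G s x))) :=
          expect_le_expect fun x _ => spreadPotential_le_of_subset h (hA.subset G s x hs) hv
      _ = spreadPotential (stopped s) (A s) *
            (1 - 1 / 2 * 𝔼 x, ind (v ∈ A (step k G s x))) := by
          rw [← mul_expect, expect_sub_distrib, ← mul_expect, Fintype.expect_const]
      _ ≤ spreadPotential (stopped s) (A s) * (1 - 1 / 2 * q) := by
          have := spreadPotential_nonneg (stopped s) (A s)
          gcongr
          exact hq G s v w hs h.1 hw hv hvw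
      _ = (1 - q / 2) * spreadPotential (stopped s) (A s) := by ring
  · have h' (x : X) : ¬ (¬ stopped (step k G s x) ∧ A (step k G s x) ≠ univ) := by
      rintro ⟨h1, h2⟩
      refine h ⟨fun h3 => h1 (hstopped G s x hs h3), fun h3 => h2 ?_⟩
      exact univ_subset_iff.1 (h3 ▸ hA.subset G s x hs)
    simp [spreadPotential, ind_neg h, ind_neg (h' _)]

theorem Grows.supExpect_card_le [Nonempty V] (hA : Grows step k I A)
    (hstopped : ∀ (G : ConnectedGraph V) s x, I s → stopped s → stopped (step k G s x))
    (hq1 : q ≤ 1)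
    (hq : ∀ (G : ConnectedGraph V) s v w, I s → ¬ stopped s → w ∈ A s → v ∉ A s → G.1.Adj v w →
      q ≤ 𝔼 x, ind (v ∈ A (step k G s x)))
    (r h : ℕ) {s : S} (hs : I s) :
    supExpect step (List.replicate r k)
      (fun s => ind (¬ stopped s ∧ A s ≠ univ ∧ (A s).card ≤ h)) s ≤
      2 ^ h * (1 - q / 2) ^ r := by
  have hle1 : spreadPotential (stopped s) (A s) ≤ 1 :=
    (spreadPotential_le_pow _ _).trans (pow_le_one₀ (by norm_num) (by norm_num))
  have hρ : 0 ≤ 1 - q / 2 := by linarith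
  calc supExpect step (List.replicate r k)
        (fun s => ind (¬ stopped s ∧ A s ≠ univ ∧ (A s).card ≤ h)) s
      ≤ supExpect step (List.replicate r k)
          (fun s => 2 ^ h * spreadPotential (stopped s) (A s)) s :=
        supExpect_mono fun _ _ => ind_card_le_spreadPotential _ _ _
    _ ≤ 2 ^ h * supExpect step (List.replicate r k)
          (fun s => spreadPotential (stopped s) (A s)) s :=
        supExpect_mul_le _ (by positivity) _ _
    _ ≤ 2 ^ h * ((1 - q / 2) ^ r * spreadPotential (stopped s) (A s)) := by
        gcongr
        exact supExpect_replicate_le hρ hA.preserves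
          (fun G _ => hA.expect_spreadPotential_le hstopped hq G) r hs
    _ ≤ 2 ^ h * ((1 - q / 2) ^ r * 1) := by gcongr
    _ = 2 ^ h * (1 - q / 2) ^ r := by ring

end Spread

/-! ### Sums of reciprocals -/

section SumInv

variable {F : Type*} [Field F]

open Classical in
/-- The numerator of `∑ x ∈ S, (X + x)⁻¹ - (X + ∑ x ∈ S, x)⁻¹`. -/
noncomputable def sumInvNumerator (S : Finset F) : Polynomial F :=
  (Polynomial.X + Polynomial.C (∑ x ∈ S, x)) *
      (∑ x ∈ S, ∏ y ∈ S.erase x, (Polynomial.X + Polynomial.C y)) -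
    ∏ y ∈ S, (Polynomial.X + Polynomial.C y)

open Classical in
theorem eval_sumInvNumerator (S : Finset F) (a : F) :
    (sumInvNumerator S).eval a =
      (a + ∑ x ∈ S, x) * (∑ x ∈ S, ∏ y ∈ S.erase x, (a + y)) - ∏ y ∈ S, (a + y) := by
  simp [sumInvNumerator, Polynomial.eval_finsetSum, Polynomial.eval_prod]

theorem sumInvNumerator_ne_zero {S : Finset F} (hS : S.card ≠ 1) : sumInvNumerator S ≠ 0 := by
  classical
  intro h0
  rcases S.eq_empty_or_nonempty with rfl | hne
  · simpa [h0] using eval_sumInvNumerator (∅ : Finset F) 0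
  obtain ⟨x₀, hx₀, hne'⟩ : ∃ x₀ ∈ S, x₀ ≠ ∑ x ∈ S, x :=
    exists_mem_ne (by have := hne.card_pos; omega) _
  have heval := eval_sumInvNumerator S (-x₀)
  rw [h0, Polynomial.eval_zero, prod_eq_zero hx₀ (by simp), sub_zero,
    sum_eq_single_of_mem x₀ hx₀ fun x _ hxx =>
      prod_eq_zero (mem_erase.2 ⟨hxx.symm, hx₀⟩) (neg_add_cancel x₀)] at heval
  rcases mul_eq_zero.1 heval.symm with h | h
  · exact hne' (by linear_combination -h)
  · obtain ⟨y, hy, hy0⟩ := prod_eq_zero_iff.1 h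
    exact (mem_erase.1 hy).1 (by linear_combination hy0)

theorem natDegree_sumInvNumerator_le (S : Finset F) : (sumInvNumerator S).natDegree ≤ S.card := by
  classical
  have hprod (s : Finset F) :
      (∏ y ∈ s, (Polynomial.X + Polynomial.C y)).natDegree ≤ s.card :=
    (Polynomial.natDegree_prod_le _ _).trans (by simp)
  refine (Polynomial.natDegree_sub_le _ _).trans (max_le ?_ (hprod S))
  rcases S.eq_empty_or_nonempty with rfl | hne
  · simp
  have hsum : (∑ x ∈ S, ∏ y ∈ S.erase x, (Polynomial.X + Polynomial.C y)).natDegree ≤ S.card - 1 :=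
    Polynomial.natDegree_sum_le_of_forall_le _ _ fun x hx =>
      (hprod _).trans (card_erase_of_mem hx).le
  have := hne.card_pos
  refine Polynomial.natDegree_mul_le.trans ?_
  rw [Polynomial.natDegree_X_add_C]
  omega

theorem isRoot_sumInvNumerator {S : Finset F} {a : F} (hS : ∀ x ∈ S, a + x ≠ 0)
    (ha : a + ∑ x ∈ S, x ≠ 0) (h : ∑ x ∈ S, (a + x)⁻¹ = (a + ∑ x ∈ S, x)⁻¹) :
    (sumInvNumerator S).IsRoot a := by
  classical
  have hfactor : ∑ x ∈ S, ∏ y ∈ S.erase x, (a + y) = (∏ y ∈ S, (a + y)) * ∑ x ∈ S, (a + x)⁻¹ := by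
    rw [mul_sum]
    refine sum_congr rfl fun x hx => ?_
    rw [← mul_prod_erase S _ hx]
    field_simp [hS x hx]
  rw [Polynomial.IsRoot, eval_sumInvNumerator, hfactor, h]
  field_simp
  ring

open Classical in
theorem card_sum_inv_eq_inv_le [Fintype F] {S : Finset F} (hS : S.card ≠ 1) :
    (univ.filter fun a : F => ∑ x ∈ S, (a + x)⁻¹ = (a + ∑ x ∈ S, x)⁻¹).card ≤ 2 * S.card + 1 := by
  set z := ∑ x ∈ S, x
  have hsub : (univ.filter fun a : F => ∑ x ∈ S, (a + x)⁻¹ = (a + z)⁻¹) ⊆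
      (sumInvNumerator S).roots.toFinset ∪ (S.image (fun x => -x) ∪ {-z}) := by
    intro a ha
    by_cases hpole : a ∈ S.image (fun x => -x) ∪ {-z}
    · exact mem_union_right _ hpole
    simp only [mem_union, mem_image, mem_singleton, not_or, not_exists, not_and] at hpole
    refine mem_union_left _ (Multiset.mem_toFinset.2 ?_)
    refine (Polynomial.mem_roots (sumInvNumerator_ne_zero hS)).2
      (isRoot_sumInvNumerator (fun x hx h => ?_) (fun h => ?_) (mem_filter.1 ha).2)
    · exact hpole.1 x hx (by linear_combination -h)
    · exact hpole.2 (by linear_combination h)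
  have hroots : (sumInvNumerator S).roots.toFinset.card ≤ S.card :=
    (Multiset.toFinset_card_le _).trans
      ((Polynomial.card_roots' _).trans (natDegree_sumInvNumerator_le S))
  have himage : (S.image fun x => -x).card ≤ S.card := card_image_le
  calc _ ≤ ((sumInvNumerator S).roots.toFinset ∪ (S.image (fun x => -x) ∪ {-z})).card :=
        card_le_card hsub
    _ ≤ (sumInvNumerator S).roots.toFinset.card + ((S.image fun x => -x).card + 1) :=
        (card_union_le _ _).trans (Nat.add_le_add_left (card_union_le _ _) _)
    _ ≤ 2 * S.card + 1 := by omega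

end SumInv

/-! ### Moments of the number of hits in a product space -/

section Hits

variable {ι Ω : Type*} (A : Finset Ω) (J I : Finset ι)

/-- The number of coordinates in `J` at which `y` lies in `A`. -/
noncomputable def hits (y : ι → Ω) : ℝ := ∑ a ∈ J, ind (y a ∈ A)

variable {A J} in
theorem hits_eq_zero {y : ι → Ω} (h : ¬ ∃ a ∈ J, y a ∈ A) : hits A J y = 0 :=
  sum_eq_zero fun a ha => ind_neg fun hy => h ⟨a, ha, hy⟩

theorem hits_nonneg (y : ι → Ω) : 0 ≤ hits A J y := sum_nonneg fun _ _ => ind_nonneg _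

theorem ind_exists_le_hits (y : ι → Ω) : ind (∃ a ∈ J, y a ∈ A) ≤ hits A J y := by
  by_cases h : ∃ a ∈ J, y a ∈ A
  · obtain ⟨a, ha, hy⟩ := h
    rw [ind_pos ⟨a, ha, hy⟩, ← ind_pos hy]
    exact single_le_sum (f := fun a => ind (y a ∈ A)) (fun a _ => ind_nonneg _) ha
  · rw [ind_neg h]
    exact hits_nonneg A J y

/-- The left-hand side is at most `1`, as the difference is a square. -/
theorem quadratic_hits_le (t : ℝ) (y : ι → Ω) :
    2 * t * hits A J y - t ^ 2 * (hits A J y * hits A J y) ≤ ind (∃ a ∈ J, y a ∈ A) := by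
  by_cases h : ∃ a ∈ J, y a ∈ A
  · rw [ind_pos h]
    nlinarith [sq_nonneg (t * hits A J y - 1)]
  · rw [ind_neg h, hits_eq_zero h]
    simp

theorem quadratic_hits_sub_le {t c : ℝ} (ht : 0 ≤ t) (hc : 0 < c) (y : ι → Ω) :
    2 * t * hits A J y - t ^ 2 * (hits A J y * hits A J y) -
        2 * t / c * (hits A J y * hits A I y) ≤
      ind ((∃ a ∈ J, y a ∈ A) ∧ hits A I y ≤ c) := by
  have hJ := hits_nonneg A J y
  have hI := hits_nonneg A I y
  by_cases hle : hits A I y ≤ c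
  · rw [show ((∃ a ∈ J, y a ∈ A) ∧ hits A I y ≤ c) = ∃ a ∈ J, y a ∈ A by simp [hle]]
    have : 0 ≤ 2 * t / c * (hits A J y * hits A I y) := by positivity
    linarith [quadratic_hits_le A J t y]
  · rw [ind_neg fun h => hle h.2]
    have : 2 * t * hits A J y ≤ 2 * t / c * (hits A J y * hits A I y) := by
      rw [div_mul_eq_mul_div, le_div_iff₀ hc, ← mul_assoc]
      exact mul_le_mul_of_nonneg_left (not_le.1 hle).le (by positivity)
    nlinarith [sq_nonneg (t * hits A J y)]

variable [Fintype ι] [DecidableEq ι] [Fintype Ω] [Nonempty Ω]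

theorem expect_ind_eval_mem (a : ι) : 𝔼 y : ι → Ω, ind (y a ∈ A) = (A.dens : ℝ) := by
  rw [expect_eval a (fun y => ind (y ∈ A)), expect_ind_mem]

theorem expect_hits : 𝔼 y, hits A J y = J.card * (A.dens : ℝ) := by
  simp only [hits]
  rw [expect_sum_comm]
  simp [expect_ind_eval_mem]

theorem expect_exists_hit_le :
    (𝔼 y : ι → Ω, ind (∃ a ∈ J, y a ∈ A)) ≤ J.card * (A.dens : ℝ) := by
  rw [← expect_hits]
  exact expect_le_expect fun y _ => ind_exists_le_hits A J y

theorem expect_ind_eval_mem_mul_le (a b : ι) :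
    𝔼 y : ι → Ω, ind (y a ∈ A) * ind (y b ∈ A) ≤
      (if a = b then (A.dens : ℝ) else 0) + A.dens * A.dens := by
  by_cases hab : a = b
  · subst hab
    have hsq (y : ι → Ω) : ind (y a ∈ A) * ind (y a ∈ A) = ind (y a ∈ A) := by
      by_cases h : y a ∈ A <;> simp [ind, h]
    simp only [hsq, expect_ind_eval_mem, if_true]
    exact le_add_of_nonneg_right (by positivity)
  · rw [if_neg hab, zero_add, expect_eval_mul hab (fun y => ind (y ∈ A)) (fun y => ind (y ∈ A)),
      expect_ind_mem]

theorem expect_hits_mul_hits_le :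
    𝔼 y, hits A J y * hits A I y ≤ J.card * (A.dens : ℝ) * (1 + I.card * A.dens) := by
  simp only [hits, sum_mul_sum]
  rw [expect_sum_comm]
  simp only [expect_sum_comm]
  calc ∑ a ∈ J, ∑ b ∈ I, 𝔼 y : ι → Ω, ind (y a ∈ A) * ind (y b ∈ A)
      ≤ ∑ a ∈ J, ∑ b ∈ I, ((if a = b then (A.dens : ℝ) else 0) + A.dens * A.dens) :=
        sum_le_sum fun a _ => sum_le_sum fun b _ => expect_ind_eval_mem_mul_le A a b
    _ ≤ ∑ _ ∈ J, ((A.dens : ℝ) + I.card * (A.dens * A.dens)) := by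
        refine sum_le_sum fun a _ => ?_
        rw [sum_add_distrib, sum_const, nsmul_eq_mul, sum_ite_eq]
        gcongr
        split_ifs
        · exact le_rfl
        · positivity
    _ = _ := by rw [sum_const, nsmul_eq_mul]; ring

/-- The value of `t` at which the expectation of `quadratic_hits_le` is largest. -/
theorem le_expect_quadratic_hits {μ t : ℝ} (hμ : μ = J.card * (A.dens : ℝ)) (ht : t = 1 / (1 + μ)) :
    μ / (1 + μ) ≤ 𝔼 y : ι → Ω, (2 * t * hits A J y - t ^ 2 * (hits A J y * hits A J y)) := by
  have hμ0 : 0 ≤ μ := by rw [hμ]; positivity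
  have hsq : t ^ 2 * (𝔼 y, hits A J y * hits A J y) ≤ μ / (1 + μ) := by
    calc t ^ 2 * (𝔼 y, hits A J y * hits A J y) ≤ t ^ 2 * (μ * (1 + μ)) := by
          rw [hμ]; gcongr; exact expect_hits_mul_hits_le A J J
      _ = μ / (1 + μ) := by rw [ht]; field_simp
  rw [expect_sub_distrib, ← mul_expect, ← mul_expect, expect_hits, ← hμ]
  have : 2 * t * μ = 2 * (μ / (1 + μ)) := by rw [ht]; ring
  linarith

theorem le_expect_exists_hit :
    J.card * (A.dens : ℝ) / (1 + J.card * A.dens) ≤ 𝔼 y : ι → Ω, ind (∃ a ∈ J, y a ∈ A) :=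
  (le_expect_quadratic_hits A J rfl rfl).trans
    (expect_le_expect fun y _ => quadratic_hits_le A J _ y)

theorem le_expect_exists_hit_and_hits_le {c : ℝ} (hc : 4 * (1 + I.card * (A.dens : ℝ)) ≤ c) :
    1 / 2 * (J.card * (A.dens : ℝ) / (1 + J.card * A.dens)) ≤
      𝔼 y : ι → Ω, ind ((∃ a ∈ J, y a ∈ A) ∧ hits A I y ≤ c) := by
  obtain ⟨μ, hμ⟩ : ∃ μ : ℝ, μ = J.card * (A.dens : ℝ) := ⟨_, rfl⟩
  obtain ⟨t, ht⟩ : ∃ t : ℝ, t = 1 / (1 + μ) := ⟨_, rfl⟩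
  have hμ0 : 0 ≤ μ := by rw [hμ]; positivity
  have ht0 : 0 ≤ t := by rw [ht]; positivity
  have hI0 : (0 : ℝ) ≤ I.card * (A.dens : ℝ) := by positivity
  have hc0 : 0 < c := by linarith
  have hquad := le_expect_quadratic_hits A J hμ ht
  have hmixed : 2 * t / c * (𝔼 y, hits A J y * hits A I y) ≤ 1 / 2 * (μ / (1 + μ)) := by
    calc 2 * t / c * (𝔼 y, hits A J y * hits A I y)
        ≤ 2 * t / c * (μ * (1 + I.card * (A.dens : ℝ))) := by
          rw [hμ]; gcongr; exact expect_hits_mul_hits_le A J I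
      _ = t * μ / 2 * (4 * (1 + I.card * (A.dens : ℝ)) / c) := by field_simp; ring
      _ ≤ t * μ / 2 * 1 := by gcongr; exact (div_le_one hc0).2 hc
      _ = 1 / 2 * (μ / (1 + μ)) := by rw [ht]; ring
  rw [← hμ]
  refine le_trans ?_ (expect_le_expect fun y _ => quadratic_hits_sub_le A J I ht0 hc0 y)
  rw [expect_sub_distrib, ← mul_expect]
  linarith

end Hits

/-! ### The largest of several keys -/

theorem dens_filter_le_add {Q : ℕ} {c : ℕ} (hc : c ≤ Q) :
    ((univ.filter fun v : Fin Q => Q ≤ v + c).dens : ℝ) = c / Q := by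
  have hmap : (univ.filter fun v : Fin Q => Q ≤ v + c).map Fin.valEmbedding = Ico (Q - c) Q := by
    ext j
    simp only [mem_map, mem_filter, mem_univ, true_and, Fin.valEmbedding_apply, mem_Ico]
    constructor
    · rintro ⟨v, hv, rfl⟩
      exact ⟨by omega, v.2⟩
    · rintro ⟨h1, h2⟩
      exact ⟨⟨j, h2⟩, by simp only; omega, rfl⟩
  rw [nnratCast_dens, ← card_map Fin.valEmbedding, hmap, Nat.card_Ico, Nat.sub_sub_self hc,
    Fintype.card_fin]

section Keys

variable {ι : Type*} [Fintype ι] [DecidableEq ι] {Q : ℕ} [NeZero Q] {I : Finset ι}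

theorem expect_not_forall_key_le (hI : I.Nonempty) :
    𝔼 κ : ι → Fin Q, ind (¬ ∀ a ∈ I, Q ≤ 4 * I.card * (Q - κ a)) ≤ 1 / 4 := by
  have hI0 : 0 < I.card := hI.card_pos
  have hQ0 : (0 : ℝ) < Q := by exact_mod_cast Nat.pos_of_ne_zero (NeZero.ne Q)
  obtain ⟨c, hc⟩ : ∃ c, c = (Q - 1) / (4 * I.card) := ⟨_, rfl⟩
  have hcQ : c ≤ Q := hc ▸ (Nat.div_le_self _ _).trans (Nat.sub_le _ _)
  have hmul : 4 * I.card * c ≤ Q := hc ▸ (Nat.mul_div_le _ _).trans (Nat.sub_le _ _)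
  calc 𝔼 κ : ι → Fin Q, ind (¬ ∀ a ∈ I, Q ≤ 4 * I.card * (Q - κ a))
      ≤ 𝔼 κ : ι → Fin Q, ind (∃ a ∈ I, κ a ∈ univ.filter fun v : Fin Q => Q ≤ v + c) := by
        refine expect_le_expect fun κ _ => ind_mono fun h => ?_
        push Not at h
        obtain ⟨a, ha, hlt⟩ := h
        have : Q - κ a ≤ c := hc ▸ (Nat.le_div_iff_mul_le (by omega)).2 (by rw [mul_comm]; omega)
        exact ⟨a, ha, mem_filter.2 ⟨mem_univ _, by omega⟩⟩
    _ ≤ I.card * (c / Q) := by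
        rw [← dens_filter_le_add hcQ]
        exact expect_exists_hit_le _ I
    _ ≤ 1 / 4 := by
        have : (4 : ℝ) * I.card * c ≤ Q := by exact_mod_cast hmul
        rw [mul_div_assoc', div_le_iff₀ hQ0]
        linarith

theorem le_expect_exists_key (hI : I.Nonempty) (hQ : I.card ≤ Q) :
    3 / 4 ≤ 𝔼 κ : ι → Fin Q, ind (∃ a ∈ I, I.card * (Q - κ a) ≤ 4 * Q) := by
  by_cases h4 : I.card ≤ 4
  · obtain ⟨a, ha⟩ := hI
    have hκ (κ : ι → Fin Q) : ∃ a ∈ I, I.card * (Q - κ a) ≤ 4 * Q :=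
      ⟨a, ha, Nat.mul_le_mul h4 (Nat.sub_le _ _)⟩
    simp only [fun κ => ind_pos (hκ κ), Fintype.expect_const]
    norm_num
  have hQ0 : (0 : ℝ) < Q := by exact_mod_cast Nat.pos_of_ne_zero (NeZero.ne Q)
  obtain ⟨c, hc⟩ : ∃ c, c = 4 * Q / I.card := ⟨_, rfl⟩
  have hcQ : c ≤ Q :=
    hc ▸ Nat.div_le_of_le_mul (Nat.mul_le_mul_right _ (not_le.1 h4).le)
  have hmean : (3 : ℝ) ≤ I.card * (c / Q) := by
    have hlt : 4 * Q < I.card * c + I.card := by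
      have := Nat.lt_mul_div_succ (4 * Q) hI.card_pos
      rw [← hc] at this
      linarith
    have hltR : (4 * Q : ℝ) < I.card * c + I.card := by exact_mod_cast hlt
    have hQR : (I.card : ℝ) ≤ Q := by exact_mod_cast hQ
    rw [mul_div_assoc', le_div_iff₀ hQ0]
    linarith
  calc (3 : ℝ) / 4 ≤ I.card * (c / Q) / (1 + I.card * (c / Q)) := by
        rw [div_le_div_iff₀ (by norm_num) (by linarith)]
        linarith
    _ ≤ 𝔼 κ : ι → Fin Q, ind (∃ a ∈ I, κ a ∈ univ.filter fun v : Fin Q => Q ≤ v + c) := by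
        rw [← dens_filter_le_add hcQ]
        exact le_expect_exists_hit _ I
    _ ≤ 𝔼 κ : ι → Fin Q, ind (∃ a ∈ I, I.card * (Q - κ a) ≤ 4 * Q) := by
        refine expect_le_expect fun κ _ => ind_mono fun ⟨a, ha, hκ⟩ => ⟨a, ha, ?_⟩
        have hκ := (mem_filter.1 hκ).2
        calc I.card * (Q - κ a) ≤ I.card * c := Nat.mul_le_mul_left _ (by omega)
          _ ≤ 4 * Q := by rw [hc]; exact Nat.mul_div_le _ _

theorem half_le_expect_key (hI : I.Nonempty) (hQ : I.card ≤ Q) :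
    1 / 2 ≤ 𝔼 κ : ι → Fin Q, ind ((∀ a ∈ I, Q ≤ 4 * I.card * (Q - κ a)) ∧
      ∃ a ∈ I, I.card * (Q - κ a) ≤ 4 * Q) := by
  refine le_trans ?_ (expect_le_expect fun κ _ => ind_sub_ind_not_le _ _)
  rw [expect_sub_distrib]
  linarith [le_expect_exists_key hI hQ, expect_not_forall_key_le (Q := Q) hI]

end Keys

section Picked

variable {ι : Type*} {Q : ℕ} [NeZero Q]

/-- The elements of `I` whose ticket `σ` is at most `g` times as far from `Q` as the largest
key `κ`. -/
noncomputable def picked (g : ℕ) (I : Finset ι) (κ σ : ι → Fin Q) : Finset ι :=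
  I.filter fun a => Q ≤ σ a + g * (Q - (I.sup κ : Fin Q))

theorem half_le_expect_gap [Fintype ι] [DecidableEq ι] {I : Finset ι} (hI : I.Nonempty)
    (hQ : I.card ≤ Q) :
    1 / 2 ≤ 𝔼 κ : ι → Fin Q, ind (Q ≤ 4 * I.card * (Q - (I.sup κ : Fin Q)) ∧
      I.card * (Q - (I.sup κ : Fin Q)) ≤ 4 * Q) := by
  refine (half_le_expect_key hI hQ).trans (expect_le_expect fun κ _ => ind_mono ?_)
  rintro ⟨hall, b, hb, hbQ⟩
  obtain ⟨a, ha, hmax⟩ := exists_mem_eq_sup I hI κ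
  refine ⟨hmax ▸ hall a ha, (Nat.mul_le_mul_left _ ?_).trans hbQ⟩
  exact Nat.sub_le_sub_left (le_sup (f := κ) hb) _

theorem dens_ticket {Q : ℕ} (c : ℕ) :
    ((univ.filter fun v : Fin Q => Q ≤ v + c).dens : ℝ) = min (c : ℝ) Q / Q := by
  rw [← Nat.cast_min, ← dens_filter_le_add (min_le_right c Q)]
  congr 3
  ext v
  omega

theorem le_dens_ticket {g N w : ℕ} (hw : Q ≤ 4 * N * w) {q : ℝ} (hq0 : 0 ≤ q) (hq1 : q ≤ 1)
    (hq : 4 * N * q ≤ g) : q ≤ ((univ.filter fun v : Fin Q => Q ≤ v + g * w).dens : ℝ) := by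
  have hQ0 : (0 : ℝ) < Q := by exact_mod_cast Nat.pos_of_ne_zero (NeZero.ne Q)
  have hwR : (Q : ℝ) ≤ 4 * N * w := by exact_mod_cast hw
  rw [dens_ticket, le_div_iff₀ hQ0]
  refine le_min ?_ (mul_le_of_le_one_left hQ0.le hq1)
  calc q * Q ≤ q * (4 * N * w) := by gcongr
    _ = 4 * N * q * w := by ring
    _ ≤ g * w := by gcongr
    _ = (g * w : ℕ) := by push_cast; rfl

theorem mul_dens_ticket_le {g N w : ℕ} (hw : N * w ≤ 4 * Q) :
    N * ((univ.filter fun v : Fin Q => Q ≤ v + g * w).dens : ℝ) ≤ 4 * g := by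
  have hQ0 : (0 : ℝ) < Q := by exact_mod_cast Nat.pos_of_ne_zero (NeZero.ne Q)
  have hwR : (N * w : ℝ) ≤ 4 * Q := by exact_mod_cast hw
  rw [dens_ticket, mul_div_assoc', div_le_iff₀ hQ0]
  calc (N : ℝ) * min ((g * w : ℕ) : ℝ) Q ≤ N * (g * w : ℕ) := by gcongr; exact min_le_left _ _
    _ = g * (N * w) := by push_cast; ring
    _ ≤ g * (4 * Q) := by gcongr
    _ = 4 * g * Q := by ring

theorem le_expect_picked [Fintype ι] [DecidableEq ι] {I J : Finset ι} (hJ : J ⊆ I) (hI : I.Nonempty)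
    (hQ : I.card ≤ Q) {g c : ℕ} (hc : 4 * (1 + 4 * g) ≤ c) {q : ℝ} (hq0 : 0 ≤ q) (hq1 : q ≤ 1)
    (hq : 4 * I.card * q ≤ g) :
    1 / 4 * (J.card * q / (1 + J.card * q)) ≤ 𝔼 κ : ι → Fin Q, 𝔼 σ : ι → Fin Q,
      ind ((∃ a ∈ J, a ∈ picked g I κ σ) ∧ (picked g I κ σ).card ≤ c) := by
  have hcR : (4 : ℝ) * (1 + 4 * g) ≤ c := by exact_mod_cast hc
  let gap (κ : ι → Fin Q) : ℕ := Q - (I.sup κ : Fin Q)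
  let E (κ : ι → Fin Q) : Prop := Q ≤ 4 * I.card * gap κ ∧ I.card * gap κ ≤ 4 * Q
  have hE : 1 / 2 ≤ 𝔼 κ : ι → Fin Q, ind (E κ) := half_le_expect_gap hI hQ
  have hticket (κ : ι → Fin Q) : E κ → 1 / 2 * (J.card * q / (1 + J.card * q)) ≤
      𝔼 σ : ι → Fin Q, ind ((∃ a ∈ J, a ∈ picked g I κ σ) ∧ (picked g I κ σ).card ≤ c) := by
    rintro ⟨hlow, hhigh⟩
    let A : Finset (Fin Q) := univ.filter fun v => Q ≤ v + g * gap κ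
    have hqA : q ≤ (A.dens : ℝ) := le_dens_ticket hlow hq0 hq1 hq
    have hAI : I.card * (A.dens : ℝ) ≤ 4 * g := mul_dens_ticket_le hhigh
    calc 1 / 2 * (J.card * q / (1 + J.card * q))
        ≤ 1 / 2 * (J.card * (A.dens : ℝ) / (1 + J.card * A.dens)) := by
          refine mul_le_mul_of_nonneg_left (div_one_add_mono (by positivity) ?_) (by norm_num)
          gcongr
      _ ≤ 𝔼 σ : ι → Fin Q, ind ((∃ a ∈ J, σ a ∈ A) ∧ hits A I σ ≤ c) :=
          le_expect_exists_hit_and_hits_le A J I (by linarith)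
      _ ≤ _ := by
          refine expect_le_expect fun σ _ => ind_mono ?_
          rintro ⟨⟨a, ha, haA⟩, hle⟩
          have hcard : hits A I σ = (picked g I κ σ).card := by
            simp [hits, ind, picked, A, gap]
          exact ⟨⟨a, ha, mem_filter.2 ⟨hJ ha, (mem_filter.1 haA).2⟩⟩,
            by rw [hcard] at hle; exact_mod_cast hle⟩
  have hy : 0 ≤ 1 / 2 * (J.card * q / (1 + J.card * q)) := by positivity
  calc 1 / 4 * (J.card * q / (1 + J.card * q))
      ≤ 1 / 2 * (J.card * q / (1 + J.card * q)) * 𝔼 κ : ι → Fin Q, ind (E κ) := by nlinarith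
    _ = 𝔼 κ : ι → Fin Q, 1 / 2 * (J.card * q / (1 + J.card * q)) * ind (E κ) := mul_expect _ _ _
    _ ≤ _ := expect_le_expect fun κ _ =>
      (mul_ind_le_expect_ind_and (hticket κ)).trans
        (expect_le_expect fun σ _ => ind_mono And.right)

end Picked

/-! ### Spans over finite fields -/

theorem exists_subset_sum_eq_of_mem_span {ι V : Type*} [AddCommGroup V] [Module (ZMod 2) V]
    {f : ι → V} {X : Finset ι} {w : V} (hw : w ∈ Submodule.span (ZMod 2) (f '' X)) :
    ∃ S ⊆ X, ∑ i ∈ S, f i = w := by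
  classical
  obtain ⟨c, rfl⟩ := (Submodule.mem_span_image_finset_iff_exists_fun' _).1 hw
  refine ⟨X.filter fun i => c i = 1, filter_subset _ _, ?_⟩
  rw [sum_filter]
  have zero_or_one : ∀ a : ZMod 2, a = 0 ∨ a = 1 := by decide
  exact sum_congr rfl fun i _ => by rcases zero_or_one (c i) with h | h <;> simp [h]

theorem expect_functional_ne_zero {V : Type*} [AddCommGroup V] [Module (ZMod 2) V] [Fintype V]
    [DecidableEq V] {R : Finset V} (φ : V →ₗ[ZMod 2] ZMod 2) {e : V} (he : e ∈ R) (hφ : φ e ≠ 0) :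
    𝔼 c : V → ZMod 2, ind (φ (∑ w ∈ R, c w • w) ≠ 0) = 1 / 2 := by
  have h01 : ∀ z : ZMod 2, z = 0 ∨ z = 1 := by decide
  refine expect_half_of_flip (Equiv.addRight (Pi.single e 1)) _ fun c => ?_
  have hflip : φ (∑ w ∈ R, (Equiv.addRight (Pi.single e 1) c) w • w) =
      φ (∑ w ∈ R, c w • w) + 1 := by
    have hsum : ∑ w ∈ R, (Equiv.addRight (Pi.single e 1) c) w • w = (∑ w ∈ R, c w • w) + e := by
      simp only [Equiv.coe_addRight, Pi.add_apply, add_smul, sum_add_distrib, Pi.single_apply,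
        ite_smul, one_smul, zero_smul, sum_ite_eq', he, if_true]
    rw [hsum, map_add, (h01 _).resolve_left hφ]
  rw [hflip]
  obtain h | h := h01 (φ (∑ w ∈ R, c w • w)) <;>
    simp [h, ind, show (1 : ZMod 2) + 1 = 0 by decide]

/-- A functional on the span of `R` can be extended to `V`, and so as many functionals suffice to
test whether subsets of the span generate it as the dual space of the span has elements. -/
theorem exists_functionals_separating {K V : Type*} [Field K] [Fintype K] [AddCommGroup V]
    [Module K V] (R : Finset V) :
    ∃ Φ : Finset (V →ₗ[K] K), Φ.card ≤ Fintype.card K ^ R.card ∧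
      (∀ φ ∈ Φ, ∃ e ∈ R, φ e ≠ 0) ∧
      ∀ S : Set V, S ⊆ Submodule.span K (R : Set V) → ∀ e ∈ R, e ∉ Submodule.span K S →
        ∃ φ ∈ Φ, ∀ e ∈ S, φ e = 0 := by
  classical
  let U := Submodule.span K (R : Set V)
  have : Module.Finite K U := Module.Finite.span_finset K R
  have : Finite (U →ₗ[K] K) := Module.finite_of_finite K
  have := Fintype.ofFinite (U →ₗ[K] K)
  choose extend hextend using fun φ : U →ₗ[K] K => LinearMap.exists_extend φ
  have hextend_apply (φ : U →ₗ[K] K) {e : V} (he : e ∈ U) : extend φ e = φ ⟨e, he⟩ :=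
    LinearMap.congr_fun (hextend φ) ⟨e, he⟩
  refine ⟨(univ.filter (· ≠ 0)).image extend, ?_, ?_, fun S hS e he heS => ?_⟩
  · calc _ ≤ Fintype.card (U →ₗ[K] K) := card_image_le.trans (card_filter_le _ _)
      _ = Fintype.card K ^ Module.finrank K U := by
        rw [Module.card_eq_pow_finrank (K := K), Subspace.dual_finrank_eq]
      _ ≤ _ := Nat.pow_le_pow_right Fintype.card_pos (finrank_span_finset_le_card R)
  · simp only [mem_image, mem_filter, mem_univ, true_and, forall_exists_index, and_imp]
    rintro _ φ hφ rfl
    by_contra! hR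
    have hker : U ≤ LinearMap.ker (extend φ) := Submodule.span_le.2 hR
    exact hφ (LinearMap.ext fun e => (hextend_apply φ e.2).symm.trans (hker e.2))
  · obtain ⟨μ, hμe, hμ⟩ := Submodule.exists_le_ker_of_notMem heS
    refine ⟨_, mem_image_of_mem _ (mem_filter.2 ⟨mem_univ (μ.domRestrict U), fun h0 => hμe ?_⟩),
      fun e' he' => ?_⟩
    · exact LinearMap.congr_fun h0 ⟨e, Submodule.subset_span he⟩
    · exact (hextend_apply _ (hS he')).trans (hμ (Submodule.subset_span he'))

/-! ### The algorithm -/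

/-- The parameters of the algorithm. Tokens have `d` bits, a block has at most `blockSize` tokens,
and a node with more than `numBlocks * blockSize` undelivered tokens is heavy. `capacity` blocks
can be coded together, keys are drawn from `Fin keyRange`, hash values are elements of the field
with `2 ^ hashBits` elements, identifiers are smaller than `idRange`, and `floodLen`, `fwdLen` and
`codeLen` are the lengths of the flooding, forwarding and coding stages. -/
structure Params where
  d : ℕ
  blockSize : ℕ
  numBlocks : ℕ
  capacity : ℕ
  keyRange : ℕ
  hashBits : ℕ
  idRange : ℕ
  floodLen : ℕ
  fwdLen : ℕ
  codeLen : ℕ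
  blockSize_pos : 0 < blockSize
  numBlocks_pos : 0 < numBlocks
  keyRange_pos : 0 < keyRange
  idRange_pos : 0 < idRange
  hashBits_ne_zero : hashBits ≠ 0

namespace Params

variable (p : Params)

instance : NeZero p.numBlocks := ⟨p.numBlocks_pos.ne'⟩
instance : NeZero p.keyRange := ⟨p.keyRange_pos.ne'⟩
instance : NeZero p.idRange := ⟨p.idRange_pos.ne'⟩

/-- The tokens. -/
abbrev Tok : Type := Token p.d

/-- A block, that is, a set of tokens that fits into one message. -/
abbrev Block : Type := {B : Finset p.Tok // B.card ≤ p.blockSize}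

/-- The field of the hash values. -/
abbrev HashField : Type := GaloisField 2 p.hashBits

noncomputable instance : Fintype p.HashField := Fintype.ofFinite _

noncomputable instance : DecidableEq p.HashField := Classical.decEq _

/-- The vectors that are coded together: an index part, a block, and a hash value. -/
abbrev CodeVec : Type := (Fin p.capacity → ZMod 2) × p.HashField × p.HashField

/-- The values that are flooded; the supremum of all of them is computed. Their components are
named below. -/
abbrev FloodValue : Type :=
  WithBot (Fin p.idRange) × WithBot (Fin p.idRange) × WithBot (Fin (Fintype.card p.Tok)) ×
    WithBot (Fin p.keyRange) × WithBot (Fin (Fintype.card p.HashField)) × Bool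

namespace FloodValue

variable {p} (a : p.FloodValue)

/-- The largest identifier of a heavy node. -/
abbrev heavyId : WithBot (Fin p.idRange) := a.1

/-- The largest identifier of a node with undelivered tokens. -/
abbrev activeId : WithBot (Fin p.idRange) := a.2.1

/-- The code of the largest undelivered token. -/
abbrev topToken : WithBot (Fin (Fintype.card p.Tok)) := a.2.2.1

/-- The largest key of a block. -/
abbrev topKey : WithBot (Fin p.keyRange) := a.2.2.2.1

/-- The code of the largest seed. -/
abbrev topSeed : WithBot (Fin (Fintype.card p.HashField)) := a.2.2.2.2.1

/-- Whether some node has reported a failure of the decoding. -/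
abbrev failed : Bool := a.2.2.2.2.2

end FloodValue

/-- The messages: a block, a value that is flooded, or a linear combination of vectors. -/
abbrev Packet : Type := p.Block ⊕ p.FloodValue ⊕ p.CodeVec

/-- The random choice of a node in a round: the number of the block that it forwards, a key and a
sampling ticket for each of its blocks, a seed for the hash values, and coefficients for the
vectors. A round uses only some of these. -/
structure Coin where
  idx : Fin p.numBlocks
  key : Fin p.numBlocks → Fin p.keyRange
  ticket : Fin p.numBlocks → Fin p.keyRange
  seed : Fin (Fintype.card p.HashField)
  coef : p.CodeVec → ZMod 2

instance : Nonempty (Fin (Fintype.card p.HashField)) := ⟨⟨0, Fintype.card_pos⟩⟩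

/-- Random choices as tuples. -/
def coinEquiv : p.Coin ≃ Fin p.numBlocks × (Fin p.numBlocks → Fin p.keyRange) ×
    (Fin p.numBlocks → Fin p.keyRange) × Fin (Fintype.card p.HashField) ×
      (p.CodeVec → ZMod 2) where
  toFun x := (x.idx, x.key, x.ticket, x.seed, x.coef)
  invFun y := ⟨y.1, y.2.1, y.2.2.1, y.2.2.2.1, y.2.2.2.2⟩

noncomputable instance : Fintype p.Coin := Fintype.ofEquiv _ p.coinEquiv.symm

instance : Nonempty p.Coin := p.coinEquiv.symm.nonempty_congr.1 inferInstance

/-- The memory of a node. -/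
structure Memory where
  uid : Fin p.idRange
  /-- known tokens that are not yet delivered -/
  pending : Finset p.Tok
  /-- tokens that all nodes are known to have received -/
  delivered : Finset p.Tok
  /-- whether blocks of undelivered tokens are still forwarded at the start of a phase -/
  forwarding : Bool
  /-- the supremum of the flooded values received so far -/
  acc : p.FloodValue
  /-- the result of the first flooding of the phase -/
  elected : p.FloodValue
  ticket : Fin p.numBlocks → Fin p.keyRange
  /-- the blocks of the node that have been sampled for coding -/
  sample : Finset p.Block
  /-- the vectors received in the current coding stage -/
  vectors : Finset p.CodeVec
  decodedBlocks : Fin p.capacity → p.Block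
  out : Option (Finset p.Tok)

/-- The kinds of rounds. -/
inductive Kind
  | fwd | draw | flood | sample | code | lead | decode | finish

/-- The rounds of a phase: tokens are forwarded; a leader, the width of the sample and a seed are
elected by flooding; the sampled blocks are gathered by random linear coding; the leader
broadcasts the blocks that it knows in the same way; and failures are reported by flooding. -/
def phase : List Kind :=
  List.replicate p.fwdLen .fwd ++ ([.draw] ++ (List.replicate p.floodLen .flood ++ ([.sample] ++
    (List.replicate p.codeLen .code ++ ([.lead] ++ (List.replicate p.codeLen .code ++ ([.decode] ++
      (List.replicate p.floodLen .flood ++ [.finish]))))))))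

theorem phase_ne_nil : p.phase ≠ [] := by simp [phase]

/-- The block without tokens, which serves as a default value. -/
def emptyBlock : p.Block := ⟨∅, by simp⟩

open Classical in
/-- The `i`-th block of the token set `T`. -/
noncomputable def block (T : Finset p.Tok) (i : ℕ) : p.Block :=
  ⟨T.filter fun τ => rank T τ / p.blockSize = i, by
    calc _ = ((T.filter fun τ => rank T τ / p.blockSize = i).image (rank T)).card :=
          (card_image_of_injOn ((rank_injOn T).mono (coe_subset.2 (filter_subset _ _)))).symm
      _ ≤ (Finset.Ico (i * p.blockSize) (i * p.blockSize + p.blockSize)).card := by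
          refine card_le_card fun j hj => ?_
          obtain ⟨τ, hτ, rfl⟩ := mem_image.1 hj
          obtain ⟨h1, h2⟩ := (Nat.div_eq_iff p.blockSize_pos).1 (mem_filter.1 hτ).2
          have := p.blockSize_pos
          rw [mem_Ico]
          omega
      _ = p.blockSize := by simp⟩

/-- Blocks as elements of the field. -/
noncomputable def blockCode : p.Block → p.HashField := someInj _ _

/-- The vector of a block in the first coding stage, with its hash value for the seed `a`. -/
noncomputable def hashVec (a : p.HashField) (B : p.Block) : p.CodeVec :=
  (0, p.blockCode B, (a + p.blockCode B)⁻¹)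

/-- The vector of a block in the second coding stage, with an index. -/
noncomputable def indexVec (j : Fin p.capacity) (B : p.Block) : p.CodeVec :=
  (Pi.single j 1, p.blockCode B, 0)

/-- The seed `a` is good for the blocks in `X` if no sum of at least two of their vectors is the
vector of a block. A node can then tell the blocks that have been sampled from the vectors that it
has received, although it does not know which nodes have sampled blocks. -/
def GoodSeed (a : p.HashField) (X : Finset p.Block) : Prop :=
  ∀ S ⊆ X, ∀ z : p.Block, ∑ B ∈ S, p.hashVec a B = p.hashVec a z → ∃ B, S = {B}

/-- The subspace generated by a set of vectors. -/
noncomputable abbrev spanOf (R : Finset p.CodeVec) : Submodule (ZMod 2) p.CodeVec :=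
  Submodule.span (ZMod 2) (R : Set p.CodeVec)

open Classical in
/-- The blocks whose vectors can be computed from the vectors in `R`. -/
noncomputable def decodable (a : p.HashField) (R : Finset p.CodeVec) : Finset p.Block :=
  univ.filter fun B => p.hashVec a B ∈ p.spanOf R

/-- An enumeration of (at most `capacity`) blocks in `Y`, filled up with empty blocks. -/
noncomputable def listing (Y : Finset p.Block) (j : Fin p.capacity) : p.Block :=
  if h : (j : ℕ) < Y.card then (Y.equivFin.symm ⟨j, h⟩ : Y) else p.emptyBlock

/-- Tokens as numbers, so that they can be compared. -/
noncomputable def tokCode : p.Tok ≃ Fin (Fintype.card p.Tok) := Fintype.equivFin _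

open Classical in
/-- The set that consists of the token with the given code, if there is one. -/
noncomputable def tokSet (i : WithBot (Fin (Fintype.card p.Tok))) : Finset p.Tok :=
  univ.filter fun τ => (p.tokCode τ : WithBot (Fin (Fintype.card p.Tok))) = i

/-- The seed in a flooded value. -/
noncomputable def seedOf (a : p.FloodValue) : p.HashField :=
  (Fintype.equivFin p.HashField).symm (WithBot.unbotD ⟨0, Fintype.card_pos⟩ a.topSeed)

/-- A block is sampled if its ticket is at least `keyRange - sampleWidth`. As the gap between
`keyRange` and the largest of `i` random keys is about `keyRange / i`, roughly `numBlocks` blocks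
are sampled in the whole network. -/
def sampleWidth (a : p.FloodValue) : ℕ :=
  p.numBlocks * (p.keyRange - (WithBot.unbotD 0 a.topKey : Fin p.keyRange))

/-- The flooded value that only reports whether there is a failure. -/
def failureFlag (f : Bool) : p.FloodValue := (⊥, ⊥, ⊥, ⊥, ⊥, f)

open Classical in
/-- The tokens in the blocks among the received messages. -/
noncomputable def receivedTokens (M : Multiset p.Packet) : Finset p.Tok :=
  M.toFinset.biUnion fun μ => match μ with
    | .inl B => B.1
    | _ => ∅

/-- The supremum of the flooded values among the received messages. -/
noncomputable def receivedFlood (M : Multiset p.Packet) : p.FloodValue :=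
  (M.map fun μ => match μ with
    | .inr (.inl a) => a
    | _ => (⊥ : p.FloodValue)).sup

open Classical in
/-- The vectors among the received messages. -/
noncomputable def receivedVecs (M : Multiset p.Packet) : Finset p.CodeVec :=
  M.toFinset.biUnion fun μ => match μ with
    | .inr (.inr w) => {w}
    | _ => ∅

variable {p}

/-- The message of a node. -/
noncomputable def packet (k : Kind) (m : p.Memory) (x : p.Coin) : p.Packet :=
  match k with
  | .fwd => .inl (p.block m.pending x.idx)
  | .flood => .inr (.inl m.acc)
  | .code => .inr (.inr (∑ w ∈ m.vectors, x.coef w • w))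
  | _ => .inl p.emptyBlock

namespace Memory

variable (m : p.Memory)

open Classical in
/-- What a node contributes to the first flooding of a phase. -/
noncomputable def drawn (x : p.Coin) : p.FloodValue :=
  (if p.numBlocks * p.blockSize < m.pending.card then (m.uid : WithBot (Fin p.idRange)) else ⊥,
    if m.pending.Nonempty then (m.uid : WithBot (Fin p.idRange)) else ⊥,
    m.pending.sup fun τ => (p.tokCode τ : WithBot (Fin (Fintype.card p.Tok))),
    (univ.filter fun i : Fin p.numBlocks => (p.block m.pending i).1.Nonempty).sup fun i =>
      (x.key i : WithBot (Fin p.keyRange)),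
    (x.seed : WithBot (Fin (Fintype.card p.HashField))), false)

open Classical in
/-- The blocks that a node samples; there are none if a heavy node has been found. -/
noncomputable def sampled : Finset p.Block :=
  if m.acc.heavyId = ⊥ then
    (univ.filter fun i : Fin p.numBlocks => (p.block m.pending i).1.Nonempty ∧
      p.keyRange ≤ m.ticket i + p.sampleWidth m.acc).image
        fun i : Fin p.numBlocks => p.block m.pending i
  else ∅

open Classical in
/-- The memory after a round in which the result of the first flooding is evaluated. -/
noncomputable def afterSample : p.Memory :=
  { m with
    elected := m.acc
    forwarding := m.forwarding && decide (m.acc.heavyId ≠ ⊥)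
    sample := m.sampled
    vectors := m.sampled.image (p.hashVec (p.seedOf m.acc)) }

open Classical in
/-- The identifier of the node that broadcasts. -/
noncomputable def leader : WithBot (Fin p.idRange) :=
  if m.elected.heavyId = ⊥ then m.elected.activeId else m.elected.heavyId

open Classical in
/-- The blocks that a leader broadcasts: its own blocks if it is heavy, and otherwise those that
it has decoded. -/
noncomputable def broadcast : Fin p.capacity → p.Block :=
  if m.elected.heavyId = ⊥ then
    if p.GoodSeed (p.seedOf m.elected) (p.decodable (p.seedOf m.elected) m.vectors) then
      p.listing (p.decodable (p.seedOf m.elected) m.vectors)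
    else fun _ => p.emptyBlock
  else fun j => if (j : ℕ) < p.numBlocks then p.block m.pending j else p.emptyBlock

open Classical in
/-- The memory at the start of the second coding stage. -/
noncomputable def afterLead : p.Memory :=
  { m with
    vectors :=
      if m.leader = m.uid then univ.image fun j => p.indexVec j (m.broadcast j) else ∅ }

open Classical in
/-- The `j`-th broadcast block, as it is decoded from the received vectors. -/
noncomputable def decoded (j : Fin p.capacity) : p.Block :=
  if h : ∃ B, p.indexVec j B ∈ p.spanOf m.vectors then h.choose else p.emptyBlock

/-- All broadcast blocks can be decoded, and the sampled blocks of the node are among them. -/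
def DecodeOk : Prop :=
  (∀ j, ∃ B, p.indexVec j B ∈ p.spanOf m.vectors) ∧ ∀ B ∈ m.sample, ∃ j, m.decoded j = B

open Classical in
/-- The memory after the broadcast blocks have been decoded. -/
noncomputable def afterDecode : p.Memory :=
  { m with
    decodedBlocks := m.decoded
    acc := p.failureFlag (decide (¬ m.DecodeOk)) }

open Classical in
/-- The tokens that are delivered in a phase. The largest token, which has been flooded, is
delivered even after a failure, and so the algorithm always terminates. -/
noncomputable def removed : Finset p.Tok :=
  (if m.acc.failed then ∅ else univ.biUnion fun j => (m.decodedBlocks j).1) ∪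
    p.tokSet m.elected.topToken

open Classical in
/-- The memory at the end of a phase. The node terminates if there are no undelivered tokens. -/
noncomputable def afterFinish : p.Memory :=
  if m.elected.activeId = ⊥ then { m with out := some m.delivered }
  else { m with pending := m.pending \ m.removed, delivered := m.delivered ∪ m.removed }

end Memory

open Classical in
/-- The memory of a node after a round of kind `k` in which it receives the messages in `M`. -/
noncomputable def update (k : Kind) (m : p.Memory) (x : p.Coin) (M : Multiset p.Packet) :
    p.Memory :=
  match k with
  | .fwd =>
    { m with pending := if m.forwarding then m.pending ∪ p.receivedTokens M else m.pending }
  | .draw => { m with acc := m.drawn x, ticket := x.ticket }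
  | .flood => { m with acc := m.acc ⊔ p.receivedFlood M }
  | .sample => m.afterSample
  | .code => { m with vectors := m.vectors ∪ p.receivedVecs M }
  | .lead => m.afterLead
  | .decode => m.afterDecode
  | .finish => m.afterFinish

variable (p)

/-- The kind of round `t`. -/
def schedule (t : ℕ) : Kind :=
  p.phase[t % p.phase.length]'(Nat.mod_lt _ (List.length_pos_of_ne_nil p.phase_ne_nil))

/-- The kinds of the first `t` rounds. -/
def kinds : ℕ → List Kind
  | 0 => []
  | t + 1 => kinds t ++ [p.schedule t]

/-- The initial memory of a node with the identifier `u` and the tokens in `S`. -/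
def initMemory (u : ℕ) (S : Finset p.Tok) : p.Memory where
  uid := Fin.ofNat p.idRange u
  pending := S
  delivered := ∅
  forwarding := true
  acc := ⊥
  elected := ⊥
  ticket := fun _ => 0
  sample := ∅
  vectors := ∅
  decodedBlocks := fun _ => p.emptyBlock
  out := none

/-- Messages as bit strings, provided that `b` bits are enough. -/
noncomputable def encode (b : ℕ) : p.Packet → Message b := someInj _ _

instance : Nonempty p.Packet := ⟨.inl p.emptyBlock⟩

/-- The inverse of `encode`. -/
noncomputable def decode (b : ℕ) : Message b → p.Packet := Function.invFun (p.encode b)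

/-- The algorithm with `b`-bit messages. Besides its memory, a node counts the rounds. -/
noncomputable def machine (b : ℕ) : Algorithm b p.d where
  State := ℕ × p.Memory
  Coin := p.Coin
  coinFintype := inferInstance
  coinNonempty := inferInstance
  init u S := (0, p.initMemory u S)
  message s x := p.encode b (packet (p.schedule s.1) s.2 x)
  update s x M := (s.1 + 1, update (p.schedule s.1) s.2 x (M.map (p.decode b)))
  output s := s.2.out

variable {p} {n : ℕ}

open Classical in
/-- A round of kind `k` on the graph `G`, acting on the memories of all nodes. -/
noncomputable def roundStep (k : Kind) (G : ConnectedGraph (Fin n)) (m : Fin n → p.Memory)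
    (x : Fin n → p.Coin) : Fin n → p.Memory := fun v =>
  if (m v).out.isSome then m v
  else update k (m v) (x v)
    ((univ.filter fun w => G.1.Adj v w ∧ ¬ (m w).out.isSome).val.map
      fun w => packet k (m w) (x w))

/-! ### From executions of the algorithm to memories -/

theorem snd_machine_step {b : ℕ} (henc : Function.Injective (p.encode b)) (t : ℕ)
    (G : ConnectedGraph (Fin n)) (s : Fin n → (p.machine b).State) (x : Fin n → (p.machine b).Coin)
    (hclock : ∀ v, ¬ (s v).2.out.isSome → (s v).1 = t) :
    (fun v => ((p.machine b).step G.1 s x v).2) =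
      roundStep (p.schedule t) G (fun v => (s v).2) x := by
  classical
  funext v
  simp only [Algorithm.step, roundStep]
  by_cases h : (s v).2.out.isSome
  · rw [if_pos h, if_pos (show (p.machine b).Halted _ from h)]
  rw [if_neg h, if_neg (show ¬ (p.machine b).Halted _ from h)]
  change update (p.schedule _) (s v).2 _ _ = _
  rw [hclock v h]
  refine congrArg (update _ _ _) ((Multiset.map_map _ _ _).trans ?_)
  refine Multiset.map_congr (congrArg Finset.val (filter_congr fun w _ => Iff.rfl)) fun w hw => ?_
  have hw' : ¬ (s w).2.out.isSome := (mem_filter.1 (mem_def.2 hw)).2.2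
  change p.decode b (p.encode b (packet (p.schedule _) _ _)) = _
  rw [hclock w hw', decode, Function.leftInverse_invFun henc]

section Simulation

variable {b : ℕ} (uid : Fin n → ℕ) (tok : Fin n → Finset (Token p.d)) (adv : Adversary n p.Coin)

/-- The memories of all nodes after `t` rounds. -/
noncomputable def memories (b : ℕ) (t : ℕ) (x : Fin t → Fin n → p.Coin) (v : Fin n) : p.Memory :=
  ((p.machine b).run uid tok adv t x v).2

theorem run_clock (t : ℕ) (x : Fin t → Fin n → p.Coin) (v : Fin n)
    (h : ¬ (memories uid tok adv b t x v).out.isSome) :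
    ((p.machine b).run uid tok adv t x v).1 = t := by
  induction t generalizing v with
  | zero => rfl
  | succ t ih =>
    simp only [memories, Algorithm.run, Algorithm.step] at h
    simp only [Algorithm.run, Algorithm.step]
    split_ifs at h ⊢ with halted
    · exact absurd halted h
    · exact congrArg (· + 1) (ih (Fin.init x) v halted)

theorem memories_succ (henc : Function.Injective (p.encode b)) (t : ℕ)
    (x : Fin (t + 1) → Fin n → p.Coin) :
    memories uid tok adv b (t + 1) x =
      roundStep (p.schedule t) ⟨_, adv.connected t (Fin.init x)⟩
        (memories uid tok adv b t (Fin.init x)) (x (Fin.last t)) :=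
  snd_machine_step henc t ⟨_, adv.connected t (Fin.init x)⟩
    ((p.machine b).run uid tok adv t (Fin.init x)) (x (Fin.last t))
    (run_clock uid tok adv t (Fin.init x))

theorem memories_reach (henc : Function.Injective (p.encode b)) (t : ℕ)
    (x : Fin t → Fin n → p.Coin) :
    Reach roundStep (p.kinds t) (fun v => p.initMemory (uid v) (tok v))
      (memories uid tok adv b t x) := by
  induction t with
  | zero => rfl
  | succ t ih =>
    rw [kinds, reach_append]
    exact ⟨_, ih (Fin.init x), _, x (Fin.last t), memories_succ uid tok adv henc t x⟩

theorem expect_memories_le (henc : Function.Injective (p.encode b)) (t : ℕ)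
    (f : (Fin n → p.Memory) → ℝ) :
    𝔼 x : Fin t → Fin n → p.Coin, f (memories uid tok adv b t x) ≤
      supExpect roundStep (p.kinds t) f (fun v => p.initMemory (uid v) (tok v)) := by
  induction t generalizing f with
  | zero =>
    rw [Fintype.expect_eq_sum_div_card]
    simp only [kinds, supExpect, Fintype.card_unique, univ_unique, sum_singleton, Nat.cast_one,
      div_one]
    exact le_rfl
  | succ t ih =>
    rw [kinds, supExpect_append]
    calc 𝔼 x : Fin (t + 1) → Fin n → p.Coin, f (memories uid tok adv b (t + 1) x)
        = 𝔼 y : (Fin n → p.Coin) × (Fin t → Fin n → p.Coin),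
            f (roundStep (p.schedule t) ⟨_, adv.connected t y.2⟩
              (memories uid tok adv b t y.2) y.1) := by
          refine (Fintype.expect_equiv (Fin.snocEquiv fun _ => Fin n → p.Coin) _ _ fun y => ?_).symm
          rw [memories_succ uid tok adv henc]
          simp [Fin.snocEquiv]
      _ = 𝔼 x : Fin t → Fin n → p.Coin, 𝔼 y : Fin n → p.Coin,
            f (roundStep (p.schedule t) ⟨_, adv.connected t x⟩ (memories uid tok adv b t x) y) := by
          rw [← univ_product_univ, expect_product, expect_comm]
      _ ≤ 𝔼 x : Fin t → Fin n → p.Coin,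
            supExpect roundStep [p.schedule t] f (memories uid tok adv b t x) :=
          expect_le_expect fun x _ => expect_le_supExpect_cons (p.schedule t) [] f _ _
      _ ≤ _ := ih _

theorem haltProb_eq (t : ℕ) :
    (p.machine b).haltProb uid tok adv t = 1 - 𝔼 x : Fin t → Fin n → p.Coin,
      ind (¬ ∀ v, (memories uid tok adv b t x v).out.isSome) := by
  classical
  rw [← Fintype.expect_const (ι := Fin t → Fin n → p.Coin) (1 : ℝ), ← expect_sub_distrib,
    Fintype.expect_eq_sum_div_card]
  change (Nat.card {x : Fin t → Fin n → p.Coin //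
      ∀ v, (memories uid tok adv b t x v).out.isSome} : ℝ) /
    (Nat.card (Fin t → Fin n → p.Coin) : ℝ) = _
  rw [Nat.card_eq_fintype_card, Nat.card_eq_fintype_card, Fintype.card_subtype, card_filter,
    Nat.cast_sum]
  congr 1
  refine sum_congr rfl fun x _ => ?_
  by_cases hx : ∀ v, (memories uid tok adv b t x v).out.isSome
  · rw [if_pos hx, ind_neg (not_not.2 hx)]; simp
  · rw [if_neg hx, ind_pos hx]; simp

theorem one_sub_supExpect_le_haltProb (henc : Function.Injective (p.encode b)) (t : ℕ) :
    1 - supExpect roundStep (p.kinds t) (fun m => ind (¬ ∀ v, (m v).out.isSome))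
      (fun v => p.initMemory (uid v) (tok v)) ≤ (p.machine b).haltProb uid tok adv t := by
  rw [haltProb_eq]
  exact sub_le_sub_left (expect_memories_le uid tok adv henc t _) 1

end Simulation

/-! ### Blocks and their vectors -/

theorem card_tok : Fintype.card p.Tok = 2 ^ p.d := by simp

theorem card_hashField : Fintype.card p.HashField = 2 ^ p.hashBits := by
  rw [← Nat.card_eq_fintype_card, GaloisField.card 2 p.hashBits p.hashBits_ne_zero]

theorem card_block_le : Fintype.card p.Block ≤ (2 ^ p.d + 1) ^ p.blockSize := by
  classical
  let entry (B : p.Block) (i : Fin p.blockSize) : Option p.Tok :=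
    if h : (i : ℕ) < B.1.card then some (B.1.equivFin.symm ⟨i, h⟩ : B.1) else none
  have mem_iff (B : p.Block) τ : τ ∈ B.1 ↔ ∃ i, entry B i = some τ := by
    constructor
    · intro hτ
      exact ⟨⟨B.1.equivFin ⟨τ, hτ⟩, (Fin.is_lt _).trans_le B.2⟩, by simp [entry]⟩
    · rintro ⟨i, hi⟩
      simp only [entry] at hi
      split_ifs at hi with h
      exact Option.some.inj hi ▸ (B.1.equivFin.symm ⟨i, h⟩).2
  have hinj : Function.Injective entry := fun B B' h =>
    Subtype.ext (Finset.ext fun τ => by rw [mem_iff, mem_iff, h])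
  exact (Fintype.card_le_of_injective entry hinj).trans (by simp)

theorem card_floodValue : Fintype.card p.FloodValue =
    (p.idRange + 1) * ((p.idRange + 1) * ((2 ^ p.d + 1) *
      ((p.keyRange + 1) * ((2 ^ p.hashBits + 1) * 2)))) := by
  have card_withBot (k : ℕ) : Fintype.card (WithBot (Fin k)) = k + 1 :=
    (Fintype.card_option (α := Fin k)).trans (by simp)
  simp only [Fintype.card_prod, card_withBot, card_tok, card_hashField, Fintype.card_bool]

theorem card_codeVec :
    Fintype.card p.CodeVec = 2 ^ p.capacity * (2 ^ p.hashBits * 2 ^ p.hashBits) := by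
  simp only [Fintype.card_prod, card_hashField, Fintype.card_fun, ZMod.card, Fintype.card_fin]

theorem encode_injective {b : ℕ}
    (h : Fintype.card p.Block + (Fintype.card p.FloodValue + Fintype.card p.CodeVec) ≤ 2 ^ b) :
    Function.Injective (p.encode b) :=
  someInj_injective (by simpa [Fintype.card_sum] using h)

theorem blockCode_injective (h : (2 ^ p.d + 1) ^ p.blockSize ≤ 2 ^ p.hashBits) :
    Function.Injective p.blockCode :=
  someInj_injective (by rw [card_hashField]; exact card_block_le.trans h)

theorem mem_block {T : Finset p.Tok} {i : ℕ} {τ : p.Tok} :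
    τ ∈ (p.block T i).1 ↔ τ ∈ T ∧ rank T τ / p.blockSize = i := by
  classical
  simp [block]

theorem exists_mem_block {T : Finset p.Tok} {τ : p.Tok} (hτ : τ ∈ T)
    (h : rank T τ < p.numBlocks * p.blockSize) : ∃ i : Fin p.numBlocks, τ ∈ (p.block T i).1 :=
  ⟨⟨rank T τ / p.blockSize, Nat.div_lt_of_lt_mul (by rwa [mul_comm])⟩, mem_block.2 ⟨hτ, rfl⟩⟩

open Classical in
theorem card_nonempty_block_le (T : Finset p.Tok) :
    (univ.filter fun i : Fin p.numBlocks => (p.block T i).1.Nonempty).card ≤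
      T.card / p.blockSize + 1 := by
  calc _ = ((univ.filter fun i : Fin p.numBlocks => (p.block T i).1.Nonempty).image
          (fun i : Fin p.numBlocks => (i : ℕ))).card :=
        (card_image_of_injective _ Fin.val_injective).symm
    _ ≤ (range (T.card / p.blockSize + 1)).card := by
        refine card_le_card fun j hj => ?_
        obtain ⟨i, hi, rfl⟩ := mem_image.1 hj
        obtain ⟨τ, hτ⟩ := (mem_filter.1 hi).2
        obtain ⟨hτ, h⟩ := mem_block.1 hτ
        rw [mem_range, ← h]
        exact Nat.lt_succ_of_le (Nat.div_le_div_right (rank_lt hτ).le)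
    _ = _ := card_range _

open Classical in
theorem le_card_biUnion_block {T : Finset p.Tok} (hT : p.numBlocks * p.blockSize ≤ T.card) :
    p.numBlocks * p.blockSize ≤
      (univ.biUnion fun i : Fin p.numBlocks => (p.block T i).1).card := by
  calc p.numBlocks * p.blockSize = (range (p.numBlocks * p.blockSize)).card := (card_range _).symm
    _ ≤ ((univ.biUnion fun i : Fin p.numBlocks => (p.block T i).1).image (rank T)).card := by
        refine card_le_card fun j hj => ?_
        rw [mem_range] at hj
        obtain ⟨τ, hτ, rfl⟩ := exists_rank_eq (hj.trans_le hT)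
        exact mem_image_of_mem _ (by simpa using exists_mem_block hτ hj)
    _ ≤ _ := card_image_le

theorem listing_mem (Y : Finset p.Block) (j : Fin p.capacity) :
    p.listing Y j ∈ Y ∨ p.listing Y j = p.emptyBlock := by
  rw [listing]
  split_ifs with h
  · exact Or.inl (Y.equivFin.symm ⟨j, h⟩).2
  · exact Or.inr rfl

theorem exists_listing_eq {Y : Finset p.Block} (hY : Y.card ≤ p.capacity) {B : p.Block}
    (hB : B ∈ Y) : ∃ j, p.listing Y j = B :=
  ⟨⟨Y.equivFin ⟨B, hB⟩, (Fin.is_lt _).trans_le hY⟩, by simp [listing]⟩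

theorem hashVec_injective (hinj : Function.Injective p.blockCode) (a : p.HashField) :
    Function.Injective (p.hashVec a) := fun B B' h => by
  simp only [hashVec, Prod.mk.injEq] at h
  exact hinj h.2.1

theorem GoodSeed.mem_of_mem_span [DecidableEq p.CodeVec] {a : p.HashField} {X Y : Finset p.Block}
    (hY : p.GoodSeed a Y) (hinj : Function.Injective p.blockCode) (hXY : X ⊆ Y) {B : p.Block}
    (hB : p.hashVec a B ∈ p.spanOf (X.image (p.hashVec a))) : B ∈ X := by
  rw [spanOf, coe_image] at hB
  obtain ⟨S, hSX, hS⟩ := exists_subset_sum_eq_of_mem_span hB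
  obtain ⟨C, rfl⟩ := hY S (hSX.trans hXY) B hS
  rw [sum_singleton] at hS
  exact hashVec_injective hinj a hS ▸ singleton_subset_iff.1 hSX

theorem eq_of_indexVec_mem_span [DecidableEq p.CodeVec] (hinj : Function.Injective p.blockCode)
    {D : Fin p.capacity → p.Block} {j : Fin p.capacity} {B : p.Block}
    (hB : p.indexVec j B ∈ p.spanOf (univ.image fun j => p.indexVec j (D j))) : B = D j := by
  -- The linear map `(c, y, z) ↦ y - ∑ i, c i * code (D i)` vanishes on all generators.
  let φ : p.CodeVec →ₗ[ZMod 2] p.HashField :=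
    LinearMap.fst (ZMod 2) p.HashField p.HashField ∘ₗ LinearMap.snd (ZMod 2) _ _ -
      (∑ i, (LinearMap.proj i : (Fin p.capacity → ZMod 2) →ₗ[ZMod 2] ZMod 2).smulRight
        (p.blockCode (D i))) ∘ₗ LinearMap.fst (ZMod 2) _ _
  have hφ (j B) : φ (p.indexVec j B) = p.blockCode B - p.blockCode (D j) := by
    simp [φ, indexVec, Pi.single_apply]
  have span_le : p.spanOf (univ.image fun j => p.indexVec j (D j)) ≤ LinearMap.ker φ := by
    refine Submodule.span_le.2 fun w hw => ?_
    obtain ⟨i, -, rfl⟩ := mem_image.1 (mem_coe.1 hw)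
    simp [hφ]
  have h0 : φ (p.indexVec j B) = 0 := span_le hB
  rw [hφ, sub_eq_zero] at h0
  exact hinj h0

theorem exists_sum_inv_eq_of_not_goodSeed [DecidableEq p.HashField]
    (hinj : Function.Injective p.blockCode) {X : Finset p.Block} {a : p.HashField}
    (ha : ¬ p.GoodSeed a X) :
    ∃ S ⊆ X, S.card ≠ 1 ∧ ∑ x ∈ S.image p.blockCode, (a + x)⁻¹ =
      (a + ∑ x ∈ S.image p.blockCode, x)⁻¹ := by
  simp only [GoodSeed, not_forall] at ha
  obtain ⟨S, hS, z, hz, hne⟩ := ha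
  refine ⟨S, hS, fun h => hne (card_eq_one.1 h), ?_⟩
  rw [sum_image hinj.injOn, sum_image hinj.injOn]
  have hblock := congrArg (fun w : p.CodeVec => w.2.1) hz
  have hhash := congrArg (fun w : p.CodeVec => w.2.2) hz
  simp only [Prod.snd_sum, Prod.fst_sum, hashVec] at hblock hhash
  rw [hhash, hblock]

theorem card_not_goodSeed_le (hinj : Function.Injective p.blockCode) {X : Finset p.Block}
    (hX : X.card ≤ p.capacity) [DecidablePred fun a => ¬ p.GoodSeed a X] :
    (univ.filter fun a : p.HashField => ¬ p.GoodSeed a X).card ≤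
      2 ^ p.capacity * (2 * p.capacity + 1) := by
  classical
  calc _ ≤ ((X.powerset.filter fun S => S.card ≠ 1).biUnion fun S =>
        univ.filter fun a : p.HashField => ∑ x ∈ S.image p.blockCode, (a + x)⁻¹ =
          (a + ∑ x ∈ S.image p.blockCode, x)⁻¹).card := by
        refine card_le_card fun a ha => ?_
        obtain ⟨S, hS, h1, h⟩ := exists_sum_inv_eq_of_not_goodSeed hinj (mem_filter.1 ha).2
        exact mem_biUnion.2 ⟨S, mem_filter.2 ⟨mem_powerset.2 hS, h1⟩, by simpa using h⟩
    _ ≤ ∑ S ∈ X.powerset.filter fun S => S.card ≠ 1, (2 * p.capacity + 1) := by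
        refine card_biUnion_le.trans (sum_le_sum fun S hS => ?_)
        obtain ⟨hS, h1⟩ := mem_filter.1 hS
        have hcard : (S.image p.blockCode).card = S.card := card_image_of_injective _ hinj
        refine (card_sum_inv_eq_inv_le (by rwa [hcard])).trans ?_
        have := card_le_card (mem_powerset.1 hS)
        omega
    _ ≤ ∑ S ∈ X.powerset, (2 * p.capacity + 1) := sum_le_sum_of_subset (filter_subset _ _)
    _ = 2 ^ X.card * (2 * p.capacity + 1) := by rw [sum_const, card_powerset, smul_eq_mul]
    _ ≤ _ := Nat.mul_le_mul_right _ (Nat.pow_le_pow_right (by norm_num) hX)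

theorem expect_coin_idx (f : Fin p.numBlocks → ℝ) : 𝔼 y : p.Coin, f y.idx = 𝔼 i, f i := by
  rw [Fintype.expect_equiv p.coinEquiv (fun y => f y.idx) (fun y => f y.1) (fun _ => rfl),
    ← univ_product_univ, expect_product]
  simp

theorem expect_coin_coef (f : (p.CodeVec → ZMod 2) → ℝ) : 𝔼 y : p.Coin, f y.coef = 𝔼 i, f i := by
  rw [Fintype.expect_equiv p.coinEquiv (fun y => f y.coef) (fun y => f y.2.2.2.2) (fun _ => rfl)]
  simp only [← univ_product_univ, expect_product]
  simp

/-- No node has terminated. -/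
def Running (m : Fin n → p.Memory) : Prop := ∀ v, (m v).out = none

open Classical in
/-- The messages that `v` receives if no node has terminated. -/
noncomputable def inbox (k : Kind) (G : ConnectedGraph (Fin n)) (m : Fin n → p.Memory)
    (x : Fin n → p.Coin) (v : Fin n) : Multiset p.Packet :=
  (univ.filter fun w => G.1.Adj v w).val.map fun w => packet k (m w) (x w)

theorem roundStep_apply {m : Fin n → p.Memory} (hm : Running m) (k : Kind)
    (G : ConnectedGraph (Fin n)) (x : Fin n → p.Coin) (v : Fin n) :
    roundStep k G m x v = update k (m v) (x v) (inbox k G m x v) := by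
  classical
  have hf : (univ.filter fun w => G.1.Adj v w ∧ ¬ (m w).out.isSome) =
      univ.filter fun w => G.1.Adj v w := by
    ext w; simp [hm w]
  rw [roundStep, if_neg (by simp [hm v]), inbox]
  convert rfl using 4
  convert hf.symm

section Inbox

variable {G : ConnectedGraph (Fin n)} {m : Fin n → p.Memory} {x : Fin n → p.Coin} {v : Fin n}

theorem mem_inbox {k : Kind} {μ : p.Packet} :
    μ ∈ inbox k G m x v ↔ ∃ w, G.1.Adj v w ∧ packet k (m w) (x w) = μ := by
  simp [inbox]

theorem mem_receivedTokens_inbox {τ : p.Tok} :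
    τ ∈ p.receivedTokens (inbox .fwd G m x v) ↔
      ∃ w, G.1.Adj v w ∧ τ ∈ (p.block (m w).pending (x w).idx).1 := by
  simp only [receivedTokens, mem_biUnion, Multiset.mem_toFinset, mem_inbox, packet]
  constructor
  · rintro ⟨_, ⟨w, hw, rfl⟩, h⟩
    exact ⟨w, hw, h⟩
  · rintro ⟨w, hw, h⟩
    exact ⟨_, ⟨w, hw, rfl⟩, h⟩

theorem mem_receivedVecs_inbox {e : p.CodeVec} :
    e ∈ p.receivedVecs (inbox .code G m x v) ↔
      ∃ w, G.1.Adj v w ∧ e = ∑ w' ∈ (m w).vectors, (x w).coef w' • w' := by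
  simp only [receivedVecs, mem_biUnion, Multiset.mem_toFinset, mem_inbox, packet]
  constructor
  · rintro ⟨_, ⟨w, hw, rfl⟩, h⟩
    exact ⟨w, hw, by simpa using h⟩
  · rintro ⟨w, hw, h⟩
    exact ⟨_, ⟨w, hw, rfl⟩, by simpa using h⟩

theorem receivedFlood_inbox_le {a : p.FloodValue} :
    p.receivedFlood (inbox .flood G m x v) ≤ a ↔ ∀ w, G.1.Adj v w → (m w).acc ≤ a := by
  simp only [receivedFlood, Multiset.sup_le, Multiset.mem_map, mem_inbox, packet]
  constructor
  · intro h w hw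
    exact h _ ⟨_, ⟨w, hw, rfl⟩, rfl⟩
  · rintro h _ ⟨_, ⟨w, hw, rfl⟩, rfl⟩
    exact h w hw

end Inbox

/-! ### Flooding -/

theorem roundStep_flood {m : Fin n → p.Memory} (hm : Running m) (G : ConnectedGraph (Fin n))
    (x : Fin n → p.Coin) :
    roundStep .flood G m x = fun v =>
      { m v with acc := (m v).acc ⊔ p.receivedFlood (inbox .flood G m x v) } :=
  funext fun v => roundStep_apply hm _ _ _ v

theorem flood_reach_bounds {L : ℕ} {m m' : Fin n → p.Memory} (hm : Running m)
    (h : Reach roundStep (List.replicate L Kind.flood) m m') :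
    ∃ a : Fin n → p.FloodValue, m' = (fun v => { m v with acc := a v }) ∧
      ∀ v, a v ≤ univ.sup fun w => (m w).acc := by
  refine Reach.invariant (I := fun m₁ => ∃ a : Fin n → p.FloodValue,
    m₁ = (fun v => { m v with acc := a v }) ∧ ∀ v, a v ≤ univ.sup fun w => (m w).acc)
    ?_ h ⟨fun v => (m v).acc, rfl, fun v => le_sup (f := fun w => (m w).acc) (mem_univ v)⟩
  rintro k hk G _ x ⟨a, rfl, ha⟩
  rw [List.eq_of_mem_replicate hk]
  exact ⟨_, roundStep_flood (m := fun v => { m v with acc := a v }) hm G x,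
    fun v => sup_le (ha v) (receivedFlood_inbox_le.2 fun w _ => ha w)⟩

open Classical in
theorem grows_flood (a : p.FloodValue) :
    Grows roundStep Kind.flood (fun m : Fin n → p.Memory => Running m ∧ ∃ v, a ≤ (m v).acc)
      (fun m => univ.filter fun v => a ≤ (m v).acc) where
  preserves := by
    rintro G m x ⟨hm, v, hv⟩
    rw [roundStep_flood hm]
    exact ⟨hm, v, hv.trans le_sup_left⟩
  subset G m x hm := by
    rw [roundStep_flood hm.1]
    exact monotone_filter_right _ fun v _ hv => hv.trans le_sup_left
  nonempty m hm := hm.2.imp fun v hv => by simpa using hv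

theorem acc_le_of_flood_reach {L : ℕ} (hL : n ≤ L) {m m' : Fin n → p.Memory} (hm : Running m)
    (h : Reach roundStep (List.replicate L Kind.flood) m m') (u v : Fin n) :
    (m u).acc ≤ (m' v).acc := by
  classical
  have hcard := (grows_flood (m u).acc).card_add_le (fun G m x v w hm hw hvw => by
    rw [roundStep_flood hm.1, mem_filter]
    exact ⟨mem_univ _, ((mem_filter.1 hw).2.trans
      (receivedFlood_inbox_le.1 le_rfl w hvw)).trans le_sup_right⟩) L ⟨hm, u, le_rfl⟩ h
  have hall : (univ.filter fun v => (m u).acc ≤ (m' v).acc) = univ := by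
    refine hcard.resolve_right fun hle => ?_
    have hpos : 0 < (univ.filter fun v => (m u).acc ≤ (m v).acc).card :=
      card_pos.2 ⟨u, by simp⟩
    have hbound := card_le_univ (univ.filter fun v => (m u).acc ≤ (m' v).acc)
    rw [Fintype.card_fin] at hbound
    omega
  exact (mem_filter.1 (eq_univ_iff_forall.1 hall v)).2

theorem flood_reach {L : ℕ} (hL : n ≤ L) {m m' : Fin n → p.Memory} (hm : Running m)
    (h : Reach roundStep (List.replicate L Kind.flood) m m') :
    m' = fun v => { m v with acc := univ.sup fun w => (m w).acc } := by
  have hle := acc_le_of_flood_reach hL hm h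
  obtain ⟨a, rfl, ha⟩ := flood_reach_bounds hm h
  funext v
  rw [(ha v).antisymm (Finset.sup_le fun u _ => hle u v)]

/-! ### Forwarding -/

theorem roundStep_fwd {m : Fin n → p.Memory} (hm : Running m) (G : ConnectedGraph (Fin n))
    (x : Fin n → p.Coin) :
    roundStep .fwd G m x = fun v =>
      { m v with
        pending := if (m v).forwarding then
          (m v).pending ∪ p.receivedTokens (inbox .fwd G m x v) else (m v).pending } :=
  funext fun v => by rw [roundStep_apply hm, update]

theorem fwd_reach {F : ℕ} {m m' : Fin n → p.Memory} (hm : Running m)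
    (h : Reach roundStep (List.replicate F Kind.fwd) m m') :
    ∃ T : Fin n → Finset p.Tok, m' = (fun v => { m v with pending := T v }) ∧
      (∀ v, (m v).pending ⊆ T v) ∧ (∀ v, ∀ τ ∈ T v, ∃ w, τ ∈ (m w).pending) ∧
      ∀ v, (m v).forwarding = false → T v = (m v).pending := by
  refine Reach.invariant (I := fun m₁ => ∃ T : Fin n → Finset p.Tok,
    m₁ = (fun v => { m v with pending := T v }) ∧
      (∀ v, (m v).pending ⊆ T v) ∧ (∀ v, ∀ τ ∈ T v, ∃ w, τ ∈ (m w).pending) ∧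
      ∀ v, (m v).forwarding = false → T v = (m v).pending) ?_ h
      ⟨fun v => (m v).pending, rfl, fun v => Subset.rfl, fun v τ hτ => ⟨v, hτ⟩, fun v _ => rfl⟩
  rintro k hk G _ x ⟨T, rfl, hsub, hsource, hfrozen⟩
  rw [List.eq_of_mem_replicate hk]
  refine ⟨_, roundStep_fwd (m := fun v => { m v with pending := T v }) hm G x,
    fun v => ?_, fun v τ hτ => ?_, fun v hv => ?_⟩
  · dsimp only
    split_ifs
    · exact (hsub v).trans subset_union_left
    · exact hsub v
  · dsimp only at hτ
    split_ifs at hτ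
    · rcases mem_union.1 hτ with hτ | hτ
      · exact hsource v τ hτ
      · obtain ⟨w, -, hw⟩ := mem_receivedTokens_inbox.1 hτ
        exact hsource w τ (mem_block.1 hw).1
    · exact hsource v τ hτ
  · dsimp only
    rw [if_neg (by simp [hv])]
    exact hfrozen v hv

open Classical in
/-- The nodes that know the undelivered token `τ`. -/
noncomputable def holders (m : Fin n → p.Memory) (τ : p.Tok) : Finset (Fin n) :=
  univ.filter fun v => τ ∈ (m v).pending

theorem mem_holders {m : Fin n → p.Memory} {τ : p.Tok} {v : Fin n} :
    v ∈ holders m τ ↔ τ ∈ (m v).pending := by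
  simp [holders]

/-- No node is heavy. -/
def Light (m : Fin n → p.Memory) : Prop :=
  ∀ v, (m v).pending.card ≤ p.numBlocks * p.blockSize

theorem roundStep_fwd_of_forwarding {m : Fin n → p.Memory} (hm : Running m)
    (hf : ∀ v, (m v).forwarding = true) (G : ConnectedGraph (Fin n)) (x : Fin n → p.Coin) :
    roundStep .fwd G m x = fun v =>
      { m v with pending := (m v).pending ∪ p.receivedTokens (inbox .fwd G m x v) } := by
  rw [roundStep_fwd hm]
  exact funext fun v => by rw [if_pos (hf v)]

theorem grows_fwd (τ : p.Tok) :
    Grows roundStep Kind.fwd (fun m : Fin n → p.Memory =>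
      Running m ∧ (∀ v, (m v).forwarding = true) ∧ ∃ v, τ ∈ (m v).pending)
      (fun m => holders m τ) where
  preserves := by
    rintro G m x ⟨hm, hf, v, hv⟩
    rw [roundStep_fwd_of_forwarding hm hf]
    exact ⟨hm, hf, v, mem_union_left _ hv⟩
  subset := by
    rintro G m x ⟨hm, hf, -⟩ v hv
    rw [roundStep_fwd_of_forwarding hm hf]
    exact mem_holders.2 (mem_union_left _ (mem_holders.1 hv))
  nonempty m hm := hm.2.2.imp fun v hv => mem_holders.2 hv

theorem le_expect_mem_holders {m : Fin n → p.Memory} (hm : Running m)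
    (hf : ∀ v, (m v).forwarding = true) (hlight : Light m) (G : ConnectedGraph (Fin n)) {τ : p.Tok}
    {v w : Fin n} (hw : w ∈ holders m τ) (hvw : G.1.Adj v w) :
    1 / (p.numBlocks : ℝ) ≤ 𝔼 x, ind (v ∈ holders (roundStep .fwd G m x) τ) := by
  rw [mem_holders] at hw
  obtain ⟨i, hi⟩ := exists_mem_block hw ((rank_lt hw).trans_le (hlight w))
  calc (1 : ℝ) / p.numBlocks = 𝔼 x : Fin n → p.Coin, ind ((x w).idx = i) := by
        rw [expect_eval w (fun y : p.Coin => ind (y.idx = i)),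
          expect_coin_idx (fun j => ind (j = i)), expect_ind_eq, Fintype.card_fin]
    _ ≤ _ := expect_le_expect fun x _ => ind_mono fun hx => mem_holders.2 (by
        rw [roundStep_fwd_of_forwarding hm hf]
        exact mem_union_right _ (mem_receivedTokens_inbox.2 ⟨w, hvw, by rwa [hx]⟩))

theorem supExpect_fwd_le [NeZero n] {m : Fin n → p.Memory} (hm : Running m)
    (hf : ∀ v, (m v).forwarding = true) {τ : p.Tok} (hτ : ∃ v, τ ∈ (m v).pending) (F h : ℕ) :
    supExpect roundStep (List.replicate F Kind.fwd)
      (fun m => ind (Light m ∧ holders m τ ≠ univ ∧ (holders m τ).card ≤ h)) m ≤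
      2 ^ h * (1 - 1 / p.numBlocks / 2) ^ F := by
  have hg : (1 : ℝ) ≤ p.numBlocks := by exact_mod_cast p.numBlocks_pos
  have key := (grows_fwd τ).supExpect_card_le (stopped := fun m => ¬ Light m)
    (q := 1 / p.numBlocks)
    (fun G m x hI hst hlight => hst fun v => by
      rw [roundStep_fwd_of_forwarding hI.1 hI.2.1] at hlight
      exact (card_le_card subset_union_left).trans (hlight v))
    (by rw [div_le_one (by positivity)]; exact hg)
    (fun G m v w hI hst hw _ hvw =>
      le_expect_mem_holders hI.1 hI.2.1 (not_not.1 hst) G hw hvw) F h ⟨hm, hf, hτ⟩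
  simpa only [not_not] using key

/-! ### Coding -/

/-- All vectors that some node has. -/
noncomputable def allVec (m : Fin n → p.Memory) : Finset p.CodeVec :=
  univ.biUnion fun v => (m v).vectors

theorem roundStep_code {m : Fin n → p.Memory} (hm : Running m) (G : ConnectedGraph (Fin n))
    (x : Fin n → p.Coin) :
    roundStep .code G m x = fun v =>
      { m v with vectors := (m v).vectors ∪ p.receivedVecs (inbox .code G m x v) } :=
  funext fun v => by rw [roundStep_apply hm, update]

theorem code_reach {H : ℕ} {m m' : Fin n → p.Memory} (hm : Running m)
    (h : Reach roundStep (List.replicate H Kind.code) m m') :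
    ∃ R : Fin n → Finset p.CodeVec, m' = (fun v => { m v with vectors := R v }) ∧
      ∀ v, ∀ e ∈ R v, e ∈ p.spanOf (allVec m) := by
  refine Reach.invariant (I := fun m₁ => ∃ R : Fin n → Finset p.CodeVec,
    m₁ = (fun v => { m v with vectors := R v }) ∧ ∀ v, ∀ e ∈ R v, e ∈ p.spanOf (allVec m)) ?_ h
      ⟨fun v => (m v).vectors, rfl, fun v e he => Submodule.subset_span
        (mem_coe.2 (mem_biUnion.2 ⟨v, mem_univ _, he⟩))⟩
  rintro k hk G _ x ⟨R, rfl, hspan⟩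
  rw [List.eq_of_mem_replicate hk]
  refine ⟨_, roundStep_code (m := fun v => { m v with vectors := R v }) hm G x, fun v e he => ?_⟩
  rcases mem_union.1 he with he | he
  · exact hspan v e he
  · obtain ⟨w, -, rfl⟩ := mem_receivedVecs_inbox.1 he
    exact Submodule.sum_mem _ fun e' he' => Submodule.smul_mem _ _ (hspan w e' he')

open Classical in
/-- The nodes whose vectors are not all annihilated by `φ`. -/
noncomputable def detectors (m : Fin n → p.Memory) (φ : p.CodeVec →ₗ[ZMod 2] ZMod 2) :
    Finset (Fin n) :=
  univ.filter fun v => ∃ e ∈ (m v).vectors, φ e ≠ 0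

theorem mem_detectors {m : Fin n → p.Memory} {φ : p.CodeVec →ₗ[ZMod 2] ZMod 2} {v : Fin n} :
    v ∈ detectors m φ ↔ ∃ e ∈ (m v).vectors, φ e ≠ 0 := by
  simp [detectors]

theorem grows_code (φ : p.CodeVec →ₗ[ZMod 2] ZMod 2) :
    Grows roundStep Kind.code
      (fun m : Fin n → p.Memory => Running m ∧ ∃ v, ∃ e ∈ (m v).vectors, φ e ≠ 0)
      (fun m => detectors m φ) where
  preserves := by
    rintro G m x ⟨hm, v, e, he, hφ⟩
    rw [roundStep_code hm]
    exact ⟨hm, v, e, mem_union_left _ he, hφ⟩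
  subset := by
    rintro G m x ⟨hm, -⟩ v hv
    obtain ⟨e, he, hφ⟩ := mem_detectors.1 hv
    rw [roundStep_code hm]
    exact mem_detectors.2 ⟨e, mem_union_left _ he, hφ⟩
  nonempty m hm := hm.2.imp fun v hv => mem_detectors.2 hv

theorem half_le_expect_mem_detectors {m : Fin n → p.Memory} (hm : Running m)
    (φ : p.CodeVec →ₗ[ZMod 2] ZMod 2) (G : ConnectedGraph (Fin n)) {v w : Fin n}
    (hw : w ∈ detectors m φ) (hvw : G.1.Adj v w) :
    1 / 2 ≤ 𝔼 x, ind (v ∈ detectors (roundStep .code G m x) φ) := by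
  classical
  obtain ⟨e, he, hφ⟩ := mem_detectors.1 hw
  calc (1 : ℝ) / 2 = 𝔼 x : Fin n → p.Coin,
        ind (φ (∑ e ∈ (m w).vectors, (x w).coef e • e) ≠ 0) := by
        rw [expect_eval w (fun y : p.Coin => ind (φ (∑ e ∈ (m w).vectors, y.coef e • e) ≠ 0)),
          expect_coin_coef (fun c => ind (φ (∑ e ∈ (m w).vectors, c e • e) ≠ 0)),
          expect_functional_ne_zero φ he hφ]
    _ ≤ _ := expect_le_expect fun x _ => ind_mono fun hx => mem_detectors.2 (by
        rw [roundStep_code hm]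
        exact ⟨_, mem_union_right _ (mem_receivedVecs_inbox.2 ⟨w, hvw, rfl⟩), hx⟩)

theorem supExpect_detectors_le [NeZero n] {m : Fin n → p.Memory} (hm : Running m)
    {φ : p.CodeVec →ₗ[ZMod 2] ZMod 2} (hφ : ∃ v, ∃ e ∈ (m v).vectors, φ e ≠ 0) (H : ℕ) :
    supExpect roundStep (List.replicate H Kind.code) (fun m => ind (detectors m φ ≠ univ)) m ≤
      2 ^ n * (3 / 4) ^ H := by
  have key := (grows_code φ).supExpect_card_le (stopped := fun _ => False) (q := 1 / 2)
    (fun _ _ _ _ h => h) (by norm_num)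
    (fun G m v w hI _ hw _ hvw => half_le_expect_mem_detectors hI.1 φ G hw hvw) H n ⟨hm, hφ⟩
  refine (supExpect_mono fun m' _ => ?_).trans (key.trans_eq (by norm_num))
  exact ind_mono fun h => ⟨not_false, h, (card_le_univ _).trans (by simp)⟩

theorem supExpect_code_le [NeZero n] {m : Fin n → p.Memory} (hm : Running m) {c : ℕ}
    (hc : (allVec m).card ≤ c) (H : ℕ) :
    supExpect roundStep (List.replicate H Kind.code) (fun m' =>
      ind (¬ ∀ v, ∀ e ∈ allVec m, e ∈ p.spanOf (m' v).vectors)) m ≤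
      2 ^ c * (2 ^ n * (3 / 4) ^ H) := by
  obtain ⟨Φ, hcard, hne, hsep⟩ := exists_functionals_separating (K := ZMod 2) (allVec m)
  calc _ ≤ supExpect roundStep (List.replicate H Kind.code)
        (fun m' => ∑ φ ∈ Φ, ind (detectors m' φ ≠ univ)) m := by
        refine supExpect_mono fun m' hm' => ?_
        by_cases h : ∀ v, ∀ e ∈ allVec m, e ∈ p.spanOf (m' v).vectors
        · rw [ind_neg (not_not.2 h)]
          exact sum_nonneg fun φ _ => ind_nonneg _
        push Not at h
        obtain ⟨v, e, he, hev⟩ := h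
        obtain ⟨R, rfl, hR⟩ := code_reach hm hm'
        obtain ⟨φ, hφ, hzero⟩ := hsep (R v) (hR v) e he hev
        refine (ind_le_one _).trans ?_
        rw [← ind_pos (P := detectors (fun v => { m v with vectors := R v }) φ ≠ univ) fun hu => by
          obtain ⟨e', he', hφe'⟩ := mem_detectors.1 (eq_univ_iff_forall.1 hu v)
          exact hφe' (hzero e' he')]
        exact single_le_sum (f := fun φ => ind (detectors _ φ ≠ univ)) (fun φ _ => ind_nonneg _) hφ
    _ ≤ ∑ φ ∈ Φ, supExpect roundStep (List.replicate H Kind.code)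
          (fun m' => ind (detectors m' φ ≠ univ)) m := supExpect_sum_le _ _ _ _
    _ ≤ ∑ φ ∈ Φ, (2 ^ n * (3 / 4) ^ H : ℝ) := by
        refine sum_le_sum fun φ hφ => supExpect_detectors_le hm ?_ H
        obtain ⟨e, he, hφe⟩ := hne φ hφ
        obtain ⟨v, -, hv⟩ := mem_biUnion.1 he
        exact ⟨v, e, hv, hφe⟩
    _ = Φ.card * (2 ^ n * (3 / 4) ^ H) := by rw [sum_const, nsmul_eq_mul]
    _ ≤ 2 ^ c * (2 ^ n * (3 / 4) ^ H) := by
        gcongr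
        exact_mod_cast hcard.trans ((ZMod.card 2).symm ▸ Nat.pow_le_pow_right two_pos hc)

/-! ### Sampling -/

variable (p n) in
/-- A key, or a ticket, for each block of each node. -/
abbrev KeyTable : Type := Fin n × Fin p.numBlocks → Fin p.keyRange

variable (p n) in
/-- A seed for each node. -/
abbrev SeedTable : Type := Fin n → Fin (Fintype.card p.HashField)

theorem expect_coin_tables (f : p.KeyTable n → p.KeyTable n → p.SeedTable n → ℝ) :
    𝔼 x : Fin n → p.Coin, f (fun a => (x a.1).key a.2) (fun a => (x a.1).ticket a.2)
      (fun v => (x v).seed) = 𝔼 κ, 𝔼 σ, 𝔼 ς, f κ σ ς := by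
  let e : (Fin n → p.Coin) ≃ (Fin n → Fin p.numBlocks) × (Fin n → p.CodeVec → ZMod 2) ×
      p.KeyTable n × p.KeyTable n × p.SeedTable n :=
    { toFun := fun x => (fun v => (x v).idx, fun v => (x v).coef, fun a => (x a.1).key a.2,
        fun a => (x a.1).ticket a.2, fun v => (x v).seed)
      invFun := fun y v => ⟨y.1 v, fun i => y.2.2.1 (v, i), fun i => y.2.2.2.1 (v, i),
        y.2.2.2.2 v, y.2.1 v⟩ }
  refine (Fintype.expect_equiv e _ (fun y => f y.2.2.1 y.2.2.2.1 y.2.2.2.2) fun _ => rfl).trans ?_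
  simp only [← univ_product_univ, expect_product]
  rw [Fintype.expect_const, Fintype.expect_const]

open Classical in
/-- The nonempty blocks of all nodes, as pairs of a node and a number. -/
noncomputable def slots (m : Fin n → p.Memory) : Finset (Fin n × Fin p.numBlocks) :=
  univ.filter fun a => (p.block (m a.1).pending a.2).1.Nonempty

theorem mem_slots {m : Fin n → p.Memory} {a : Fin n × Fin p.numBlocks} :
    a ∈ slots m ↔ (p.block (m a.1).pending a.2).1.Nonempty := by
  simp [slots]

open Classical in
/-- The blocks that are sampled by some node if the keys are `κ` and the tickets are `σ`. -/
noncomputable def chosen (m : Fin n → p.Memory) (κ σ : p.KeyTable n) : Finset p.Block :=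
  (picked p.numBlocks (slots m) κ σ).image fun a => p.block (m a.1).pending a.2

/-- The seed that is elected. -/
noncomputable def maxSeed (ς : p.SeedTable n) : p.HashField :=
  (Fintype.equivFin p.HashField).symm (WithBot.unbotD ⟨0, Fintype.card_pos⟩
    (univ.sup fun v => (ς v : WithBot (Fin (Fintype.card p.HashField)))))

theorem exists_maxSeed_eq [NeZero n] (ς : p.SeedTable n) :
    ∃ v, maxSeed ς = (Fintype.equivFin p.HashField).symm (ς v) := by
  obtain ⟨v, -, hv⟩ := exists_mem_eq_sup univ univ_nonempty fun v : Fin n =>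
    (ς v : WithBot (Fin (Fintype.card p.HashField)))
  exact ⟨v, by rw [maxSeed, hv]; rfl⟩

theorem half_le_expect_goodSeed [NeZero n] (hinj : Function.Injective p.blockCode)
    {X : Finset p.Block} (hX : X.card ≤ p.capacity)
    (hF : 2 * (n * (2 ^ p.capacity * (2 * p.capacity + 1))) ≤ Fintype.card p.HashField) :
    1 / 2 ≤ 𝔼 ς : p.SeedTable n, ind (p.GoodSeed (maxSeed ς) X) := by
  classical
  let A : Finset (Fin (Fintype.card p.HashField)) :=
    univ.filter fun i => ¬ p.GoodSeed ((Fintype.equivFin p.HashField).symm i) X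
  have hcard : A.card ≤ 2 ^ p.capacity * (2 * p.capacity + 1) := by
    refine le_trans ?_ (card_not_goodSeed_le hinj hX)
    rw [← card_image_of_injective A (Fintype.equivFin p.HashField).symm.injective]
    refine card_le_card fun a ha => ?_
    obtain ⟨i, hi, rfl⟩ := mem_image.1 ha
    exact mem_filter.2 ⟨mem_univ _, (mem_filter.1 hi).2⟩
  have hdens : ((univ : Finset (Fin n)).card : ℝ) * A.dens ≤ 1 / 2 := by
    rw [nnratCast_dens, card_univ, Fintype.card_fin, Fintype.card_fin, mul_div_assoc',
      div_le_iff₀ (by exact_mod_cast Fintype.card_pos)]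
    have hmul : 2 * (n * A.card) ≤ Fintype.card p.HashField :=
      (Nat.mul_le_mul_left _ (Nat.mul_le_mul_left _ hcard)).trans hF
    have hmulR : (2 : ℝ) * (n * A.card) ≤ Fintype.card p.HashField := by exact_mod_cast hmul
    linarith
  calc (1 : ℝ) / 2 ≤ 1 - 𝔼 ς : p.SeedTable n, ind (∃ v ∈ univ, ς v ∈ A) := by
        linarith [expect_exists_hit_le A (univ : Finset (Fin n))]
    _ = 𝔼 ς : p.SeedTable n, (1 - ind (∃ v ∈ univ, ς v ∈ A)) := by
        rw [expect_sub_distrib, Fintype.expect_const]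
    _ ≤ _ := by
        refine expect_le_expect fun ς _ => ?_
        obtain ⟨v, hv⟩ := exists_maxSeed_eq ς
        by_cases hgood : p.GoodSeed (maxSeed ς) X
        · rw [ind_pos hgood]
          linarith [ind_nonneg (∃ v ∈ univ, ς v ∈ A)]
        · rw [ind_pos ⟨v, mem_univ _, mem_filter.2 ⟨mem_univ _, hv ▸ hgood⟩⟩, sub_self]
          exact ind_nonneg _

theorem card_holders_le [DecidableEq p.Tok] {m : Fin n → p.Memory} (hlight : Light m)
    (τ : p.Tok) :
    (holders m τ).card ≤
      (univ.filter fun a : Fin n × Fin p.numBlocks =>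
        τ ∈ (p.block (m a.1).pending a.2).1).card := by
  refine (card_le_card fun v hv => ?_).trans (card_image_le (f := Prod.fst))
  have hτ := mem_holders.1 hv
  obtain ⟨i, hi⟩ := exists_mem_block hτ ((rank_lt hτ).trans_le (hlight v))
  exact mem_image.2 ⟨(v, i), mem_filter.2 ⟨mem_univ _, hi⟩, rfl⟩

theorem le_expect_chosen {m : Fin n → p.Memory} (hlight : Light m)
    (hinj : Function.Injective p.blockCode)
    (hF : 2 * (n * (2 ^ p.capacity * (2 * p.capacity + 1))) ≤ Fintype.card p.HashField)
    (hcap : 4 * (1 + 4 * p.numBlocks) ≤ p.capacity) (hQ : (slots m).card ≤ p.keyRange) {τ : p.Tok}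
    (hτ : (holders m τ).Nonempty) {q : ℝ} (hq0 : 0 ≤ q) (hq1 : q ≤ 1)
    (hq : 4 * (slots m).card * q ≤ p.numBlocks) :
    1 / 8 * ((holders m τ).card * q / (1 + (holders m τ).card * q)) ≤
      𝔼 κ : p.KeyTable n, 𝔼 σ : p.KeyTable n, 𝔼 ς : p.SeedTable n,
        ind (((∃ B ∈ chosen m κ σ, τ ∈ B.1) ∧ (chosen m κ σ).card ≤ p.capacity) ∧
          p.GoodSeed (maxSeed ς) (chosen m κ σ)) := by
  classical
  have : NeZero n := ⟨hτ.choose.pos.ne'⟩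
  let J : Finset (Fin n × Fin p.numBlocks) :=
    univ.filter fun a => τ ∈ (p.block (m a.1).pending a.2).1
  have hJcard : (holders m τ).card ≤ J.card := card_holders_le hlight τ
  have hJ : J ⊆ slots m := fun a ha => mem_slots.2 ⟨τ, (mem_filter.1 ha).2⟩
  have hslots : (slots m).Nonempty := (card_pos.1 (hτ.card_pos.trans_le hJcard)).mono hJ
  have hchosen (κ σ : p.KeyTable n)
      (h : (∃ a ∈ J, a ∈ picked p.numBlocks (slots m) κ σ) ∧
        (picked p.numBlocks (slots m) κ σ).card ≤ p.capacity) :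
      (∃ B ∈ chosen m κ σ, τ ∈ B.1) ∧ (chosen m κ σ).card ≤ p.capacity := by
    obtain ⟨⟨a, haJ, ha⟩, hcard⟩ := h
    exact ⟨⟨_, mem_image_of_mem _ ha, (mem_filter.1 haJ).2⟩, card_image_le.trans hcard⟩
  calc 1 / 8 * ((holders m τ).card * q / (1 + (holders m τ).card * q))
      ≤ 1 / 2 * (1 / 4 * (J.card * q / (1 + J.card * q))) := by
        have : (holders m τ).card * q / (1 + (holders m τ).card * q) ≤
            J.card * q / (1 + J.card * q) := div_one_add_mono (by positivity) (by gcongr)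
        linarith
    _ ≤ 1 / 2 * 𝔼 κ : p.KeyTable n, 𝔼 σ : p.KeyTable n,
          ind ((∃ a ∈ J, a ∈ picked p.numBlocks (slots m) κ σ) ∧
            (picked p.numBlocks (slots m) κ σ).card ≤ p.capacity) := by
        gcongr
        exact le_expect_picked hJ hslots hQ hcap hq0 hq1 hq
    _ ≤ _ := by
        simp only [mul_expect]
        refine expect_le_expect fun κ _ => expect_le_expect fun σ _ => ?_
        refine le_trans (mul_le_mul_of_nonneg_left (ind_mono (hchosen κ σ)) (by norm_num)) ?_
        exact mul_ind_le_expect_ind_and fun h => half_le_expect_goodSeed hinj h.2 hF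

/-! ### Electing a leader and a sample -/

open Classical in
/-- The tokens that are not yet delivered. -/
noncomputable def undelivered (m : Fin n → p.Memory) : Finset p.Tok :=
  univ.biUnion fun v => (m v).pending

theorem mem_undelivered {m : Fin n → p.Memory} {τ : p.Tok} :
    τ ∈ undelivered m ↔ ∃ v, τ ∈ (m v).pending := by
  simp [undelivered]

theorem subset_undelivered (m : Fin n → p.Memory) (v : Fin n) : (m v).pending ⊆ undelivered m :=
  fun _ h => mem_undelivered.2 ⟨v, h⟩

/-- The result of the first flooding of a phase. -/
noncomputable def electedOf (m : Fin n → p.Memory) (x : Fin n → p.Coin) : p.FloodValue :=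
  univ.sup fun w => (m w).drawn (x w)

section Election

variable (m : Fin n → p.Memory) (x : Fin n → p.Coin)

theorem heavyId_electedOf : (electedOf m x).heavyId = univ.sup fun w =>
    if p.numBlocks * p.blockSize < (m w).pending.card then ((m w).uid : WithBot (Fin p.idRange))
    else ⊥ :=
  sup_fst _ _

theorem activeId_electedOf : (electedOf m x).activeId = univ.sup fun w =>
    if (m w).pending.Nonempty then ((m w).uid : WithBot (Fin p.idRange)) else ⊥ := by
  rw [electedOf, FloodValue.activeId, sup_snd, sup_fst]
  exact sup_congr rfl fun w _ => by simp [Memory.drawn]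

theorem topToken_electedOf : (electedOf m x).topToken = univ.sup fun w =>
    (m w).pending.sup fun τ => (p.tokCode τ : WithBot (Fin (Fintype.card p.Tok))) := by
  rw [electedOf, FloodValue.topToken, sup_snd, sup_snd, sup_fst]
  rfl

open Classical in
theorem topKey_electedOf : (electedOf m x).topKey = univ.sup fun w =>
    (univ.filter fun i : Fin p.numBlocks => (p.block (m w).pending i).1.Nonempty).sup fun i =>
      ((x w).key i : WithBot (Fin p.keyRange)) := by
  rw [electedOf, FloodValue.topKey, sup_snd, sup_snd, sup_snd, sup_fst]
  rfl

theorem topSeed_electedOf : (electedOf m x).topSeed =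
    univ.sup fun w => ((x w).seed : WithBot (Fin (Fintype.card p.HashField))) := by
  rw [electedOf, FloodValue.topSeed, sup_snd, sup_snd, sup_snd, sup_snd, sup_fst]
  rfl

theorem heavyId_electedOf_eq_bot : (electedOf m x).heavyId = ⊥ ↔ Light m := by
  simp [heavyId_electedOf, Finset.sup_eq_bot_iff, Light]

theorem exists_heavy_of_heavyId_electedOf (h : (electedOf m x).heavyId ≠ ⊥) :
    ∃ v, p.numBlocks * p.blockSize < (m v).pending.card ∧ (electedOf m x).heavyId = (m v).uid := by
  rw [heavyId_electedOf] at h ⊢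
  obtain ⟨v, -, hv⟩ := exists_eq_of_sup_ne_bot h
  rw [hv] at h ⊢
  split_ifs at h ⊢ with hc
  · exact ⟨v, hc, rfl⟩
  · exact absurd rfl h

theorem activeId_electedOf_eq_bot : (electedOf m x).activeId = ⊥ ↔ undelivered m = ∅ := by
  simp only [activeId_electedOf, Finset.sup_eq_bot_iff, mem_univ, true_imp_iff, ite_eq_right_iff,
    WithBot.coe_ne_bot, imp_false, not_nonempty_iff_eq_empty, eq_empty_iff_forall_notMem,
    mem_undelivered, not_exists]
  exact forall_comm

theorem exists_active_of_activeId_electedOf (h : (electedOf m x).activeId ≠ ⊥) :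
    ∃ v, (electedOf m x).activeId = (m v).uid := by
  rw [activeId_electedOf] at h ⊢
  obtain ⟨v, -, hv⟩ := exists_eq_of_sup_ne_bot h
  rw [hv] at h ⊢
  split_ifs at h ⊢ with hc
  · exact ⟨v, rfl⟩
  · exact absurd rfl h

theorem exists_tokSet_electedOf (h : undelivered m ≠ ∅) :
    ∃ τ ∈ undelivered m, p.tokSet (electedOf m x).topToken = {τ} := by
  have hne : (electedOf m x).topToken ≠ ⊥ := by
    obtain ⟨τ, hτ⟩ := nonempty_iff_ne_empty.2 h
    obtain ⟨v, hv⟩ := mem_undelivered.1 hτ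
    simp only [topToken_electedOf, Ne, Finset.sup_eq_bot_iff]
    exact fun hbot => WithBot.coe_ne_bot (hbot v (mem_univ v) τ hv)
  rw [topToken_electedOf] at hne ⊢
  obtain ⟨v, -, hv⟩ := exists_eq_of_sup_ne_bot hne
  rw [hv] at hne ⊢
  obtain ⟨τ, hτ, htop⟩ := exists_eq_of_sup_ne_bot hne
  refine ⟨τ, mem_undelivered.2 ⟨v, hτ⟩, ?_⟩
  rw [htop]
  ext τ'
  simp only [tokSet, mem_filter, mem_univ, true_and, WithBot.coe_inj, mem_singleton,
    EmbeddingLike.apply_eq_iff_eq]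

theorem sampleWidth_electedOf : p.sampleWidth (electedOf m x) =
    p.numBlocks * (p.keyRange - ((slots m).sup fun a => (x a.1).key a.2 : Fin p.keyRange)) := by
  have hkey : WithBot.unbotD 0 (electedOf m x).topKey = (slots m).sup fun a => (x a.1).key a.2 := by
    refine eq_of_forall_ge_iff fun c => ?_
    rw [WithBot.unbotD_le_iff fun _ => Fin.zero_le c, topKey_electedOf]
    simp [Finset.sup_le_iff, mem_slots]
  rw [sampleWidth, hkey]

theorem seedOf_electedOf : p.seedOf (electedOf m x) = maxSeed fun v => (x v).seed := by
  rw [seedOf, topSeed_electedOf, maxSeed]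

end Election

/-- The state after the draw, the first flooding and the sampling. -/
noncomputable def sampleState (m : Fin n → p.Memory) (x : Fin n → p.Coin) : Fin n → p.Memory :=
  fun v => ({ m v with acc := electedOf m x, ticket := (x v).ticket } : p.Memory).afterSample

variable (p) in
/-- The rounds of a phase in which the leader and the sample are elected. -/
def drawStage : List Kind := [.draw] ++ (List.replicate p.floodLen .flood ++ [.sample])

theorem roundStep_eq {m : Fin n → p.Memory} (hm : Running m) (k : Kind)
    (G : ConnectedGraph (Fin n)) (x : Fin n → p.Coin) :
    roundStep k G m x = fun v => update k (m v) (x v) (inbox k G m x v) :=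
  funext fun v => roundStep_apply hm k G x v

theorem drawStage_reach (hL : n ≤ p.floodLen) {m m' : Fin n → p.Memory} (hm : Running m)
    (G : ConnectedGraph (Fin n)) (x : Fin n → p.Coin)
    (h : Reach roundStep (List.replicate p.floodLen Kind.flood ++ [.sample])
      (roundStep .draw G m x) m') :
    m' = sampleState m x := by
  rw [roundStep_eq hm, reach_append] at h
  obtain ⟨m₁, hflood, G', x', hsample⟩ := h
  have hdraw : Running fun v => update .draw (m v) (x v) (inbox .draw G m x v) := fun v => hm v
  have hflood := flood_reach hL hdraw hflood
  have hrun : Running m₁ := by rw [hflood]; exact fun v => hm v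
  rw [show m' = _ from hsample, roundStep_eq hrun, hflood]
  rfl

theorem supExpect_drawStage_le [NeZero n] (hL : n ≤ p.floodLen) {m : Fin n → p.Memory}
    (hm : Running m) (f : (Fin n → p.Memory) → ℝ) :
    supExpect roundStep p.drawStage f m ≤ 𝔼 x, f (sampleState m x) :=
  supExpect_cons_le fun G => expect_le_expect fun x _ => supExpect_le_of_forall fun m' h => by
    rw [drawStage_reach hL hm G x h]

/-- What the nodes know after the sampling if the flooded value is `a`. -/
structure Ready (m : Fin n → p.Memory) (a : p.FloodValue) : Prop where
  running : Running m
  uid_injective : Function.Injective fun v => (m v).uid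
  elected_eq : ∀ v, (m v).elected = a
  mem_vectors_iff : ∀ v e, e ∈ (m v).vectors ↔ ∃ B ∈ (m v).sample, p.hashVec (p.seedOf a) B = e
  sample_sub : ∀ v, ∀ B ∈ (m v).sample, B.1.Nonempty ∧ B.1 ⊆ (m v).pending
  sample_eq_empty : a.heavyId ≠ ⊥ → ∀ v, (m v).sample = ∅
  exists_active : a.activeId ≠ ⊥ → ∃ v, a.activeId = (m v).uid
  exists_heavy : a.heavyId ≠ ⊥ →
    ∃ v, p.numBlocks * p.blockSize < (m v).pending.card ∧ a.heavyId = (m v).uid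
  exists_token : a.activeId ≠ ⊥ → ∃ τ ∈ undelivered m, p.tokSet a.topToken = {τ}

theorem sampleState_ready {m : Fin n → p.Memory} (hm : Running m)
    (huid : Function.Injective fun v => (m v).uid) (x : Fin n → p.Coin) :
    Ready (sampleState m x) (electedOf m x) where
  running := hm
  uid_injective := huid
  elected_eq _ := rfl
  mem_vectors_iff v e := by simp [sampleState, Memory.afterSample]
  sample_sub v B hB := by
    classical
    simp only [sampleState, Memory.afterSample, Memory.sampled] at hB
    split_ifs at hB with hc
    · obtain ⟨i, hi, rfl⟩ := mem_image.1 hB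
      exact ⟨(mem_filter.1 hi).2.1, fun τ hτ => (mem_block.1 hτ).1⟩
    · simp at hB
  sample_eq_empty h v := by
    simp only [sampleState, Memory.afterSample, Memory.sampled]
    rw [if_neg h]
  exists_active := exists_active_of_activeId_electedOf m x
  exists_heavy := exists_heavy_of_heavyId_electedOf m x
  exists_token h := exists_tokSet_electedOf m x (mt (activeId_electedOf_eq_bot m x).2 h)

theorem forwarding_sampleState (m : Fin n → p.Memory) (x : Fin n → p.Coin) (v : Fin n) :
    (sampleState m x v).forwarding = true ↔ (m v).forwarding = true ∧ ¬ Light m := by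
  simp only [sampleState, Memory.afterSample, Bool.and_eq_true, decide_eq_true_eq]
  rw [Ne, heavyId_electedOf_eq_bot]

open Classical in
/-- The blocks that the nodes have sampled. -/
noncomputable def sampledBlocks (m : Fin n → p.Memory) : Finset p.Block :=
  univ.biUnion fun v => (m v).sample

theorem mem_sampledBlocks {m : Fin n → p.Memory} {B : p.Block} :
    B ∈ sampledBlocks m ↔ ∃ v, B ∈ (m v).sample := by
  simp [sampledBlocks]

theorem sampledBlocks_sampleState {m : Fin n → p.Memory} (hlight : Light m)
    (x : Fin n → p.Coin) : sampledBlocks (sampleState m x) =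
      chosen m (fun a => (x a.1).key a.2) (fun a => (x a.1).ticket a.2) := by
  classical
  have h := (heavyId_electedOf_eq_bot m x).2 hlight
  ext B
  simp only [mem_sampledBlocks, sampleState, Memory.afterSample, Memory.sampled, if_pos h, chosen,
    picked, mem_image, mem_filter, mem_univ, true_and, mem_slots, Prod.exists,
    sampleWidth_electedOf]

/-! ### Delivering the sampled blocks -/

variable (p) in
/-- The rounds of a phase after the coding stages. -/
def endStage : List Kind := [.decode] ++ (List.replicate p.floodLen .flood ++ [.finish])

variable (p) in
/-- The rounds of a phase from the broadcast of the leader on. -/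
def leadStage : List Kind := [.lead] ++ (List.replicate p.codeLen .code ++ p.endStage)

variable (p) in
/-- The rounds of a phase after the election. -/
def codeStage : List Kind := List.replicate p.codeLen .code ++ p.leadStage

theorem phase_eq : p.phase = List.replicate p.fwdLen .fwd ++ (p.drawStage ++ p.codeStage) := by
  simp [phase, drawStage, codeStage, leadStage, endStage]

/-- The state after decoding, flooding of failures, and finishing. -/
noncomputable def endState (m : Fin n → p.Memory) : Fin n → p.Memory := fun v =>
  ({ (m v).afterDecode with
    acc := univ.sup fun w => (m w).afterDecode.acc } : p.Memory).afterFinish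

theorem endStage_reach (hL : n ≤ p.floodLen) {m m' : Fin n → p.Memory} (hm : Running m)
    (h : Reach roundStep p.endStage m m') : m' = endState m := by
  obtain ⟨G, x, h⟩ := h
  change Reach roundStep (List.replicate p.floodLen Kind.flood ++ [.finish]) _ m' at h
  rw [roundStep_eq hm, reach_append] at h
  obtain ⟨m₁, hflood, G', x', hfinish⟩ := h
  have hdecode : Running fun v => update .decode (m v) (x v) (inbox .decode G m x v) :=
    fun v => hm v
  have hflood := flood_reach hL hdecode hflood
  have hrun : Running m₁ := by rw [hflood]; exact fun v => hm v
  rw [show m' = _ from hfinish, roundStep_eq hrun, hflood]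
  rfl

open Classical in
theorem failed_sup_iff (m : Fin n → p.Memory) :
    (univ.sup fun w => (m w).afterDecode.acc).failed = true ↔ ∃ w, ¬ (m w).DecodeOk := by
  have hfailed : (univ.sup fun w => (m w).afterDecode.acc).failed =
      univ.sup fun w => decide (¬ (m w).DecodeOk) := by
    rw [FloodValue.failed, sup_snd, sup_snd, sup_snd, sup_snd, sup_snd]
    rfl
  rw [hfailed, ← not_iff_not, Bool.not_eq_true]
  refine (Finset.sup_eq_bot_iff _ _).trans ?_
  simp

/-- The state `m` with the vectors `R`. -/
def withVectors (m : Fin n → p.Memory) (R : Fin n → Finset p.CodeVec) : Fin n → p.Memory :=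
  fun v => { m v with vectors := R v }

/-- `m'` arises from `m` if all nodes deliver the tokens in `S`. -/
structure Delivers (S : Finset p.Tok) (m m' : Fin n → p.Memory) : Prop where
  running : Running m'
  uid_eq : ∀ v, (m' v).uid = (m v).uid
  pending_eq : ∀ v, (m' v).pending = (m v).pending \ S
  delivered_eq : ∀ v, (m' v).delivered = (m v).delivered ∪ S
  forwarding_eq : ∀ v, (m' v).forwarding = (m v).forwarding

open Classical in
/-- The vectors of the broadcast blocks `D`. -/
noncomputable def indexVecs (D : Fin p.capacity → p.Block) : Finset p.CodeVec :=
  univ.image fun j => p.indexVec j (D j)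

theorem card_indexVecs_le (D : Fin p.capacity → p.Block) : (indexVecs D).card ≤ p.capacity :=
  card_image_le.trans (by simp)

theorem indexVec_mem_indexVecs (D : Fin p.capacity → p.Block) (j : Fin p.capacity) :
    p.indexVec j (D j) ∈ indexVecs D :=
  mem_image_of_mem _ (mem_univ j)

open Classical in
/-- The tokens that are delivered if the leader broadcasts `D`, where `ok` says that there is no
failure. -/
noncomputable def deliveredTokens (D : Fin p.capacity → p.Block) (a : p.FloodValue) (ok : Prop) :
    Finset p.Tok :=
  (if ok then univ.biUnion fun j => (D j).1 else ∅) ∪ p.tokSet a.topToken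

theorem Memory.decoded_eq {μ : p.Memory} (hinj : Function.Injective p.blockCode)
    {D : Fin p.capacity → p.Block} (hvec : ∀ e ∈ μ.vectors, e ∈ p.spanOf (indexVecs D))
    {j : Fin p.capacity} (h : ∃ B, p.indexVec j B ∈ p.spanOf μ.vectors) : μ.decoded j = D j := by
  classical
  rw [Memory.decoded, dif_pos h]
  exact eq_of_indexVec_mem_span hinj (Submodule.span_le.2 hvec h.choose_spec)

/-- The identifier of the leader. -/
noncomputable def leaderId (a : p.FloodValue) : WithBot (Fin p.idRange) :=
  open Classical in if a.heavyId = ⊥ then a.activeId else a.heavyId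

theorem allVec_ite (m : Fin n → p.Memory) (v₀ : Fin n)
    (R : Finset p.CodeVec) : allVec (withVectors m fun v => if v = v₀ then R else ∅) = R := by
  classical
  ext e
  simp only [allVec, withVectors, mem_biUnion, mem_univ, true_and]
  refine ⟨fun ⟨v, hv⟩ => ?_, fun he => ⟨v₀, by rwa [if_pos rfl]⟩⟩
  split_ifs at hv with hvv
  · exact hv
  · exact absurd hv (notMem_empty e)

namespace Ready

variable {m : Fin n → p.Memory} {a : p.FloodValue} (h : Ready m a)

include h

theorem exists_leader (ha : a.activeId ≠ ⊥) : ∃ v, leaderId a = (m v).uid := by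
  by_cases hheavy : a.heavyId = ⊥
  · rw [leaderId, if_pos hheavy]
    exact h.exists_active ha
  · rw [leaderId, if_neg hheavy]
    obtain ⟨v, -, hv⟩ := h.exists_heavy hheavy
    exact ⟨v, hv⟩

theorem roundStep_lead {v₀ : Fin n} (hv₀ : leaderId a = (m v₀).uid)
    (R : Fin n → Finset p.CodeVec) (G : ConnectedGraph (Fin n)) (x : Fin n → p.Coin) :
    roundStep .lead G (withVectors m R) x = withVectors m fun v =>
      if v = v₀ then indexVecs (withVectors m R v₀).broadcast else ∅ := by
  classical
  rw [roundStep_eq (show Running (withVectors m R) from h.running)]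
  funext v
  simp only [update, Memory.afterLead, withVectors]
  congr 1
  have hleader : (withVectors m R v).leader = (withVectors m R v).uid ↔ v = v₀ := by
    rw [show (withVectors m R v).leader = leaderId a by
      simp only [Memory.leader, withVectors, h.elected_eq v, leaderId], hv₀, WithBot.coe_inj]
    exact ⟨fun huid => (h.uid_injective huid).symm, fun hv => hv ▸ rfl⟩
  by_cases hv : v = v₀
  · subst hv
    rw [if_pos rfl]
    exact if_pos (hleader.2 rfl)
  · rw [if_neg hv]
    exact if_neg (mt hleader.1 hv)

theorem endState_delivers (ha : a.activeId ≠ ⊥) (hinj : Function.Injective p.blockCode)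
    {D : Fin p.capacity → p.Block} {R : Fin n → Finset p.CodeVec}
    (hR : ∀ v, ∀ e ∈ R v, e ∈ p.spanOf (indexVecs D)) :
    Delivers (deliveredTokens D a (∀ w, (withVectors m R w).DecodeOk)) m
      (endState (withVectors m R)) := by
  classical
  let acc : p.FloodValue := univ.sup fun w => (withVectors m R w).afterDecode.acc
  let S : Finset p.Tok := deliveredTokens D a (∀ w, (withVectors m R w).DecodeOk)
  have helected (v : Fin n) : (withVectors m R v).afterDecode.elected = a := h.elected_eq v
  have hfailed : acc.failed = true ↔ ¬ ∀ w, (withVectors m R w).DecodeOk :=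
    (failed_sup_iff _).trans not_forall.symm
  have hremoved (v : Fin n) :
      ({ (withVectors m R v).afterDecode with acc := acc } : p.Memory).removed = S := by
    simp only [Memory.removed, helected, S, deliveredTokens]
    congr 1
    by_cases hok : ∀ w, (withVectors m R w).DecodeOk
    · rw [if_pos hok, if_neg (by rw [hfailed]; exact not_not.2 hok)]
      refine congrArg _ (funext fun j => ?_)
      exact congrArg Subtype.val (Memory.decoded_eq hinj (hR v) ((hok v).1 j))
    · rw [if_neg hok, if_pos (hfailed.2 hok)]
  have hend (v : Fin n) : endState (withVectors m R) v =
      { (withVectors m R v).afterDecode with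
        acc := acc
        pending := (m v).pending \ S
        delivered := (m v).delivered ∪ S } := by
    rw [← hremoved v]
    simp only [endState, Memory.afterFinish]
    rw [if_neg (by rw [helected]; exact ha)]
    rfl
  exact ⟨fun v => (congrArg Memory.out (hend v)).trans (h.running v),
    fun v => (congrArg Memory.uid (hend v)).trans rfl, fun v => congrArg Memory.pending (hend v),
    fun v => congrArg Memory.delivered (hend v),
    fun v => (congrArg Memory.forwarding (hend v)).trans rfl⟩

theorem allVec_eq [DecidableEq p.CodeVec] :
    allVec m = (sampledBlocks m).image (p.hashVec (p.seedOf a)) := by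
  ext e
  simp only [allVec, mem_biUnion, mem_univ, true_and, h.mem_vectors_iff, mem_image,
    mem_sampledBlocks]
  exact ⟨fun ⟨v, B, hB, he⟩ => ⟨B, ⟨v, hB⟩, he⟩, fun ⟨B, ⟨v, hB⟩, he⟩ => ⟨v, B, hB, he⟩⟩

theorem decodable_subset (hinj : Function.Injective p.blockCode) {R : Finset p.CodeVec}
    (hR : ∀ e ∈ R, e ∈ p.spanOf (allVec m)) {Y : Finset p.Block} (hY : sampledBlocks m ⊆ Y)
    (hgood : p.GoodSeed (p.seedOf a) Y) : p.decodable (p.seedOf a) R ⊆ sampledBlocks m := by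
  classical
  intro B hB
  refine hgood.mem_of_mem_span hinj hY ?_
  rw [← h.allVec_eq]
  exact Submodule.span_le.2 hR (mem_filter.1 hB).2

theorem subset_decodable {R : Finset p.CodeVec} (hR : ∀ e ∈ allVec m, e ∈ p.spanOf R) :
    sampledBlocks m ⊆ p.decodable (p.seedOf a) R := by
  classical
  refine fun B hB => mem_filter.2 ⟨mem_univ B, hR _ ?_⟩
  rw [h.allVec_eq]
  exact mem_image_of_mem _ hB

theorem subset_undelivered_of_mem_sampledBlocks {B : p.Block} (hB : B ∈ sampledBlocks m) :
    B.1 ⊆ undelivered m := by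
  obtain ⟨v, hv⟩ := mem_sampledBlocks.1 hB
  exact (h.sample_sub v B hv).2.trans (subset_undelivered m v)

theorem broadcast_subset_undelivered (hinj : Function.Injective p.blockCode)
    {R : Fin n → Finset p.CodeVec} {v₀ : Fin n} (hR : ∀ e ∈ R v₀, e ∈ p.spanOf (allVec m))
    (hsample : ∀ B ∈ sampledBlocks m, ∃ j, (withVectors m R v₀).broadcast j = B)
    (j : Fin p.capacity) : ((withVectors m R v₀).broadcast j).1 ⊆ undelivered m := by
  classical
  have hempty : p.emptyBlock.1 ⊆ undelivered m := empty_subset _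
  have helected : (withVectors m R v₀).elected = a := h.elected_eq v₀
  revert hsample
  simp only [Memory.broadcast, helected]
  set Y := p.decodable (p.seedOf a) (withVectors m R v₀).vectors
  split_ifs with hheavy hgood
  · intro hsample
    have hY : sampledBlocks m ⊆ Y := fun B hB => by
      obtain ⟨j, rfl⟩ := hsample B hB
      refine (p.listing_mem Y j).resolve_right fun hj => ?_
      obtain ⟨v, hv⟩ := mem_sampledBlocks.1 hB
      exact (h.sample_sub v _ hv).1.ne_empty (congrArg Subtype.val hj)
    rcases p.listing_mem Y j with hj | hj
    · exact h.subset_undelivered_of_mem_sampledBlocks (h.decodable_subset hinj hR hY hgood hj)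
    · rwa [hj]
  · exact fun _ => hempty
  · intro _
    dsimp only
    split_ifs
    · exact fun τ hτ => subset_undelivered m v₀ (mem_block.1 hτ).1
    · exact hempty

theorem deliveredTokens_subset (hinj : Function.Injective p.blockCode) (ha : a.activeId ≠ ⊥)
    {R R' : Fin n → Finset p.CodeVec} {v₀ : Fin n} (hR : ∀ e ∈ R v₀, e ∈ p.spanOf (allVec m))
    (hR' : ∀ v, ∀ e ∈ R' v, e ∈ p.spanOf (indexVecs (withVectors m R v₀).broadcast)) :
    deliveredTokens (withVectors m R v₀).broadcast a (∀ w, (withVectors m R' w).DecodeOk) ⊆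
      undelivered m := by
  refine union_subset ?_ ?_
  · split_ifs with hok
    · refine biUnion_subset.2 fun j _ => h.broadcast_subset_undelivered hinj hR (fun B hB => ?_) j
      obtain ⟨w, hw⟩ := mem_sampledBlocks.1 hB
      obtain ⟨i, hi⟩ := (hok w).2 B hw
      exact ⟨i, (Memory.decoded_eq hinj (hR' w) ((hok w).1 i)).symm.trans hi⟩
    · exact empty_subset _
  · obtain ⟨τ, hτ, htop⟩ := h.exists_token ha
    rw [htop]
    exact singleton_subset_iff.2 hτ

theorem card_deliveredTokens_le (ha : a.activeId ≠ ⊥) (D : Fin p.capacity → p.Block) (ok : Prop) :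
    (deliveredTokens D a ok).card ≤ p.capacity * p.blockSize + 1 := by
  refine (card_union_le _ _).trans (add_le_add ?_ ?_)
  · split_ifs
    · refine card_biUnion_le.trans ((sum_le_sum fun j _ => (D j).2).trans ?_)
      simp
    · simp
  · obtain ⟨τ, -, htop⟩ := h.exists_token ha
    rw [htop, card_singleton]

theorem codeStage_reach (ha : a.activeId ≠ ⊥) (hinj : Function.Injective p.blockCode)
    (hL : n ≤ p.floodLen) {m' : Fin n → p.Memory} (hr : Reach roundStep p.codeStage m m') :
    ∃ S ⊆ undelivered m, S.Nonempty ∧ S.card ≤ p.capacity * p.blockSize + 1 ∧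
      Delivers S m m' := by
  obtain ⟨v₀, hv₀⟩ := h.exists_leader ha
  rw [codeStage, reach_append] at hr
  obtain ⟨_, hcode, G, x, hr⟩ := hr
  obtain ⟨R, rfl, hR⟩ := code_reach h.running hcode
  change Reach roundStep (List.replicate p.codeLen .code ++ p.endStage)
    (roundStep .lead G (withVectors m R) x) m' at hr
  rw [h.roundStep_lead hv₀, reach_append] at hr
  obtain ⟨_, hcode', hr⟩ := hr
  obtain ⟨R', rfl, hR'⟩ := code_reach (by exact h.running) hcode'
  rw [allVec_ite] at hR'
  refine ⟨_, h.deliveredTokens_subset hinj ha (hR v₀) hR', ?_, h.card_deliveredTokens_le ha _ _, ?_⟩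
  · obtain ⟨τ, -, htop⟩ := h.exists_token ha
    exact ⟨τ, mem_union_right _ (htop ▸ mem_singleton_self τ)⟩
  · rw [endStage_reach hL (by exact h.running) hr]
    exact h.endState_delivers ha hinj hR'

theorem out_eq_of_codeStage_reach (ha : a.activeId = ⊥) (hL : n ≤ p.floodLen)
    {m' : Fin n → p.Memory} (hr : Reach roundStep p.codeStage m m') (v : Fin n) :
    (m' v).out = some (m v).delivered := by
  rw [codeStage, reach_append] at hr
  obtain ⟨_, hcode, G, x, hr⟩ := hr
  obtain ⟨R, rfl, -⟩ := code_reach h.running hcode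
  change Reach roundStep (List.replicate p.codeLen .code ++ p.endStage)
    (roundStep .lead G (withVectors m R) x) m' at hr
  rw [roundStep_eq (show Running (withVectors m R) from h.running), reach_append] at hr
  obtain ⟨_, hcode', hr⟩ := hr
  have hrun : Running fun v => update .lead (withVectors m R v) (x v)
    (inbox .lead G (withVectors m R) x v) := h.running
  obtain ⟨R', rfl, -⟩ := code_reach hrun hcode'
  rw [endStage_reach hL (by exact h.running) hr]
  simp only [endState, Memory.afterFinish]
  rw [if_pos]
  · rfl
  · exact (congrArg FloodValue.activeId (h.elected_eq v)).trans ha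

end Ready

open Classical in
/-- The tokens that a phase tries to deliver: those in the sampled blocks, or those of the leader
if there is a heavy node. -/
def Payload (m : Fin n → p.Memory) (a : p.FloodValue) (τ : p.Tok) : Prop :=
  if a.heavyId = ⊥ then ∃ B ∈ sampledBlocks m, τ ∈ B.1
  else ∃ v, leaderId a = (m v).uid ∧ ∃ i : Fin p.numBlocks, τ ∈ (p.block (m v).pending i).1

namespace Ready

variable {m : Fin n → p.Memory} {a : p.FloodValue} (h : Ready m a)

include h

theorem exists_broadcast_eq (hinj : Function.Injective p.blockCode)
    (hcard : (sampledBlocks m).card ≤ p.capacity)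
    (hgood : p.GoodSeed (p.seedOf a) (sampledBlocks m)) (ha : a.heavyId = ⊥)
    {R : Fin n → Finset p.CodeVec} {v : Fin n} (hR : ∀ e ∈ R v, e ∈ p.spanOf (allVec m))
    (hR' : ∀ e ∈ allVec m, e ∈ p.spanOf (R v)) {B : p.Block} (hB : B ∈ sampledBlocks m) :
    ∃ j, (withVectors m R v).broadcast j = B := by
  have hdecodable : p.decodable (p.seedOf a) (withVectors m R v).vectors = sampledBlocks m :=
    (h.decodable_subset hinj hR Subset.rfl hgood).antisymm (h.subset_decodable hR')
  have helected : (withVectors m R v).elected = a := h.elected_eq v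
  rw [Memory.broadcast, helected, if_pos ha, hdecodable, if_pos hgood]
  exact p.exists_listing_eq hcard hB

theorem decodeOk (hinj : Function.Injective p.blockCode) {D : Fin p.capacity → p.Block}
    (hD : a.heavyId = ⊥ → ∀ B ∈ sampledBlocks m, ∃ j, D j = B) {R : Fin n → Finset p.CodeVec}
    {v : Fin n} (hR : ∀ e ∈ R v, e ∈ p.spanOf (indexVecs D))
    (hR' : ∀ e ∈ indexVecs D, e ∈ p.spanOf (R v)) : (withVectors m R v).DecodeOk := by
  have hmem (j : Fin p.capacity) : ∃ B, p.indexVec j B ∈ p.spanOf (withVectors m R v).vectors :=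
    ⟨D j, hR' _ (indexVec_mem_indexVecs D j)⟩
  refine ⟨hmem, fun B hB => ?_⟩
  have ha : a.heavyId = ⊥ := by
    by_contra ha
    exact notMem_empty B (h.sample_eq_empty ha v ▸ hB)
  obtain ⟨j, rfl⟩ := hD ha B (mem_sampledBlocks.2 ⟨v, hB⟩)
  exact ⟨j, Memory.decoded_eq hinj hR (hmem j)⟩

theorem exists_mem_broadcast_of_payload (hcap : p.numBlocks ≤ p.capacity) {v : Fin n}
    (hv : leaderId a = (m v).uid) {R : Fin n → Finset p.CodeVec}
    (hD : a.heavyId = ⊥ → ∀ B ∈ sampledBlocks m, ∃ j, (withVectors m R v).broadcast j = B)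
    {τ : p.Tok} (hτ : Payload m a τ) : ∃ j, τ ∈ ((withVectors m R v).broadcast j).1 := by
  rw [Payload] at hτ
  split_ifs at hτ with ha
  · obtain ⟨B, hB, hτB⟩ := hτ
    obtain ⟨j, rfl⟩ := hD ha B hB
    exact ⟨j, hτB⟩
  · obtain ⟨w, hw, i, hi⟩ := hτ
    obtain rfl : w = v := h.uid_injective (WithBot.coe_inj.1 (hw.symm.trans hv))
    have helected : (withVectors m R w).elected = a := h.elected_eq w
    refine ⟨⟨i, i.2.trans_le hcap⟩, ?_⟩
    rw [Memory.broadcast, helected, if_neg ha, if_pos i.2]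
    exact hi

theorem notMem_undelivered_endState (ha : a.activeId ≠ ⊥) (hinj : Function.Injective p.blockCode)
    {D : Fin p.capacity → p.Block}
    (hD : a.heavyId = ⊥ → ∀ B ∈ sampledBlocks m, ∃ j, D j = B) {R : Fin n → Finset p.CodeVec}
    (hR : ∀ v, ∀ e ∈ R v, e ∈ p.spanOf (indexVecs D))
    (hR' : ∀ v, ∀ e ∈ indexVecs D, e ∈ p.spanOf (R v)) {τ : p.Tok} (hτ : ∃ j, τ ∈ (D j).1) :
    τ ∉ undelivered (endState (withVectors m R)) := by
  intro hmem
  obtain ⟨v, hv⟩ := mem_undelivered.1 hmem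
  obtain ⟨j, hj⟩ := hτ
  rw [(h.endState_delivers ha hinj hR).pending_eq v, mem_sdiff] at hv
  refine hv.2 (mem_union_left _ ?_)
  rw [if_pos fun w => h.decodeOk hinj hD (hR w) (hR' w)]
  exact mem_biUnion.2 ⟨j, mem_univ j, hj⟩

variable [NeZero n] (ha : a.activeId ≠ ⊥) (hinj : Function.Injective p.blockCode)
  (hL : n ≤ p.floodLen) (hcap : p.numBlocks ≤ p.capacity)
  (hH : (2 : ℝ) ^ p.capacity * (2 ^ n * (3 / 4) ^ p.codeLen) ≤ 1 / 4)

include ha hinj hL hcap hH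

theorem supExpect_leadStage_le {v₀ : Fin n} (hv₀ : leaderId a = (m v₀).uid)
    {R : Fin n → Finset p.CodeVec} (hD : a.heavyId = ⊥ →
      ∀ B ∈ sampledBlocks m, ∃ j, (withVectors m R v₀).broadcast j = B) :
    supExpect roundStep p.leadStage
      (fun m' => ind (∃ τ, Payload m a τ ∧ τ ∈ undelivered m')) (withVectors m R) ≤ 1 / 4 := by
  refine supExpect_cons_le fun G => expect_le univ_nonempty fun x _ => ?_
  change supExpect roundStep (List.replicate p.codeLen .code ++ p.endStage) _
    (roundStep .lead G (withVectors m R) x) ≤ _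
  rw [h.roundStep_lead hv₀, supExpect_append]
  set D := (withVectors m R v₀).broadcast
  have hrun : Running (withVectors m fun v => if v = v₀ then indexVecs D else ∅) := h.running
  have hcode := supExpect_code_le hrun
    ((congrArg card (allVec_ite m v₀ _)).trans_le (card_indexVecs_le D)) p.codeLen
  refine (supExpect_mono fun m₁ h₁ => ?_).trans (hcode.trans hH)
  obtain ⟨R', rfl, hR'⟩ := code_reach hrun h₁
  rw [allVec_ite] at hR' ⊢
  refine supExpect_le_of_forall fun m' hm' => ?_
  rw [endStage_reach hL (by exact h.running) hm']
  refine ind_mono fun ⟨τ, hτ, hmem⟩ hdec => ?_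
  exact h.notMem_undelivered_endState ha hinj hD hR' hdec
    (h.exists_mem_broadcast_of_payload hcap hv₀ hD hτ) hmem

theorem supExpect_codeStage_le (hcard : (sampledBlocks m).card ≤ p.capacity)
    (hgood : a.heavyId = ⊥ → p.GoodSeed (p.seedOf a) (sampledBlocks m)) :
    supExpect roundStep p.codeStage
      (fun m' => ind (∃ τ, Payload m a τ ∧ τ ∈ undelivered m')) m ≤ 1 / 2 := by
  classical
  obtain ⟨v₀, hv₀⟩ := h.exists_leader ha
  have hallVec : (allVec m).card ≤ p.capacity :=
    (congrArg card h.allVec_eq).trans_le (card_image_le.trans hcard)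
  rw [codeStage, supExpect_append]
  calc _ ≤ supExpect roundStep (List.replicate p.codeLen Kind.code) (fun m₁ =>
        ind (¬ ∀ v, ∀ e ∈ allVec m, e ∈ p.spanOf (m₁ v).vectors) + 1 / 4) m := ?_
    _ ≤ 1 / 4 + 1 / 4 := (supExpect_add_le _ _ _ _).trans (add_le_add
        ((supExpect_code_le h.running hallVec _).trans hH)
        (supExpect_le_of_forall fun _ _ => le_rfl))
    _ = 1 / 2 := by norm_num
  refine supExpect_mono fun m₁ h₁ => ?_
  by_cases hspan : ∀ v, ∀ e ∈ allVec m, e ∈ p.spanOf (m₁ v).vectors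
  · rw [ind_neg (not_not.2 hspan), zero_add]
    obtain ⟨R, rfl, hR⟩ := code_reach h.running h₁
    exact h.supExpect_leadStage_le ha hinj hL hcap hH hv₀ fun hlight B hB =>
      h.exists_broadcast_eq hinj hcard (hgood hlight) hlight (hR v₀) (hspan v₀) hB
  · rw [ind_pos hspan]
    exact (supExpect_le_of_forall fun _ _ => ind_le_one _).trans (by norm_num)

end Ready

/-! ### A phase: invariant and progress -/

variable (p) in
/-- The rounds of a phase after the forwarding. -/
def mainStage : List Kind := p.drawStage ++ p.codeStage

theorem mainStage_reach (hL : n ≤ p.floodLen) {m m' : Fin n → p.Memory} (hm : Running m)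
    (h : Reach roundStep p.mainStage m m') :
    ∃ x, Reach roundStep p.codeStage (sampleState m x) m' := by
  rw [mainStage, reach_append] at h
  obtain ⟨_, ⟨G, x, hdraw⟩, hcode⟩ := h
  exact ⟨x, drawStage_reach hL hm G x hdraw ▸ hcode⟩

theorem exists_delivers_of_mainStage_reach {m m' : Fin n → p.Memory} (hm : Running m)
    (huid : Function.Injective fun v => (m v).uid) (hund : undelivered m ≠ ∅)
    (hinj : Function.Injective p.blockCode) (hL : n ≤ p.floodLen)
    (h : Reach roundStep p.mainStage m m') :
    ∃ x, ∃ S ⊆ undelivered m, S.Nonempty ∧ S.card ≤ p.capacity * p.blockSize + 1 ∧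
      Delivers S (sampleState m x) m' := by
  obtain ⟨x, hcode⟩ := mainStage_reach hL hm h
  exact ⟨x, (sampleState_ready hm huid x).codeStage_reach
    (mt (activeId_electedOf_eq_bot m x).1 hund) hinj hL hcode⟩

theorem out_eq_of_mainStage_reach {m m' : Fin n → p.Memory} (hm : Running m)
    (huid : Function.Injective fun v => (m v).uid) (hund : undelivered m = ∅)
    (hL : n ≤ p.floodLen) (h : Reach roundStep p.mainStage m m') (v : Fin n) :
    (m' v).out = some (m v).delivered := by
  obtain ⟨x, hcode⟩ := mainStage_reach hL hm h
  exact (sampleState_ready hm huid x).out_eq_of_codeStage_reach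
    ((activeId_electedOf_eq_bot m x).2 hund) hL hcode v

theorem Delivers.holders_eq {m m' : Fin n → p.Memory} {S : Finset p.Tok}
    (h : Delivers S m m') {τ : p.Tok} (hτ : τ ∉ S) : holders m' τ = holders m τ := by
  ext v
  simp [mem_holders, h.pending_eq, hτ]

theorem Delivers.undelivered_eq {m m' : Fin n → p.Memory} {S : Finset p.Tok}
    (h : Delivers S m m') : undelivered m' = undelivered m \ S := by
  ext τ
  simp only [mem_undelivered, mem_sdiff, h.pending_eq, exists_and_right]

/-- The invariant at the beginning of a phase; `A` is the set of all tokens. -/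
structure Invariant (A : Finset p.Tok) (m : Fin n → p.Memory) : Prop where
  running : Running m
  uid_injective : Function.Injective fun v => (m v).uid
  undelivered_union : ∀ v, undelivered m ∪ (m v).delivered = A
  forwarding_eq : ∀ v w, (m v).forwarding = (m w).forwarding

namespace Invariant

variable {A : Finset p.Tok} {m m' : Fin n → p.Memory} (h : Invariant A m)

include h

theorem fwd_reach {F : ℕ} (hr : Reach roundStep (List.replicate F Kind.fwd) m m') :
    Invariant A m' ∧ undelivered m' = undelivered m ∧
      (∀ v, (m' v).forwarding = (m v).forwarding) ∧
      (∀ v, (m' v).delivered = (m v).delivered) ∧ ∀ v, (m v).forwarding = false → m' = m := by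
  obtain ⟨T, rfl, hsub, hexists, hstay⟩ := Params.fwd_reach h.running hr
  have hund : undelivered (fun v => ({ m v with pending := T v } : p.Memory)) =
      undelivered m := by
    ext τ
    simp only [mem_undelivered]
    exact ⟨fun ⟨v, hv⟩ => hexists v τ hv, fun ⟨v, hv⟩ => ⟨v, hsub v hv⟩⟩
  refine ⟨⟨h.running, h.uid_injective, fun v => ?_, h.forwarding_eq⟩, hund,
    fun v => rfl, fun v => rfl, fun v hv => ?_⟩
  · rw [hund]
    exact h.undelivered_union v
  · funext w
    rw [hstay w ((h.forwarding_eq w v).trans hv)]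

theorem mainStage_reach (hund : undelivered m ≠ ∅) (hinj : Function.Injective p.blockCode)
    (hL : n ≤ p.floodLen) (hr : Reach roundStep p.mainStage m m') :
    Invariant A m' ∧ (undelivered m').card < (undelivered m).card := by
  obtain ⟨x, S, hS, hne, -, hdel⟩ :=
    exists_delivers_of_mainStage_reach h.running h.uid_injective hund hinj hL hr
  have hund' : undelivered m' = undelivered m \ S := hdel.undelivered_eq
  refine ⟨⟨hdel.running, ?_, fun v => ?_, fun v w => ?_⟩, ?_⟩
  · rw [show (fun v => (m' v).uid) = fun v => (m v).uid from funext hdel.uid_eq]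
    exact h.uid_injective
  · calc undelivered m' ∪ (m' v).delivered
        = (undelivered m \ S) ∪ ((m v).delivered ∪ S) := by
          rw [hund']
          exact congrArg _ (hdel.delivered_eq v)
      _ = undelivered m ∪ (m v).delivered := by
          rw [union_comm (m v).delivered, ← union_assoc, sdiff_union_of_subset hS]
      _ = A := h.undelivered_union v
  · rw [hdel.forwarding_eq, hdel.forwarding_eq, Bool.eq_iff_iff, forwarding_sampleState,
      forwarding_sampleState, h.forwarding_eq v w]
  · rw [hund']
    exact card_lt_card (sdiff_ssubset hS hne)

theorem phase_reach (hinj : Function.Injective p.blockCode) (hL : n ≤ p.floodLen)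
    (hr : Reach roundStep p.phase m m') :
    (undelivered m = ∅ ∧ ∀ v, (m' v).out = some A) ∨
      Invariant A m' ∧ (undelivered m').card < (undelivered m).card := by
  rw [phase_eq, reach_append] at hr
  obtain ⟨m₁, hfwd, hmain⟩ := hr
  obtain ⟨h₁, hund, -, hdelivered, -⟩ := h.fwd_reach hfwd
  by_cases hempty : undelivered m = ∅
  · refine Or.inl ⟨hempty, fun v => ?_⟩
    rw [out_eq_of_mainStage_reach h₁.running h₁.uid_injective (hund.trans hempty) hL hmain v,
      hdelivered, ← h.undelivered_union v, hempty, empty_union]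
  · rw [← hund] at hempty ⊢
    exact Or.inr (h₁.mainStage_reach hempty hinj hL hmain)

end Invariant

/-- The relations between the parameters that the analysis uses. -/
structure Fits (p : Params) (n : ℕ) : Prop where
  blockCode_injective : Function.Injective p.blockCode
  le_floodLen : n ≤ p.floodLen
  le_card_hashField : 2 * (n * (2 ^ p.capacity * (2 * p.capacity + 1))) ≤ Fintype.card p.HashField
  le_keyRange : n * p.numBlocks ≤ p.keyRange
  capacity_eq : p.capacity = 20 * p.numBlocks
  code_failure_le : (2 : ℝ) ^ p.capacity * (2 ^ n * (3 / 4) ^ p.codeLen) ≤ 1 / 4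

theorem card_slots_le_mul (m : Fin n → p.Memory) : (slots m).card ≤ n * p.numBlocks :=
  (card_le_univ _).trans (by simp)

section Light

variable (hp : Fits p n) {m : Fin n → p.Memory} (hlight : Light m) {τ : p.Tok}

include hp hlight

theorem le_expect_sampledBlocks (hτ : τ ∈ undelivered m) {q : ℝ} (hq0 : 0 ≤ q) (hq1 : q ≤ 1)
    (hq : 4 * (slots m).card * q ≤ p.numBlocks) :
    1 / 8 * ((holders m τ).card * q / (1 + (holders m τ).card * q)) ≤
      𝔼 x, ind (((∃ B ∈ sampledBlocks (sampleState m x), τ ∈ B.1) ∧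
        (sampledBlocks (sampleState m x)).card ≤ p.capacity) ∧
          p.GoodSeed (p.seedOf (electedOf m x)) (sampledBlocks (sampleState m x))) := by
  obtain ⟨v, hv⟩ := mem_undelivered.1 hτ
  have hpos := p.numBlocks_pos
  refine (le_expect_chosen hlight hp.blockCode_injective hp.le_card_hashField
    (by rw [hp.capacity_eq]; omega) ((card_slots_le_mul m).trans hp.le_keyRange)
    ⟨v, mem_holders.2 hv⟩ hq0 hq1 hq).trans ?_
  rw [← expect_coin_tables fun κ σ ς => ind (((∃ B ∈ chosen m κ σ, τ ∈ B.1) ∧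
    (chosen m κ σ).card ≤ p.capacity) ∧ p.GoodSeed (maxSeed ς) (chosen m κ σ))]
  simp only [sampledBlocks_sampleState hlight, seedOf_electedOf, le_refl]

variable [NeZero n] (hm : Running m) (huid : Function.Injective fun v => (m v).uid)

include hm huid

theorem supExpect_codeStage_sampleState_le (hund : undelivered m ≠ ∅) {x : Fin n → p.Coin}
    (hτ : ∃ B ∈ sampledBlocks (sampleState m x), τ ∈ B.1)
    (hcard : (sampledBlocks (sampleState m x)).card ≤ p.capacity)
    (hgood : p.GoodSeed (p.seedOf (electedOf m x)) (sampledBlocks (sampleState m x))) :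
    supExpect roundStep p.codeStage (fun m' => ind (τ ∈ undelivered m')) (sampleState m x) ≤
      1 / 2 := by
  refine (supExpect_mono fun m' _ => ind_mono fun hmem => ⟨τ, ?_, hmem⟩).trans
    ((sampleState_ready hm huid x).supExpect_codeStage_le
      (mt (activeId_electedOf_eq_bot m x).1 hund) hp.blockCode_injective hp.le_floodLen
      (by rw [hp.capacity_eq]; omega) hp.code_failure_le hcard fun _ => hgood)
  rwa [Payload, if_pos ((heavyId_electedOf_eq_bot m x).2 hlight)]

theorem supExpect_mainStage_light_le (hτ : τ ∈ undelivered m) {q : ℝ} (hq0 : 0 ≤ q) (hq1 : q ≤ 1)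
    (hq : 4 * (slots m).card * q ≤ p.numBlocks) :
    supExpect roundStep p.mainStage (fun m' => ind (τ ∈ undelivered m')) m ≤
      1 - 1 / 16 * ((holders m τ).card * q / (1 + (holders m τ).card * q)) := by
  have hsampled := le_expect_sampledBlocks hp hlight hτ hq0 hq1 hq
  set ev : (Fin n → p.Coin) → Prop := fun x =>
    ((∃ B ∈ sampledBlocks (sampleState m x), τ ∈ B.1) ∧
      (sampledBlocks (sampleState m x)).card ≤ p.capacity) ∧
        p.GoodSeed (p.seedOf (electedOf m x)) (sampledBlocks (sampleState m x))
  rw [mainStage, supExpect_append]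
  refine (supExpect_drawStage_le hp.le_floodLen hm _).trans ?_
  calc _ ≤ 𝔼 x : Fin n → p.Coin, (1 - 1 / 2 * ind (ev x)) := expect_le_expect fun x _ => ?_
    _ = 1 - 1 / 2 * 𝔼 x : Fin n → p.Coin, ind (ev x) := by
        rw [expect_sub_distrib, Fintype.expect_const, mul_expect]
    _ ≤ _ := by linarith
  by_cases hx : ev x
  · rw [ind_pos hx]
    obtain ⟨⟨hsample, hcard⟩, hgood⟩ := hx
    exact (supExpect_codeStage_sampleState_le hp hlight hm huid (ne_empty_of_mem hτ) hsample hcard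
      hgood).trans (by norm_num)
  · rw [ind_neg hx]
    exact (supExpect_le_of_forall fun _ _ => ind_le_one _).trans (by norm_num)

end Light

theorem Ready.card_undelivered_add_le {m m' : Fin n → p.Memory} {a : p.FloodValue}
    (h : Ready m a) (hheavy : a.heavyId ≠ ⊥)
    (hsub : undelivered m' ⊆ undelivered m) (hdel : ∀ τ, Payload m a τ → τ ∉ undelivered m') :
    (undelivered m').card + p.numBlocks * p.blockSize ≤ (undelivered m).card := by
  classical
  obtain ⟨v, hv, huid⟩ := h.exists_heavy hheavy
  set P := univ.biUnion fun i : Fin p.numBlocks => (p.block (m v).pending i).1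
  have hsubset : P ⊆ undelivered m := biUnion_subset.2 fun i _ τ hτ =>
    subset_undelivered m v (mem_block.1 hτ).1
  have hdisjoint : Disjoint (undelivered m') P := by
    refine disjoint_right.2 fun τ hτ => hdel τ ?_
    obtain ⟨i, -, hi⟩ := mem_biUnion.1 hτ
    rw [Payload, if_neg hheavy]
    exact ⟨v, (if_neg hheavy).trans huid, i, hi⟩
  calc (undelivered m').card + p.numBlocks * p.blockSize
      ≤ (undelivered m').card + P.card := by
        gcongr
        exact le_card_biUnion_block hv.le
    _ = (undelivered m' ∪ P).card := (card_union_of_disjoint hdisjoint).symm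
    _ ≤ (undelivered m).card := card_le_card (union_subset hsub hsubset)

theorem undelivered_ne_empty_of_not_light {m : Fin n → p.Memory} (h : ¬ Light m) :
    undelivered m ≠ ∅ := fun hempty => h fun v => by
  rw [subset_empty.1 ((subset_undelivered m v).trans_eq hempty), card_empty]
  exact Nat.zero_le _

theorem supExpect_mainStage_heavy_le [NeZero n] (hp : Fits p n) {m : Fin n → p.Memory}
    (hm : Running m) (huid : Function.Injective fun v => (m v).uid) (hheavy : ¬ Light m) :
    supExpect roundStep p.mainStage (fun m' =>
      ind (¬ (undelivered m').card + p.numBlocks * p.blockSize ≤ (undelivered m).card)) m ≤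
      1 / 2 := by
  have hund := undelivered_ne_empty_of_not_light hheavy
  rw [mainStage, supExpect_append]
  refine (supExpect_drawStage_le hp.le_floodLen hm _).trans ?_
  refine expect_le univ_nonempty fun x _ => ?_
  have ha := mt (activeId_electedOf_eq_bot m x).1 hund
  have hb := mt (heavyId_electedOf_eq_bot m x).1 hheavy
  have hready := sampleState_ready hm huid x
  have hsampled : sampledBlocks (sampleState m x) = ∅ := eq_empty_of_forall_notMem fun B hB => by
    obtain ⟨v, hv⟩ := mem_sampledBlocks.1 hB
    rw [hready.sample_eq_empty hb v] at hv
    exact notMem_empty B hv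
  refine (supExpect_mono fun m' hm' => ind_mono ?_).trans (hready.supExpect_codeStage_le ha
    hp.blockCode_injective hp.le_floodLen (by rw [hp.capacity_eq]; omega) hp.code_failure_le
    (by simp [hsampled]) fun h => absurd h hb)
  contrapose!
  intro hdel
  obtain ⟨S, -, -, -, hS⟩ := hready.codeStage_reach ha hp.blockCode_injective hp.le_floodLen hm'
  exact hready.card_undelivered_add_le hb (hS.undelivered_eq.trans_subset sdiff_subset) hdel

end Params

/-! ### The potential -/

/-- In each phase the potential is expected to fall by the factor `1 - 1 / decayTime`. In
`5376 = 32 * 168`, `1 / 168` is the constant of `exists_gain_le`, and `1 / 32` is the product of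
`1 / 2` in `mass_mul_exp_le` with `1 / 16` in the bound on the probability of a delivery. -/
def decayTime : ℕ := 5376

theorem one_sub_one_div_decayTime_nonneg : (0 : ℝ) ≤ 1 - 1 / decayTime := by
  norm_num [decayTime]

namespace Params

variable {p : Params} {n : ℕ}

/-- The number of pairs of a node and an undelivered token that it knows. -/
def mass (m : Fin n → p.Memory) : ℕ := ∑ v, (m v).pending.card

theorem mass_eq (m : Fin n → p.Memory) : mass m = ∑ τ ∈ undelivered m, (holders m τ).card := by
  classical
  have hpending (v : Fin n) :
      (m v).pending.card = ∑ τ ∈ undelivered m, if τ ∈ (m v).pending then 1 else 0 := by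
    rw [← card_filter, filter_mem_eq_inter, inter_eq_right.2 (subset_undelivered m v)]
  simp only [mass, hpending, holders, card_filter]
  exact sum_comm

theorem Delivers.mass_add_sum_eq {m m' : Fin n → p.Memory} {S : Finset p.Tok}
    (h : Delivers S m m') (hS : S ⊆ undelivered m) :
    mass m' + ∑ τ ∈ S, (holders m τ).card = mass m := by
  rw [mass_eq, mass_eq, h.undelivered_eq, ← sum_sdiff hS]
  congr 1
  exact sum_congr rfl fun τ hτ => by rw [h.holders_eq (mem_sdiff.1 hτ).2]

theorem card_slots_le (m : Fin n → p.Memory) :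
    ((slots m).card : ℝ) ≤ mass m / p.blockSize + n := by
  classical
  have hslots : slots m = univ.biUnion fun v : Fin n =>
      (univ.filter fun i : Fin p.numBlocks => (p.block (m v).pending i).1.Nonempty).image
        fun i => (v, i) := by
    ext ⟨v, i⟩
    simp [mem_slots]
  have hcard : (slots m).card ≤ ∑ v, ((m v).pending.card / p.blockSize + 1) := by
    rw [hslots]
    exact card_biUnion_le.trans (sum_le_sum fun v _ =>
      card_image_le.trans (card_nonempty_block_le _))
  calc ((slots m).card : ℝ)
      ≤ ∑ v : Fin n, ((((m v).pending.card / p.blockSize : ℕ) : ℝ) + 1) := by exact_mod_cast hcard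
    _ ≤ ∑ v : Fin n, (((m v).pending.card : ℝ) / p.blockSize + 1) := by
        gcongr
        exact Nat.cast_div_le
    _ = _ := by simp [sum_add_distrib, ← sum_div, mass]

variable (p) in
/-- The rate of the exponential part of the potential. A phase delivers at most
`21 * numBlocks * blockSize` tokens, so the exponent falls by at most `1`. -/
noncomputable def rate : ℝ := 1 / (21 * (p.numBlocks * p.blockSize))

variable (p) in
theorem cast_numBlocks_pos : (0 : ℝ) < p.numBlocks := Nat.cast_pos.2 p.numBlocks_pos

variable (p) in
theorem cast_blockSize_pos : (0 : ℝ) < p.blockSize := Nat.cast_pos.2 p.blockSize_pos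

variable (p) in
theorem rate_pos : 0 < p.rate := by
  have := p.cast_numBlocks_pos
  have := p.cast_blockSize_pos
  rw [rate]
  positivity

theorem rate_mul_le_one (hp : Fits p n) {s : ℕ} (hs : s ≤ p.capacity * p.blockSize + 1) :
    p.rate * s ≤ 1 := by
  have hpos := Nat.mul_pos p.numBlocks_pos p.blockSize_pos
  have hs : s ≤ 21 * (p.numBlocks * p.blockSize) := by
    rw [hp.capacity_eq, mul_assoc] at hs
    omega
  have hcast : (s : ℝ) ≤ 21 * (p.numBlocks * p.blockSize) := by exact_mod_cast hs
  rw [rate, one_div_mul_eq_div]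
  exact div_le_one_of_le₀ hcast (by positivity)

/-- Up to constants, how much the potential `mass m * exp (rate * (undelivered m).card)` falls,
relative to its exponential factor, when the token `τ` is delivered. -/
noncomputable def weight (m : Fin n → p.Memory) (τ : p.Tok) : ℝ :=
  (holders m τ).card + mass m * p.rate / 2

theorem weight_nonneg (m : Fin n → p.Memory) (τ : p.Tok) : 0 ≤ weight m τ := by
  have := p.rate_pos
  rw [weight]
  positivity

theorem sum_weight (m : Fin n → p.Memory) (S : Finset p.Tok) :
    ∑ τ ∈ S, weight m τ =
      ∑ τ ∈ S, ((holders m τ).card : ℝ) + mass m * (p.rate * S.card) / 2 := by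
  simp only [weight, sum_add_distrib, sum_const, nsmul_eq_mul]
  ring

/-- Every undelivered token is known to at least a fraction `1 / numBlocks` of the nodes. -/
def Spread (m : Fin n → p.Memory) : Prop :=
  ∀ τ ∈ undelivered m, n ≤ p.numBlocks * (holders m τ).card

section Light

variable (hp : Fits p n) {m : Fin n → p.Memory} (hm : Running m)
  (huid : Function.Injective fun v => (m v).uid) (hund : undelivered m ≠ ∅)

theorem exists_gain_le (hlight : Light m) (hund : undelivered m ≠ ∅) (hspread : Spread m) :
    ∃ q : ℝ, 0 ≤ q ∧ q ≤ 1 ∧ 4 * (slots m).card * q ≤ p.numBlocks ∧ ∀ τ ∈ undelivered m,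
      1 / 168 * ((holders m τ).card : ℝ) ≤
        weight m τ * ((holders m τ).card * q / (1 + (holders m τ).card * q)) := by
  classical
  have hnum := p.cast_numBlocks_pos
  have hslots : (0 : ℝ) < (slots m).card := by
    obtain ⟨τ, hτ⟩ := nonempty_iff_ne_empty.2 hund
    obtain ⟨v, hv⟩ := mem_undelivered.1 hτ
    obtain ⟨i, hi⟩ := exists_mem_block hv ((rank_lt hv).trans_le (hlight v))
    exact Nat.cast_pos.2 (card_pos.2 ⟨(v, i), mem_slots.2 ⟨τ, hi⟩⟩)
  refine ⟨min 1 ((p.numBlocks : ℝ) / (4 * (slots m).card)), by positivity, min_le_left _ _, ?_,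
    fun τ hτ => mul_le_add_mul_div_one_add (by norm_num) (Nat.cast_nonneg _) (by positivity) <|
      le_mul_min_one_div_add hnum p.cast_blockSize_pos hslots (Nat.cast_nonneg _)
        (Nat.cast_nonneg n) ?_ (by exact_mod_cast hspread τ hτ) (card_slots_le m)⟩
  · calc 4 * ((slots m).card : ℝ) * min 1 ((p.numBlocks : ℝ) / (4 * (slots m).card))
        ≤ 4 * (slots m).card * (p.numBlocks / (4 * (slots m).card)) := by
          gcongr
          exact min_le_right _ _
      _ = p.numBlocks := by field_simp
  · obtain ⟨v, hv⟩ := mem_undelivered.1 hτ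
    exact_mod_cast card_pos.2 ⟨v, mem_holders.2 hv⟩

include hp hm huid hund

theorem exists_undelivered_eq_sdiff {m' : Fin n → p.Memory}
    (h : Reach roundStep p.mainStage m m') :
    ∃ S ⊆ undelivered m, S.card ≤ p.capacity * p.blockSize + 1 ∧
      undelivered m' = undelivered m \ S ∧
      mass m' + ∑ τ ∈ S, (holders m τ).card = mass m := by
  obtain ⟨x, S, hS, -, hcard, hdel⟩ :=
    exists_delivers_of_mainStage_reach hm huid hund hp.blockCode_injective hp.le_floodLen h
  exact ⟨S, hS, hcard, hdel.undelivered_eq, hdel.mass_add_sum_eq hS⟩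

theorem mass_mul_exp_le {m' : Fin n → p.Memory} (h : Reach roundStep p.mainStage m m') :
    mass m' * Real.exp (p.rate * (undelivered m').card) ≤
      Real.exp (p.rate * (undelivered m).card) *
          (mass m - 1 / 2 * ∑ τ ∈ undelivered m, weight m τ) +
        ∑ τ ∈ undelivered m, Real.exp (p.rate * (undelivered m).card) / 2 * weight m τ *
          ind (τ ∈ undelivered m') := by
  classical
  obtain ⟨S, hS, hcard, hund', hadd⟩ := exists_undelivered_eq_sdiff hp hm huid hund h
  have hmass : (mass m' : ℝ) = mass m - ∑ τ ∈ S, ((holders m τ).card : ℝ) := by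
    rw [← hadd]
    push_cast
    ring
  have hexp : p.rate * (undelivered m').card =
      p.rate * (undelivered m).card + -(p.rate * S.card) := by
    rw [hund', card_sdiff_of_subset hS, Nat.cast_sub (card_le_card hS)]
    ring
  have hfall : (mass m - ∑ τ ∈ S, ((holders m τ).card : ℝ)) * Real.exp (-(p.rate * S.card)) ≤
      mass m - 1 / 2 * ∑ τ ∈ S, weight m τ := by
    rw [sum_weight]
    refine sub_mul_exp_neg_le (sum_nonneg fun _ _ => Nat.cast_nonneg _) ?_ ?_
      (rate_mul_le_one hp hcard)
    · rw [← sub_nonneg, ← hmass]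
      exact Nat.cast_nonneg _
    · exact mul_nonneg p.rate_pos.le (Nat.cast_nonneg _)
  simp only [mul_assoc, ← mul_sum]
  rw [hund', sum_mul_ind_mem_sdiff hS, ← hund', hmass, hexp, Real.exp_add, mul_left_comm]
  linarith [mul_le_mul_of_nonneg_left hfall (Real.exp_nonneg (p.rate * (undelivered m).card))]

theorem supExpect_mass_le [NeZero n] (hlight : Light m) (hspread : Spread m) :
    supExpect roundStep p.mainStage
        (fun m' => mass m' * Real.exp (p.rate * (undelivered m').card)) m ≤
      (1 - 1 / decayTime) * (mass m * Real.exp (p.rate * (undelivered m).card)) := by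
  obtain ⟨q, hq0, hq1, hq, hgain⟩ := exists_gain_le hlight hund hspread
  have hmass : (mass m : ℝ) = ∑ τ ∈ undelivered m, ((holders m τ).card : ℝ) := by
    exact_mod_cast mass_eq m
  set E := Real.exp (p.rate * (undelivered m).card)
  have hEpos : 0 < E := Real.exp_pos _
  set y : p.Tok → ℝ := fun τ => (holders m τ).card * q / (1 + (holders m τ).card * q)
  have hcoeff (τ : p.Tok) : 0 ≤ E / 2 * weight m τ :=
    mul_nonneg (half_pos hEpos).le (weight_nonneg m τ)
  calc _ ≤ E * (mass m - 1 / 2 * ∑ τ ∈ undelivered m, weight m τ) +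
        ∑ τ ∈ undelivered m, E / 2 * weight m τ * supExpect roundStep p.mainStage
          (fun m' => ind (τ ∈ undelivered m')) m :=
        (supExpect_mono fun _ h => mass_mul_exp_le hp hm huid hund h).trans
          (supExpect_affine_le _ _ _ _ (fun τ _ => hcoeff τ) _ _)
    _ ≤ E * (mass m - 1 / 2 * ∑ τ ∈ undelivered m, weight m τ) +
        ∑ τ ∈ undelivered m, E / 2 * weight m τ * (1 - 1 / 16 * y τ) := by
        gcongr with τ hτ
        · exact hcoeff τ
        · exact supExpect_mainStage_light_le hp hlight hm huid hτ hq0 hq1 hq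
    _ = E * (mass m - 1 / 32 * ∑ τ ∈ undelivered m, weight m τ * y τ) := by
        have hterm (τ : p.Tok) : E / 2 * weight m τ * (1 - 1 / 16 * y τ) =
            E / 2 * weight m τ - E / 32 * (weight m τ * y τ) := by ring
        simp only [hterm, sum_sub_distrib, ← mul_sum]
        ring
    _ ≤ E * (mass m - 1 / 32 * ∑ τ ∈ undelivered m, 1 / 168 * ((holders m τ).card : ℝ)) := by
        have := sum_le_sum hgain
        gcongr
    _ = _ := by
        rw [← mul_sum, ← hmass, decayTime]
        push_cast
        ring

theorem exp_rate_mul_le {m' : Fin n → p.Memory} (h : Reach roundStep p.mainStage m m') :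
    Real.exp (p.rate * (undelivered m').card) ≤
      Real.exp (p.rate * (undelivered m).card) * (41 / 42) +
        Real.exp (p.rate * (undelivered m).card) / 42 *
          ind (¬ (undelivered m').card + p.numBlocks * p.blockSize ≤ (undelivered m).card) := by
  have hrate := p.rate_pos
  by_cases hfall : (undelivered m').card + p.numBlocks * p.blockSize ≤ (undelivered m).card
  · rw [ind_neg (not_not.2 hfall), mul_zero, add_zero]
    have hstep : p.rate * (p.numBlocks * p.blockSize) = 1 / 21 := by
      have := p.cast_numBlocks_pos
      have := p.cast_blockSize_pos
      rw [rate]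
      field_simp
    have hcast : ((undelivered m').card : ℝ) + p.numBlocks * p.blockSize ≤
        (undelivered m).card := by
      exact_mod_cast hfall
    calc Real.exp (p.rate * (undelivered m').card)
        ≤ Real.exp (p.rate * (undelivered m).card + -(1 / 21)) := by
          gcongr
          linarith [mul_le_mul_of_nonneg_left hcast hrate.le]
      _ = Real.exp (p.rate * (undelivered m).card) * Real.exp (-(1 / 21)) := Real.exp_add _ _
      _ ≤ Real.exp (p.rate * (undelivered m).card) * (1 - 1 / 21 / 2) := by
          gcongr
          exact exp_neg_le_one_sub_half (by norm_num) (by norm_num)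
      _ = _ := by ring
  · obtain ⟨S, -, -, hund', -⟩ := exists_undelivered_eq_sdiff hp hm huid hund h
    have hle : (undelivered m').card ≤ (undelivered m).card := by
      classical
      rw [hund']
      exact card_le_card sdiff_subset
    rw [ind_pos hfall]
    calc Real.exp (p.rate * (undelivered m').card)
        ≤ Real.exp (p.rate * (undelivered m).card) := by gcongr
      _ = _ := by ring

end Light

theorem supExpect_exp_le [NeZero n] (hp : Fits p n) {m : Fin n → p.Memory} (hm : Running m)
    (huid : Function.Injective fun v => (m v).uid) (hheavy : ¬ Light m) :
    supExpect roundStep p.mainStage (fun m' => Real.exp (p.rate * (undelivered m').card)) m ≤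
      (1 - 1 / decayTime) * Real.exp (p.rate * (undelivered m).card) := by
  have hund := undelivered_ne_empty_of_not_light hheavy
  set E := Real.exp (p.rate * (undelivered m).card)
  have hEpos : 0 < E := Real.exp_pos _
  calc _ ≤ supExpect roundStep p.mainStage (fun _ => E * (41 / 42)) m +
        supExpect roundStep p.mainStage (fun m' => E / 42 *
          ind (¬ (undelivered m').card + p.numBlocks * p.blockSize ≤ (undelivered m).card)) m :=
        (supExpect_mono fun _ h => exp_rate_mul_le hp hm huid hund h).trans
          (supExpect_add_le _ _ _ _)
    _ ≤ E * (41 / 42) + E / 42 * (1 / 2) := by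
        gcongr
        · exact supExpect_le_of_forall fun _ _ => le_rfl
        · refine (supExpect_mul_le _ (by positivity) _ _).trans ?_
          gcongr
          exact supExpect_mainStage_heavy_le hp hm huid hheavy
    _ ≤ (1 - 1 / decayTime) * E := by
        rw [decayTime]
        push_cast
        linarith

/-! ### A sequence of phases -/

variable (p) in
/-- The kinds of the rounds of `j` phases. -/
def phases (j : ℕ) : List Kind := (List.replicate j p.phase).flatten

theorem phases_succ (j : ℕ) : p.phases (j + 1) = p.phase ++ p.phases j := by
  simp [phases, List.replicate_succ]

theorem phases_succ' (j : ℕ) : p.phases (j + 1) = p.phases j ++ p.phase := by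
  simp [phases, List.replicate_succ']

theorem roundStep_of_isSome {m : Fin n → p.Memory} {v : Fin n} (h : (m v).out.isSome = true)
    (k : Kind) (G : ConnectedGraph (Fin n)) (x : Fin n → p.Coin) : roundStep k G m x v = m v :=
  if_pos h

/-- All nodes have terminated with output `A`. -/
def Done (A : Finset p.Tok) (m : Fin n → p.Memory) : Prop := ∀ v, (m v).out = some A

theorem Done.reach {A : Finset p.Tok} {m m' : Fin n → p.Memory} (h : Done A m) {l : List Kind}
    (hr : Reach roundStep l m m') : Done A m' :=
  Reach.invariant (I := Done A) (fun k _ G m x hm v => by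
    rw [roundStep_of_isSome (Option.isSome_of_eq_some (hm v))]
    exact hm v) hr h

theorem Invariant.phases_reach {A : Finset p.Tok} {m m' : Fin n → p.Memory} (h : Invariant A m)
    (hinj : Function.Injective p.blockCode) (hL : n ≤ p.floodLen) {j : ℕ}
    (hr : Reach roundStep (p.phases j) m m') :
    Done A m' ∨ Invariant A m' ∧ (undelivered m').card + j ≤ (undelivered m).card := by
  induction j generalizing m with
  | zero =>
    rw [show m' = m from hr]
    exact Or.inr ⟨h, le_rfl⟩
  | succ j ih =>
    rw [phases_succ, reach_append] at hr
    obtain ⟨m₁, hphase, hr⟩ := hr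
    rcases h.phase_reach hinj hL hphase with ⟨-, hdone⟩ | ⟨h₁, hlt⟩
    · exact Or.inl (Done.reach hdone hr)
    · exact (ih h₁ hr).imp_right fun ⟨h', _⟩ => ⟨h', by omega⟩

theorem Invariant.done_of_undelivered_eq_empty {A : Finset p.Tok} {m m' : Fin n → p.Memory}
    (h : Invariant A m) (hp : Fits p n) (hund : undelivered m = ∅) {j : ℕ}
    (hr : Reach roundStep (p.phases (j + 1)) m m') : Done A m' :=
  (h.phases_reach hp.blockCode_injective hp.le_floodLen hr).resolve_right fun hcard => by
    simp [hund] at hcard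

/-- The states from which the potential decreases in expectation: either the tokens are still
being forwarded, or forwarding has stopped because no node is heavy and all tokens are spread. -/
def Good (m : Fin n → p.Memory) : Prop :=
  (∀ v, (m v).forwarding = true) ∨ (∀ v, (m v).forwarding = false) ∧ Light m ∧ Spread m

open Classical in
/-- The potential function of the analysis. As long as the tokens are forwarded, the mass may grow
and is replaced by its upper bound `n ^ 2`. -/
noncomputable def potential (m : Fin n → p.Memory) : ℝ :=
  (if ∀ v, (m v).forwarding = true then (n : ℝ) ^ 2 else mass m) *
    Real.exp (p.rate * (undelivered m).card)

theorem potential_of_forwarding {m : Fin n → p.Memory} (h : ∀ v, (m v).forwarding = true) :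
    potential m = (n : ℝ) ^ 2 * Real.exp (p.rate * (undelivered m).card) := by
  rw [potential, if_pos h]

theorem potential_of_not_forwarding {m : Fin n → p.Memory} {v : Fin n}
    (h : (m v).forwarding = false) :
    potential m = mass m * Real.exp (p.rate * (undelivered m).card) := by
  rw [potential, if_neg fun hf => by simp [hf v] at h]

theorem potential_nonneg (m : Fin n → p.Memory) : 0 ≤ potential m := by
  unfold potential
  split_ifs <;> positivity

theorem one_le_potential [NeZero n] {m : Fin n → p.Memory} (hund : undelivered m ≠ ∅) :
    1 ≤ potential m := by
  have hexp : 1 ≤ Real.exp (p.rate * (undelivered m).card) :=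
    Real.one_le_exp (mul_nonneg p.rate_pos.le (Nat.cast_nonneg _))
  refine one_le_mul_of_one_le_of_one_le ?_ hexp
  split_ifs
  · exact one_le_pow₀ (Nat.one_le_cast.2 NeZero.one_le)
  · obtain ⟨τ, hτ⟩ := nonempty_iff_ne_empty.2 hund
    obtain ⟨v, hv⟩ := mem_undelivered.1 hτ
    exact Nat.one_le_cast.2 ((card_pos.2 ⟨τ, hv⟩).trans_le
      (single_le_sum (f := fun v => (m v).pending.card) (fun _ _ => Nat.zero_le _) (mem_univ v)))

theorem Invariant.undelivered_subset {A : Finset p.Tok} {m : Fin n → p.Memory}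
    (h : Invariant A m) (v : Fin n) : undelivered m ⊆ A :=
  subset_union_left.trans (h.undelivered_union v).subset

theorem Invariant.mass_le_sq {A : Finset p.Tok} {m : Fin n → p.Memory} (h : Invariant A m)
    (hA : A.card ≤ n) : (mass m : ℝ) ≤ (n : ℝ) ^ 2 := by
  have hpending (v : Fin n) : (m v).pending.card ≤ n :=
    (card_le_card ((subset_undelivered m v).trans (h.undelivered_subset v))).trans hA
  have hmass : mass m ≤ n ^ 2 := (sum_le_sum fun v _ => hpending v).trans (by simp [sq])
  exact_mod_cast hmass

theorem Invariant.mass_mul_exp_le_potential {A : Finset p.Tok} {m : Fin n → p.Memory}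
    (h : Invariant A m) (hA : A.card ≤ n) :
    mass m * Real.exp (p.rate * (undelivered m).card) ≤ potential m := by
  rw [potential]
  gcongr
  split_ifs
  · exact h.mass_le_sq hA
  · exact le_rfl

section MainStage

variable (hp : Fits p n) {A : Finset p.Tok} {m m' : Fin n → p.Memory} (h : Invariant A m)
  (hund : undelivered m ≠ ∅)

include hp h hund

theorem forwarding_of_mainStage_reach (hr : Reach roundStep p.mainStage m m') (v : Fin n) :
    (m' v).forwarding = true ↔ (m v).forwarding = true ∧ ¬ Light m := by
  obtain ⟨x, S, -, -, -, hdel⟩ := exists_delivers_of_mainStage_reach h.running h.uid_injective hund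
    hp.blockCode_injective hp.le_floodLen hr
  rw [hdel.forwarding_eq]
  exact forwarding_sampleState m x v

theorem light_and_spread_of_mainStage_reach (hr : Reach roundStep p.mainStage m m')
    (hlight : Light m) (hspread : Spread m) : Light m' ∧ Spread m' := by
  obtain ⟨x, S, -, -, -, hdel⟩ := exists_delivers_of_mainStage_reach h.running h.uid_injective hund
    hp.blockCode_injective hp.le_floodLen hr
  constructor
  · intro v
    rw [hdel.pending_eq]
    exact (card_le_card sdiff_subset).trans (hlight v)
  · intro τ hτ
    rw [hdel.undelivered_eq, mem_sdiff] at hτ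
    rw [hdel.holders_eq hτ.2]
    exact hspread τ hτ.1

theorem good_of_mainStage_reach (hr : Reach roundStep p.mainStage m m') (hgood : Good m)
    (hspread : Light m → Spread m) : Good m' := by
  have hforwarding := forwarding_of_mainStage_reach hp h hund hr
  by_cases hlight : Light m
  · refine Or.inr ⟨fun v => ?_,
      light_and_spread_of_mainStage_reach hp h hund hr hlight (hspread hlight)⟩
    rw [← Bool.not_eq_true, hforwarding]
    exact fun hv => hv.2 hlight
  · have hf := hgood.resolve_right fun hstopped => hlight hstopped.2.1
    exact Or.inl fun v => (hforwarding v).2 ⟨hf v, hlight⟩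

theorem supExpect_potential_mainStage_le [NeZero n] (hA : A.card ≤ n) (hgood : Good m)
    (hspread : Light m → Spread m) :
    supExpect roundStep p.mainStage potential m ≤ (1 - 1 / decayTime) * potential m := by
  by_cases hlight : Light m
  · calc _ ≤ supExpect roundStep p.mainStage
          (fun m' => mass m' * Real.exp (p.rate * (undelivered m').card)) m :=
          supExpect_mono fun m' hr => (potential_of_not_forwarding (v := 0) <| by
            rw [← Bool.not_eq_true, forwarding_of_mainStage_reach hp h hund hr]
            exact fun hv => hv.2 hlight).le
      _ ≤ (1 - 1 / decayTime) * (mass m * Real.exp (p.rate * (undelivered m).card)) :=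
          supExpect_mass_le hp h.running h.uid_injective hund hlight (hspread hlight)
      _ ≤ (1 - 1 / decayTime) * potential m :=
          mul_le_mul_of_nonneg_left (h.mass_mul_exp_le_potential hA)
            one_sub_one_div_decayTime_nonneg
  · have hf := hgood.resolve_right fun hstopped => hlight hstopped.2.1
    calc _ ≤ supExpect roundStep p.mainStage
          (fun m' => (n : ℝ) ^ 2 * Real.exp (p.rate * (undelivered m').card)) m :=
          supExpect_mono fun m' hr => (potential_of_forwarding fun v =>
            (forwarding_of_mainStage_reach hp h hund hr v).2 ⟨hf v, hlight⟩).le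
      _ ≤ (n : ℝ) ^ 2 * supExpect roundStep p.mainStage
          (fun m' => Real.exp (p.rate * (undelivered m').card)) m :=
          supExpect_mul_le _ (by positivity) _ _
      _ ≤ (n : ℝ) ^ 2 * ((1 - 1 / decayTime) * Real.exp (p.rate * (undelivered m).card)) := by
          gcongr
          exact supExpect_exp_le hp h.running h.uid_injective hlight
      _ = (1 - 1 / decayTime) * potential m := by
          rw [potential_of_forwarding hf]
          ring

theorem supExpect_mainStage_le [NeZero n] (hA : A.card ≤ n) (hgood : Good m)
    (hspread : Light m → Spread m) {f : (Fin n → p.Memory) → ℝ} {a c : ℝ} (ha : 0 ≤ a)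
    (hf : ∀ m', Invariant A m' → Good m' → f m' ≤ c + a * potential m') :
    supExpect roundStep p.mainStage f m ≤ c + (1 - 1 / decayTime) * a * potential m := by
  calc _ ≤ supExpect roundStep p.mainStage (fun m' => c + a * potential m') m :=
        supExpect_mono fun m' hr => hf m'
          (h.mainStage_reach hund hp.blockCode_injective hp.le_floodLen hr).1
          (good_of_mainStage_reach hp h hund hr hgood hspread)
    _ ≤ c + supExpect roundStep p.mainStage (fun m' => a * potential m') m :=
        (supExpect_add_le _ _ _ _).trans
          (add_le_add_left (supExpect_le_of_forall fun _ _ => le_rfl) _)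
    _ ≤ c + a * ((1 - 1 / decayTime) * potential m) := by
        gcongr
        refine (supExpect_mul_le _ ha _ _).trans ?_
        gcongr
        exact supExpect_potential_mainStage_le hp h hund hA hgood hspread
    _ = _ := by ring

end MainStage

section FwdStage

variable {A : Finset p.Tok} {m m' : Fin n → p.Memory} (h : Invariant A m)

include h

theorem Invariant.eq_or_forwarding_of_fwd_reach {F : ℕ}
    (hr : Reach roundStep (List.replicate F Kind.fwd) m m') :
    m' = m ∨ (∀ v, (m v).forwarding = true) ∧ ∀ v, (m' v).forwarding = true := by
  obtain ⟨-, -, hforwarding, -, hsame⟩ := h.fwd_reach hr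
  by_cases hf : ∀ v, (m v).forwarding = true
  · exact Or.inr ⟨hf, fun v => (hforwarding v).trans (hf v)⟩
  · obtain ⟨v, hv⟩ := not_forall.1 hf
    exact Or.inl (hsame v (Bool.not_eq_true _ ▸ hv))

theorem Invariant.good_of_fwd_reach {F : ℕ}
    (hr : Reach roundStep (List.replicate F Kind.fwd) m m') (hgood : Good m) : Good m' := by
  rcases h.eq_or_forwarding_of_fwd_reach hr with rfl | ⟨-, hf⟩
  · exact hgood
  · exact Or.inl hf

theorem Invariant.potential_eq_of_fwd_reach {F : ℕ}
    (hr : Reach roundStep (List.replicate F Kind.fwd) m m') : potential m' = potential m := by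
  rcases h.eq_or_forwarding_of_fwd_reach hr with rfl | ⟨hf, hf'⟩
  · rfl
  · rw [potential_of_forwarding hf, potential_of_forwarding hf', (h.fwd_reach hr).2.1]

end FwdStage

variable (p n) in
/-- An upper bound on the probability that after the forwarding rounds of a phase, no node is heavy
but some token is not spread. -/
noncomputable def fwdFailure : ℝ :=
  n * (2 ^ (n / p.numBlocks) * (1 - 1 / p.numBlocks / 2) ^ p.fwdLen)

variable (p n) in
theorem fwdFailure_nonneg : 0 ≤ p.fwdFailure n := by
  have hle : (1 : ℝ) / p.numBlocks ≤ 1 :=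
    div_le_one_of_le₀ (Nat.one_le_cast.2 p.numBlocks_pos) p.cast_numBlocks_pos.le
  have : (0 : ℝ) ≤ 1 - 1 / p.numBlocks / 2 := by linarith
  rw [fwdFailure]
  positivity

theorem exists_of_not_spread {m : Fin n → p.Memory} (h : ¬ Spread m) :
    ∃ τ ∈ undelivered m, holders m τ ≠ univ ∧ (holders m τ).card ≤ n / p.numBlocks := by
  simp only [Spread, not_forall, not_le] at h
  obtain ⟨τ, hτ, hlt⟩ := h
  refine ⟨τ, hτ, fun hall => ?_, ?_⟩
  · rw [hall, card_univ, Fintype.card_fin] at hlt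
    exact hlt.not_ge (Nat.le_mul_of_pos_left n p.numBlocks_pos)
  · rw [Nat.le_div_iff_mul_le p.numBlocks_pos, mul_comm]
    exact hlt.le

theorem supExpect_fwd_not_spread_le [NeZero n] {A : Finset p.Tok} {m : Fin n → p.Memory}
    (h : Invariant A m) (hA : A.card ≤ n) (hgood : Good m) :
    supExpect roundStep (List.replicate p.fwdLen Kind.fwd)
      (fun m₁ => ind (Light m₁ ∧ ¬ Spread m₁)) m ≤ p.fwdFailure n := by
  rcases hgood with hf | ⟨hf, -, hspread⟩
  · calc _ ≤ supExpect roundStep (List.replicate p.fwdLen Kind.fwd) (fun m₁ =>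
            ∑ τ ∈ undelivered m, ind (Light m₁ ∧ holders m₁ τ ≠ univ ∧
              (holders m₁ τ).card ≤ n / p.numBlocks)) m := by
          refine supExpect_mono fun m₁ hr => (ind_mono fun ⟨hlight, hns⟩ => ?_).trans
            (ind_exists_le_sum _ _)
          obtain ⟨τ, hτ, hfew⟩ := exists_of_not_spread hns
          exact ⟨τ, (h.fwd_reach hr).2.1 ▸ hτ, hlight, hfew⟩
      _ ≤ ∑ _τ ∈ undelivered m,
            (2 : ℝ) ^ (n / p.numBlocks) * (1 - 1 / (p.numBlocks : ℝ) / 2) ^ p.fwdLen :=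
          (supExpect_sum_le _ _ _ _).trans (sum_le_sum fun τ hτ =>
            supExpect_fwd_le h.running hf (mem_undelivered.1 hτ) p.fwdLen _)
      _ ≤ p.fwdFailure n := by
          have hcard : (undelivered m).card ≤ n :=
            (card_le_card (h.undelivered_subset 0)).trans hA
          have hle : (1 : ℝ) / p.numBlocks ≤ 1 :=
            div_le_one_of_le₀ (Nat.one_le_cast.2 p.numBlocks_pos) p.cast_numBlocks_pos.le
          have : (0 : ℝ) ≤ 1 - 1 / p.numBlocks / 2 := by linarith
          rw [sum_const, nsmul_eq_mul, fwdFailure]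
          gcongr
  · refine supExpect_le_of_forall fun m₁ hr => ?_
    rw [(h.fwd_reach hr).2.2.2.2 0 (hf 0), ind_neg fun hns => hns.2 hspread]
    exact p.fwdFailure_nonneg n

section Phases

variable [NeZero n] (hp : Fits p n) {A : Finset p.Tok} (hA : A.card ≤ n)

include hp hA

theorem supExpect_phase_le {m : Fin n → p.Memory} (h : Invariant A m) (hgood : Good m)
    (hund : undelivered m ≠ ∅) {f : (Fin n → p.Memory) → ℝ} (hf1 : ∀ m', f m' ≤ 1) {a c : ℝ}
    (ha : 0 ≤ a) (hc : 0 ≤ c) (hf : ∀ m', Invariant A m' → Good m' → f m' ≤ c + a * potential m') :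
    supExpect roundStep p.phase f m ≤
      c + (1 - 1 / decayTime) * a * potential m + p.fwdFailure n := by
  set K : ℝ := c + (1 - 1 / decayTime) * a * potential m with hK
  have hK0 : 0 ≤ K := add_nonneg hc <|
    mul_nonneg (mul_nonneg one_sub_one_div_decayTime_nonneg ha) (potential_nonneg m)
  have hmain (m₁) (hr : Reach roundStep (List.replicate p.fwdLen Kind.fwd) m m₁) :
      supExpect roundStep p.mainStage f m₁ ≤ K + ind (Light m₁ ∧ ¬ Spread m₁) := by
    obtain ⟨h₁, hund₁, -⟩ := h.fwd_reach hr
    by_cases hbad : Light m₁ ∧ ¬ Spread m₁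
    · rw [ind_pos hbad]
      exact (supExpect_le_of_forall fun m' _ => hf1 m').trans (le_add_of_nonneg_left hK0)
    · rw [ind_neg hbad, add_zero, hK, ← h.potential_eq_of_fwd_reach hr]
      exact supExpect_mainStage_le hp h₁ (hund₁ ▸ hund) hA (h.good_of_fwd_reach hr hgood)
        (by tauto) ha hf
  rw [phase_eq, ← mainStage, supExpect_append]
  calc _ ≤ supExpect roundStep (List.replicate p.fwdLen Kind.fwd)
        (fun m₁ => K + ind (Light m₁ ∧ ¬ Spread m₁)) m := supExpect_mono hmain
    _ ≤ _ := (supExpect_add_le _ _ _ _).trans (add_le_add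
        (supExpect_le_of_forall fun _ _ => le_rfl) (supExpect_fwd_not_spread_le h hA hgood))

theorem supExpect_not_done_le (j : ℕ) {m : Fin n → p.Memory} (h : Invariant A m)
    (hgood : Good m) :
    supExpect roundStep (p.phases (j + 1)) (fun m' => ind (¬ Done A m')) m ≤
      j * p.fwdFailure n + (1 - 1 / decayTime) ^ j * potential m := by
  have hfail := p.fwdFailure_nonneg n
  induction j generalizing m with
  | zero =>
    rw [Nat.cast_zero, zero_mul, pow_zero, one_mul, zero_add (potential m)]
    refine supExpect_le_of_forall fun m' hr => ?_
    by_cases hund : undelivered m = ∅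
    · rw [ind_neg (not_not.2 (h.done_of_undelivered_eq_empty hp hund hr))]
      exact potential_nonneg m
    · exact (ind_le_one _).trans (one_le_potential hund)
  | succ j ih =>
    by_cases hund : undelivered m = ∅
    · have hpot := potential_nonneg m
      have hdecay := one_sub_one_div_decayTime_nonneg
      refine supExpect_le_of_forall fun m' hr => ?_
      rw [ind_neg (not_not.2 (h.done_of_undelivered_eq_empty hp hund hr))]
      positivity
    · rw [phases_succ, supExpect_append]
      refine (supExpect_phase_le hp hA h hgood hund
        (fun m' => supExpect_le_of_forall fun _ _ => ind_le_one _)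
        (pow_nonneg one_sub_one_div_decayTime_nonneg j) (mul_nonneg (Nat.cast_nonneg j) hfail)
        fun m' => ih).trans (le_of_eq ?_)
      push_cast
      ring

end Phases

/-! ### The whole execution -/

theorem kinds_add (t : ℕ) {i : ℕ} (hi : i ≤ p.phase.length) :
    p.kinds (t * p.phase.length + i) = p.kinds (t * p.phase.length) ++ p.phase.take i := by
  induction i with
  | zero => simp
  | succ i ih =>
    have hmod : (t * p.phase.length + i) % p.phase.length = i := by
      rw [Nat.mul_add_mod_of_lt hi]
    rw [← Nat.add_assoc, kinds, ih (by omega), List.append_assoc, List.take_add_one,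
      List.getElem?_eq_getElem hi]
    simp only [schedule, Option.toList_some, hmod]

theorem kinds_mul_length (j : ℕ) : p.kinds (j * p.phase.length) = p.phases j := by
  induction j with
  | zero => simp [kinds, phases]
  | succ j ih =>
    rw [Nat.succ_mul, kinds_add j le_rfl, ih, List.take_length, phases_succ']

theorem exists_kinds_eq_append {t t' : ℕ} (h : t ≤ t') : ∃ l, p.kinds t' = p.kinds t ++ l := by
  induction t', h using Nat.le_induction with
  | base => exact ⟨[], (List.append_nil _).symm⟩
  | succ t' _ ih =>
    obtain ⟨l, hl⟩ := ih
    exact ⟨l ++ [p.schedule t'], by rw [kinds, hl, List.append_assoc]⟩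

theorem length_phase : p.phase.length = p.fwdLen + 2 * p.floodLen + 2 * p.codeLen + 5 := by
  simp [phase]
  ring

theorem supExpect_kinds_antitone [NeZero n] {t t' : ℕ} (h : t ≤ t') (m : Fin n → p.Memory) :
    supExpect roundStep (p.kinds t') (fun m' => ind (¬ ∀ v, (m' v).out.isSome = true)) m ≤
      supExpect roundStep (p.kinds t) (fun m' => ind (¬ ∀ v, (m' v).out.isSome = true)) m := by
  obtain ⟨l, hl⟩ := exists_kinds_eq_append (p := p) h
  have hstay (k : Kind) (_ : k ∈ l) (G : ConnectedGraph (Fin n)) (m : Fin n → p.Memory)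
      (x : Fin n → p.Coin) (hm : ∀ v, (m v).out.isSome = true) (v : Fin n) :
      (roundStep k G m x v).out.isSome = true := by
    rw [roundStep_of_isSome (hm v)]
    exact hm v
  rw [hl, supExpect_append]
  exact supExpect_mono fun m₁ _ => supExpect_le_of_forall fun m₂ hr =>
    ind_mono fun hnot hsome => hnot (Reach.invariant hstay hr hsome)

section Execution

variable {b : ℕ} {uid : Fin n → ℕ} {tok : Fin n → Finset (Token p.d)}

theorem undelivered_initMemory :
    undelivered (fun v => p.initMemory (uid v) (tok v)) = univ.biUnion tok := by
  ext τ
  simp [mem_undelivered, initMemory]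

section Simulation

variable (hp : Fits p n) (huid : Function.Injective uid) (hU : ∀ v, uid v < p.idRange)

include huid hU in
theorem invariant_initMemory :
    Invariant (univ.biUnion tok) fun v => p.initMemory (uid v) (tok v) where
  running _ := rfl
  uid_injective v w h := huid <| by
    simpa [initMemory, Nat.mod_eq_of_lt (hU v), Nat.mod_eq_of_lt (hU w)] using congrArg Fin.val h
  undelivered_union v := by
    rw [undelivered_initMemory]
    simp [initMemory]
  forwarding_eq _ _ := rfl

variable (adv : Adversary n p.Coin) (henc : Function.Injective (p.encode b))

include henc in
theorem exists_extension (t : ℕ) (x : Fin t → Fin n → p.Coin) (v : Fin n)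
    (h : (memories uid tok adv b t x v).out.isSome = true) (s : ℕ) :
    ∃ y : Fin (t + s) → Fin n → p.Coin,
      memories uid tok adv b (t + s) y v = memories uid tok adv b t x v := by
  induction s with
  | zero => exact ⟨x, rfl⟩
  | succ s ih =>
    obtain ⟨y, hy⟩ := ih
    refine ⟨Fin.snoc (α := fun _ => Fin n → p.Coin) y (Classical.arbitrary _), ?_⟩
    change memories uid tok adv b (t + s + 1) _ v = _
    rw [memories_succ uid tok adv henc, Fin.init_snoc, roundStep_of_isSome (by rwa [hy]), hy]

include hp huid hU henc in
theorem done_memories {j : ℕ} (hj : (univ.biUnion tok).card < j)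
    (x : Fin (j * p.phase.length) → Fin n → p.Coin) :
    Done (univ.biUnion tok) (memories uid tok adv b (j * p.phase.length) x) := by
  have hreach := memories_reach uid tok adv henc (j * p.phase.length) x
  rw [kinds_mul_length] at hreach
  refine ((invariant_initMemory huid hU).phases_reach hp.blockCode_injective hp.le_floodLen
    hreach).resolve_right fun ⟨_, hcard⟩ => ?_
  rw [undelivered_initMemory] at hcard
  omega

include hp huid hU henc

theorem machine_disseminates : (p.machine b).Disseminates uid tok adv where
  correct t x v S hS := by
    have hout : (memories uid tok adv b t x v).out = some S := hS
    set j := t + (univ.biUnion tok).card + 1 with hj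
    have hphase : 0 < p.phase.length := List.length_pos_of_ne_nil p.phase_ne_nil
    obtain ⟨s, hs⟩ := Nat.exists_eq_add_of_le (show t ≤ j * p.phase.length by nlinarith)
    obtain ⟨y, hy⟩ := exists_extension adv henc t x v (Option.isSome_of_eq_some hout) s
    have hdone := done_memories (tok := tok) hp huid hU adv henc (show _ < j by omega)
    rw [hs] at hdone
    exact Option.some.inj (hout.symm.trans (hy ▸ hdone y v))
  terminates x := ⟨((univ.biUnion tok).card + 1) * p.phase.length, fun v =>
    Option.isSome_of_eq_some (done_memories hp huid hU adv henc (Nat.lt_succ_self _) _ v)⟩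

theorem le_haltProb [NeZero n] (hk : (univ.biUnion tok).card ≤ n) (j : ℕ) {t : ℕ}
    (ht : (j + 1) * p.phase.length ≤ t) :
    1 - (j * p.fwdFailure n + (1 - 1 / decayTime) ^ j *
        ((n : ℝ) ^ 2 * Real.exp (p.rate * (univ.biUnion tok).card))) ≤
      (p.machine b).haltProb uid tok adv t := by
  set m₀ : Fin n → p.Memory := fun v => p.initMemory (uid v) (tok v)
  have hpot : potential m₀ = (n : ℝ) ^ 2 * Real.exp (p.rate * (univ.biUnion tok).card) := by
    rw [potential_of_forwarding fun _ => rfl, undelivered_initMemory]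
  refine le_trans (sub_le_sub_left ?_ 1) (one_sub_supExpect_le_haltProb uid tok adv henc t)
  calc supExpect roundStep (p.kinds t) (fun m => ind (¬ ∀ v, (m v).out.isSome = true)) m₀
      ≤ supExpect roundStep (p.phases (j + 1)) (fun m => ind (¬ ∀ v, (m v).out.isSome = true))
          m₀ := by
        rw [← kinds_mul_length]
        exact supExpect_kinds_antitone ht m₀
    _ ≤ supExpect roundStep (p.phases (j + 1)) (fun m => ind (¬ Done (univ.biUnion tok) m)) m₀ :=
        supExpect_mono fun _ _ => ind_mono <| mt fun hdone v => Option.isSome_of_eq_some (hdone v)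
    _ ≤ j * p.fwdFailure n + (1 - 1 / decayTime) ^ j * potential m₀ :=
        supExpect_not_done_le hp hk j (invariant_initMemory huid hU) (Or.inl fun _ => rfl)
    _ = _ := by rw [hpot]

end Simulation

end Execution

end Params

/-! ### The choice of the parameters -/

/-- The number of binary digits of `N`, which stands for `log n` in the choice of the parameters. -/
def bits (N : ℕ) : ℕ := Nat.log 2 N + 1

/-- The number of phases is at most `phaseFactor c * n`. -/
def phaseFactor (c : ℕ) : ℕ := decayTime * (13 + 4 * c) + 1

/-- The length of the forwarding stage, relative to `N`. -/
def fwdFactor (c : ℕ) : ℕ := 4 * (1 + 2 * (c + 3 + phaseFactor c))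

/-- The parameters for the exponent `c` of the error probability, identifiers below `n ^ u`,
the estimate `N` of `n`, messages of `O(b)` bits, and tokens of `d` bits. -/
def params (c u N b d : ℕ) : Params where
  d := d
  blockSize := max 1 (b / max d 1)
  numBlocks := max 1 (min b (N / bits N + 1))
  capacity := 20 * max 1 (min b (N / bits N + 1))
  keyRange := 2 * N * max 1 (min b (N / bits N + 1)) + 1
  hashBits := 29 * b + 1
  idRange := (2 * N) ^ u + 1
  floodLen := 2 * N
  fwdLen := fwdFactor c * N
  codeLen := 132 * N
  blockSize_pos := by positivity
  numBlocks_pos := by positivity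
  keyRange_pos := by positivity
  idRange_pos := by positivity
  hashBits_ne_zero := by positivity

section Choice

variable {c u N b d n k : ℕ}

theorem bits_pos : 0 < bits N := Nat.succ_pos _

theorem lt_two_pow_bits : N < 2 ^ bits N := Nat.lt_pow_succ_log_self one_lt_two N

theorem bits_le (hN : 0 < N) : bits N ≤ N := Nat.log_lt_self 2 hN.ne'

theorem cast_bits_le_logb (h2 : 2 ≤ n) (hNn : N ≤ 2 * n) :
    (bits N : ℝ) ≤ 3 * Real.logb 2 n := by
  have hlog : (Nat.log 2 N : ℝ) ≤ 1 + Real.logb 2 n :=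
    calc (Nat.log 2 N : ℝ) ≤ Nat.log 2 (n * 2) := by
          exact_mod_cast Nat.log_mono_right (by omega)
      _ = 1 + Nat.log 2 n := by
          rw [Nat.log_mul_base one_lt_two (by omega)]
          push_cast
          ring
      _ ≤ 1 + Real.logb 2 n := by
          gcongr
          exact_mod_cast Real.natLog_le_logb n 2
  have hone := one_le_logb_two (show (2 : ℝ) ≤ n by exact_mod_cast h2)
  rw [bits]
  push_cast
  linarith

theorem cast_le_exp_bits (hnN : n ≤ 2 * N) : (n : ℝ) ≤ Real.exp (2 * bits N) := by
  have hpow : n ≤ 2 ^ (2 * bits N) :=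
    calc n ≤ 2 * N := hnN
      _ ≤ 2 ^ bits N * 2 ^ bits N :=
        Nat.mul_le_mul (Nat.le_self_pow bits_pos.ne' 2) lt_two_pow_bits.le
      _ = _ := by ring
  calc (n : ℝ) ≤ (2 : ℝ) ^ (2 * bits N) := by exact_mod_cast hpow
    _ ≤ Real.exp (2 * bits N) := by exact_mod_cast two_pow_le_exp (2 * bits N)

theorem exp_neg_bits_le (hn : 0 < n) (hnN : n ≤ 2 * N) (j : ℕ) :
    Real.exp (-(2 * bits N * j)) ≤ 1 / (n : ℝ) ^ j := by
  rw [Real.exp_neg, ← one_div, mul_comm _ (j : ℝ), Real.exp_nat_mul]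
  gcongr
  exact cast_le_exp_bits hnN

theorem params_numBlocks (hb : 0 < b) :
    (params c u N b d).numBlocks = min b (N / bits N + 1) :=
  max_eq_right (le_min hb (Nat.succ_pos _))

theorem params_numBlocks_le (hb : 0 < b) : (params c u N b d).numBlocks ≤ b :=
  (params_numBlocks hb).trans_le (min_le_left _ _)

theorem params_blockSize (hb : 0 < b) (hd : d ≤ b) :
    (params c u N b d).blockSize = b / max d 1 :=
  max_eq_right (Nat.div_pos (max_le hd hb) (by positivity))

theorem params_capacity : (params c u N b d).capacity = 20 * (params c u N b d).numBlocks := rfl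

theorem bits_mul_params_numBlocks_le (hN : 0 < N) (hb : 0 < b) :
    bits N * (params c u N b d).numBlocks ≤ 2 * N :=
  calc bits N * (params c u N b d).numBlocks ≤ bits N * (N / bits N + 1) := by
        rw [params_numBlocks hb]
        gcongr
        exact min_le_right _ _
    _ = bits N * (N / bits N) + bits N := Nat.mul_succ _ _
    _ ≤ N + N := add_le_add (Nat.mul_div_le _ _) (bits_le hN)
    _ = 2 * N := (two_mul N).symm

theorem card_block_params_le (hb : 0 < b) (hd : d ≤ b) :
    (2 ^ (params c u N b d).d + 1) ^ (params c u N b d).blockSize ≤ 2 ^ (2 * b) := by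
  rw [params_blockSize hb hd]
  exact two_pow_add_one_pow_div_le d b

theorem card_codeVec_params_le (hb : 0 < b) :
    Fintype.card (params c u N b d).CodeVec ≤ 2 ^ (80 * b) := by
  have hnum := params_numBlocks_le (c := c) (u := u) (N := N) (d := d) hb
  rw [Params.card_codeVec, params_capacity, ← pow_add, ← pow_add]
  change 2 ^ (20 * (params c u N b d).numBlocks + (29 * b + 1 + (29 * b + 1))) ≤ _
  exact Nat.pow_le_pow_right two_pos (by omega)

section MessageSize

variable (hNn : N ≤ 2 * n) (hb : 0 < b) (hn : n ≤ 2 ^ b) (hd : d ≤ b)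
include hNn hb hn

theorem two_mul_le_two_pow : 2 * N ≤ 2 ^ (3 * b) :=
  calc 2 * N ≤ 4 * 2 ^ b := by omega
    _ = 2 ^ (b + 2) := by ring
    _ ≤ 2 ^ (3 * b) := Nat.pow_le_pow_right two_pos (by omega)

include hd

theorem card_floodValue_params_le :
    Fintype.card (params c u N b d).FloodValue ≤ 2 ^ ((6 * u + 46) * b) := by
  have hN := two_mul_le_two_pow hNn hb hn
  have hid : (2 * N) ^ u + 2 ≤ 2 ^ ((3 * u + 2) * b) := by
    refine add_two_le_two_pow hb ?_
    calc (2 * N) ^ u ≤ (2 ^ (3 * b)) ^ u := Nat.pow_le_pow_left hN u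
      _ = 2 ^ (3 * u * b) := by rw [← pow_mul]; ring_nf
  have hkey : 2 * N * (params c u N b d).numBlocks + 2 ≤ 2 ^ (6 * b) := by
    refine add_two_le_two_pow (k := 4) hb ?_
    calc 2 * N * (params c u N b d).numBlocks ≤ 2 ^ (3 * b) * 2 ^ b :=
          Nat.mul_le_mul hN ((params_numBlocks_le hb).trans Nat.lt_two_pow_self.le)
      _ = 2 ^ (4 * b) := by ring
  have htok : 2 ^ d + 1 ≤ 2 ^ (3 * b) := (Nat.le_succ _).trans <|
    add_two_le_two_pow (k := 1) hb (Nat.pow_le_pow_right two_pos (by omega))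
  have hhash : 2 ^ (29 * b + 1) + 1 ≤ 2 ^ (32 * b) := (Nat.le_succ _).trans <|
    add_two_le_two_pow (k := 30) hb (Nat.pow_le_pow_right two_pos (by omega))
  have hflag : 2 ≤ 2 ^ (1 * b) := Nat.le_self_pow (by omega) 2
  rw [Params.card_floodValue]
  calc ((2 * N) ^ u + 2) * (((2 * N) ^ u + 2) * ((2 ^ d + 1) *
      ((2 * N * (params c u N b d).numBlocks + 2) * ((2 ^ (29 * b + 1) + 1) * 2))))
      ≤ 2 ^ ((3 * u + 2) * b) * (2 ^ ((3 * u + 2) * b) * (2 ^ (3 * b) *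
          (2 ^ (6 * b) * (2 ^ (32 * b) * 2 ^ (1 * b))))) := by gcongr
    _ = 2 ^ ((6 * u + 46) * b) := by simp only [← pow_add]; ring_nf

theorem params_encode_injective :
    Function.Injective ((params c u N b d).encode ((6 * u + 126) * b)) := by
  refine Params.encode_injective ?_
  have hpow (k : ℕ) (hk : k ≤ 6 * u + 124) : 2 ^ (k * b) ≤ 2 ^ ((6 * u + 124) * b) :=
    Nat.pow_le_pow_right two_pos (Nat.mul_le_mul_right b hk)
  have hblock := (Params.card_block_le.trans (card_block_params_le (c := c) (u := u) (N := N)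
    hb hd)).trans (hpow 2 (by omega))
  have hflood := (card_floodValue_params_le (c := c) (u := u) hNn hb hn hd).trans
    (hpow _ (by omega))
  have hvec := (card_codeVec_params_le (c := c) (u := u) (N := N) (d := d) hb).trans
    (hpow 80 (by omega))
  calc _ ≤ 4 * 2 ^ ((6 * u + 124) * b) := by omega
    _ = 2 ^ ((6 * u + 124) * b + 2) := by ring
    _ ≤ 2 ^ ((6 * u + 126) * b) := Nat.pow_le_pow_right two_pos (by nlinarith)

end MessageSize

theorem le_card_hashField_params (hb : 0 < b) (hn : n ≤ 2 ^ b) :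
    2 * (n * (2 ^ (params c u N b d).capacity * (2 * (params c u N b d).capacity + 1))) ≤
      Fintype.card (params c u N b d).HashField := by
  have hnum := params_numBlocks_le (c := c) (u := u) (N := N) (d := d) hb
  have hlt : b < 2 ^ b := Nat.lt_two_pow_self
  rw [Params.card_hashField, params_capacity]
  calc 2 * (n * (2 ^ (20 * (params c u N b d).numBlocks) *
        (2 * (20 * (params c u N b d).numBlocks) + 1)))
      ≤ 2 * (2 ^ b * (2 ^ (20 * b) * (64 * 2 ^ b))) := by
        gcongr
        · norm_num
        · omega
    _ = 2 ^ (22 * b + 7) := by ring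
    _ ≤ 2 ^ (29 * b + 1) := Nat.pow_le_pow_right two_pos (by omega)

theorem params_fits (hn0 : 0 < n) (hnN : n ≤ 2 * N) (hb : 0 < b) (hn : n ≤ 2 ^ b)
    (hd : d ≤ b) : (params c u N b d).Fits n where
  blockCode_injective := Params.blockCode_injective <|
    (card_block_params_le hb hd).trans <| Nat.pow_le_pow_right two_pos <|
      show 2 * b ≤ 29 * b + 1 by omega
  le_floodLen := hnN
  le_card_hashField := le_card_hashField_params hb hn
  le_keyRange := (Nat.mul_le_mul_right _ hnN).trans (Nat.le_succ _)
  capacity_eq := params_capacity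
  code_failure_le := by
    refine two_pow_mul_three_quarters_pow_le (by omega) ?_ hnN
    have hnum : (params c u N b d).numBlocks ≤ N + 1 := by
      rw [params_numBlocks hb]
      exact (min_le_right _ _).trans (Nat.succ_le_succ (Nat.div_le_self _ _))
    rw [params_capacity]
    omega

theorem params_fwdFailure_le (hn0 : 0 < n) (hnN : n ≤ 2 * N) (hb : 0 < b) :
    (params c u N b d).fwdFailure n ≤ 1 / (n : ℝ) ^ (c + 2 + phaseFactor c) := by
  set g := (params c u N b d).numBlocks
  have hg0 : (0 : ℝ) < g := (params c u N b d).cast_numBlocks_pos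
  have hg1 : 1 / (g : ℝ) ≤ 1 := (div_le_one hg0).2 (by exact_mod_cast hg0)
  have hfrac : 0 ≤ 1 - 1 / (g : ℝ) / 2 := by linarith
  have hratio : (bits N : ℝ) / 2 ≤ N / g := by
    rw [div_le_div_iff₀ two_pos hg0, mul_comm (N : ℝ)]
    exact_mod_cast bits_mul_params_numBlocks_le (by omega) hb
  have hcovers : (2 : ℝ) ^ (n / g) ≤ Real.exp (2 * (N / g)) := by
    refine (two_pow_le_exp _).trans (Real.exp_le_exp.2 ?_)
    calc ((n / g : ℕ) : ℝ) ≤ (n : ℝ) / g := Nat.cast_div_le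
      _ ≤ (2 * N : ℝ) / g := by gcongr; exact_mod_cast hnN
      _ = _ := mul_div_assoc _ _ _
  have hmiss : (1 - 1 / (g : ℝ) / 2) ^ (fwdFactor c * N) ≤
      Real.exp (-((fwdFactor c : ℝ) / 2 * (N / g))) := by
    refine (one_sub_pow_le_exp_neg (sub_nonneg.1 hfrac) _).trans (le_of_eq ?_)
    push_cast
    ring_nf
  calc (n : ℝ) * (2 ^ (n / g) * (1 - 1 / (g : ℝ) / 2) ^ (fwdFactor c * N))
      ≤ Real.exp (2 * bits N) * (Real.exp (2 * (N / g)) *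
        Real.exp (-((fwdFactor c : ℝ) / 2 * (N / g)))) := by
        gcongr
        exact cast_le_exp_bits hnN
    _ = Real.exp (2 * bits N - 4 * (c + 3 + phaseFactor c) * (N / g)) := by
        rw [← Real.exp_add, ← Real.exp_add, fwdFactor]
        push_cast
        ring_nf
    _ ≤ Real.exp (-(2 * bits N * (c + 2 + phaseFactor c : ℕ))) := by
        have hmul := mul_le_mul_of_nonneg_left hratio
          (show (0 : ℝ) ≤ 4 * (c + 3 + phaseFactor c) by positivity)
        push_cast
        gcongr
        linarith
    _ ≤ _ := exp_neg_bits_le hn0 hnN _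

/-- The number of phases: the exponent `p.rate * k` of the initial potential and the `log` of the
error probability, each of which takes `decayTime` phases per unit. -/
noncomputable def phaseCount (p : Params) (c N k : ℕ) : ℕ :=
  ⌈decayTime * ((k : ℝ) / (p.numBlocks * p.blockSize) + (3 + c) * (2 * bits N))⌉₊

theorem phaseCount_le (p : Params) : (phaseCount p c N k : ℝ) ≤
    decayTime * ((k : ℝ) / (p.numBlocks * p.blockSize) + (3 + c) * (2 * bits N)) + 1 :=
  (Nat.ceil_lt_add_one (by positivity)).le

theorem one_le_numBlocks_mul_blockSize (p : Params) : (1 : ℝ) ≤ p.numBlocks * p.blockSize := by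
  exact_mod_cast Nat.mul_pos p.numBlocks_pos p.blockSize_pos

theorem phaseCount_le_mul (hn0 : 0 < n) (hnN : n ≤ 2 * N) (hNn : N ≤ 2 * n) (hk : k ≤ n)
    (p : Params) : (phaseCount p c N k : ℝ) ≤ phaseFactor c * n := by
  have hbits : (bits N : ℝ) ≤ 2 * n := by exact_mod_cast (bits_le (by omega)).trans hNn
  have hblocks : (k : ℝ) / (p.numBlocks * p.blockSize) ≤ n :=
    (div_le_self (Nat.cast_nonneg k) (one_le_numBlocks_mul_blockSize p)).trans
      (Nat.cast_le.2 hk)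
  calc (phaseCount p c N k : ℝ)
      ≤ decayTime * ((k : ℝ) / (p.numBlocks * p.blockSize) + (3 + c) * (2 * bits N)) + 1 :=
        phaseCount_le p
    _ ≤ decayTime * (n + (3 + c) * (2 * (2 * n))) + n := by
        gcongr
        exact_mod_cast hn0
    _ = phaseFactor c * n := by
        rw [phaseFactor]
        push_cast
        ring

theorem decay_pow_mul_le (h2 : 2 ≤ n) (hnN : n ≤ 2 * N) (p : Params) :
    (1 - 1 / decayTime) ^ phaseCount p c N k * ((n : ℝ) ^ 2 * Real.exp (p.rate * k)) ≤
      1 / (n : ℝ) ^ c / 2 := by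
  set j := phaseCount p c N k
  have hn2 : (2 : ℝ) ≤ n := by exact_mod_cast h2
  have hdecay : (0 : ℝ) < decayTime := by norm_num [decayTime]
  have hphases : (k : ℝ) / (p.numBlocks * p.blockSize) + (3 + c) * (2 * bits N) ≤
      j * (1 / decayTime) := by
    rw [mul_one_div, le_div_iff₀ hdecay, mul_comm]
    exact Nat.le_ceil _
  have hrate : p.rate * k ≤ (k : ℝ) / (p.numBlocks * p.blockSize) := by
    have hone := one_le_numBlocks_mul_blockSize p
    rw [Params.rate, one_div_mul_eq_div]
    exact div_le_div_of_nonneg_left (Nat.cast_nonneg k) (by linarith) (by linarith)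
  calc (1 - 1 / decayTime) ^ j * ((n : ℝ) ^ 2 * Real.exp (p.rate * k))
      ≤ Real.exp (-(j * (1 / decayTime))) * ((n : ℝ) ^ 2 * Real.exp (p.rate * k)) := by
        gcongr
        exact one_sub_pow_le_exp_neg (sub_nonneg.1 one_sub_one_div_decayTime_nonneg) j
    _ = (n : ℝ) ^ 2 * Real.exp (p.rate * k - j * (1 / decayTime)) := by
        rw [mul_left_comm, ← Real.exp_add, neg_add_eq_sub]
    _ ≤ (n : ℝ) ^ 2 * Real.exp (-(2 * bits N * (c + 3 : ℕ))) := by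
        gcongr
        push_cast
        linarith
    _ ≤ (n : ℝ) ^ 2 * (1 / (n : ℝ) ^ (c + 3)) := by
        gcongr
        exact exp_neg_bits_le (by omega) hnN (c + 3)
    _ = 1 / (n : ℝ) ^ c / n := by field_simp; ring
    _ ≤ 1 / (n : ℝ) ^ c / 2 := by gcongr

theorem failure_le (h2 : 2 ≤ n) (hnN : n ≤ 2 * N) (hNn : N ≤ 2 * n) (hk : k ≤ n) (hb : 0 < b) :
    phaseCount (params c u N b d) c N k * (params c u N b d).fwdFailure n +
      (1 - 1 / decayTime) ^ phaseCount (params c u N b d) c N k *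
        ((n : ℝ) ^ 2 * Real.exp ((params c u N b d).rate * k)) ≤ 1 / (n : ℝ) ^ c := by
  have hn2 : (2 : ℝ) ≤ n := by exact_mod_cast h2
  have hfactor : (phaseFactor c : ℝ) / n ^ phaseFactor c ≤ 1 := by
    rw [div_le_one (by positivity)]
    calc (phaseFactor c : ℝ) ≤ 2 ^ phaseFactor c := by exact_mod_cast Nat.lt_two_pow_self.le
      _ ≤ n ^ phaseFactor c := by gcongr
  have hfwd : phaseCount (params c u N b d) c N k * (params c u N b d).fwdFailure n ≤
      1 / (n : ℝ) ^ c / 2 :=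
    calc _ ≤ (phaseFactor c * n : ℝ) * (1 / (n : ℝ) ^ (c + 2 + phaseFactor c)) := by
          gcongr
          · exact (params c u N b d).fwdFailure_nonneg n
          · exact phaseCount_le_mul (by omega) hnN hNn hk _
          · exact params_fwdFailure_le (by omega) hnN hb
      _ = phaseFactor c / n ^ phaseFactor c * (1 / (n : ℝ) ^ c / n) := by
          rw [pow_add, pow_add]
          field_simp
      _ ≤ 1 * (1 / (n : ℝ) ^ c / 2) := by gcongr
      _ = _ := one_mul _
  linarith [decay_pow_mul_le (c := c) (k := k) h2 hnN (params c u N b d)]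

theorem one_div_params_blockSize_le (hb : 0 < b) (hd : d ≤ b) (hd0 : 0 < d) :
    1 / ((params c u N b d).blockSize : ℝ) ≤ 2 * d / b := by
  have hsize : (params c u N b d).blockSize = b / d := by
    rw [params_blockSize hb hd, max_eq_left hd0]
  have hpos := (params c u N b d).blockSize_pos
  rw [div_le_div_iff₀ (params c u N b d).cast_blockSize_pos (by exact_mod_cast hb), one_mul]
  rw [hsize] at hpos ⊢
  have hle : b ≤ 2 * d * (b / d) := by
    nlinarith [Nat.div_add_mod b d, Nat.mod_lt b hd0]
  exact_mod_cast hle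

theorem one_div_params_numBlocks_le (hb : 0 < b) (hN : 0 < N) :
    1 / ((params c u N b d).numBlocks : ℝ) ≤ 1 / b + bits N / N := by
  rcases min_choice b (N / bits N + 1) with hmin | hmin
  · rw [params_numBlocks hb, hmin]
    exact le_add_of_nonneg_right (by positivity)
  · have hle : (N : ℝ) ≤ bits N * (N / bits N + 1 : ℕ) := by
      exact_mod_cast (Nat.lt_mul_div_succ N bits_pos).le
    rw [params_numBlocks hb, hmin]
    refine le_add_of_nonneg_of_le (by positivity) ?_
    rw [div_le_div_iff₀ (by positivity) (by positivity)]
    linarith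

theorem div_params_le (hnN : n ≤ 2 * N) (hN : 0 < N) (hb : 0 < b) (hd : d ≤ b) (hk : k ≤ n)
    (hkd : d = 0 → k ≤ 1) :
    (k : ℝ) / ((params c u N b d).numBlocks * (params c u N b d).blockSize) ≤
      2 * ((k : ℝ) * d / b ^ 2) + 4 * bits N := by
  rcases Nat.eq_zero_or_pos d with rfl | hd0
  · have hk1 : (k : ℝ) ≤ 1 := by exact_mod_cast hkd rfl
    have hbits : (1 : ℝ) ≤ bits N := by exact_mod_cast bits_pos
    calc _ ≤ (k : ℝ) := div_le_self (Nat.cast_nonneg k) (one_le_numBlocks_mul_blockSize _)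
      _ ≤ _ := by
        rw [Nat.cast_zero, mul_zero, zero_div]
        linarith
  have hkN : (k : ℝ) / N ≤ 2 :=
    div_le_of_le_mul₀ (Nat.cast_nonneg N) two_pos.le (by exact_mod_cast hk.trans hnN)
  have hdb : (d : ℝ) / b ≤ 1 := div_le_one_of_le₀ (Nat.cast_le.2 hd) (Nat.cast_nonneg b)
  calc _ = k * (1 / ((params c u N b d).numBlocks : ℝ) *
        (1 / ((params c u N b d).blockSize : ℝ))) := by
        rw [one_div_mul_one_div, mul_one_div]
    _ ≤ k * ((1 / b + bits N / N) * (2 * d / b)) := by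
        grw [one_div_params_numBlocks_le hb hN, one_div_params_blockSize_le hb hd hd0]
    _ = 2 * ((k : ℝ) * d / b ^ 2) + 2 * (k / N) * (d / b) * bits N := by field_simp
    _ ≤ 2 * ((k : ℝ) * d / b ^ 2) + 2 * 2 * 1 * bits N := by gcongr
    _ = _ := by ring

theorem length_params_phase_le (hN : 0 < N) (hNn : N ≤ 2 * n) :
    ((params c u N b d).phase.length : ℝ) ≤ 2 * (fwdFactor c + 273) * n := by
  have hlen : (params c u N b d).phase.length ≤ (fwdFactor c + 273) * N := by
    rw [Params.length_phase]
    change fwdFactor c * N + 2 * (2 * N) + 2 * (132 * N) + 5 ≤ _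
    nlinarith
  calc ((params c u N b d).phase.length : ℝ) ≤ (((fwdFactor c + 273) * (2 * n) : ℕ) : ℝ) := by
        exact_mod_cast hlen.trans (Nat.mul_le_mul_left _ hNn)
    _ = _ := by
        push_cast
        ring

theorem phaseCount_params_add_one_le (h2 : 2 ≤ n) (hnN : n ≤ 2 * N) (hNn : N ≤ 2 * n)
    (hb : 0 < b) (hd : d ≤ b) (hk : k ≤ n) (hkd : d = 0 → k ≤ 1) :
    (phaseCount (params c u N b d) c N k : ℝ) + 1 ≤
      (decayTime * (30 + 6 * c) + 2) * ((k : ℝ) * d / b ^ 2 + Real.logb 2 n) := by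
  have hone := one_le_logb_two (show (2 : ℝ) ≤ n by exact_mod_cast h2)
  set X : ℝ := (k : ℝ) * d / b ^ 2
  have hX0 : 0 ≤ X := by positivity
  calc (phaseCount (params c u N b d) c N k : ℝ) + 1
      ≤ decayTime * (2 * X + 4 * bits N + (3 + c) * (2 * bits N)) + 1 + 1 := by
        grw [phaseCount_le, div_params_le hnN (by omega) hb hd hk hkd]
    _ = decayTime * (2 * X + (10 + 2 * c) * bits N) + 2 := by ring
    _ ≤ decayTime * (2 * X + (10 + 2 * c) * (3 * Real.logb 2 n)) + 2 := by
        grw [cast_bits_le_logb h2 hNn]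
    _ ≤ decayTime * ((30 + 6 * c) * X + (30 + 6 * c) * Real.logb 2 n) +
        2 * (X + Real.logb 2 n) := by
        have hc : 2 * X ≤ (30 + 6 * c) * X := by
          gcongr
          linarith [(Nat.cast_nonneg c : (0 : ℝ) ≤ c)]
        grw [hc]
        linarith
    _ = _ := by ring

/-- The constant in the round bound: the product of the factors in `phaseCount_params_add_one_le`
and `length_params_phase_le`. -/
def roundConst (c : ℕ) : ℕ := (decayTime * (30 + 6 * c) + 2) * (2 * (fwdFactor c + 273))

theorem rounds_le (h2 : 2 ≤ n) (hnN : n ≤ 2 * N) (hNn : N ≤ 2 * n) (hb : 0 < b) (hd : d ≤ b)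
    (hk : k ≤ n) (hkd : d = 0 → k ≤ 1) :
    (phaseCount (params c u N b d) c N k + 1) * (params c u N b d).phase.length ≤
      ⌊roundConst c * (n * ((k : ℝ) * d / b ^ 2 + Real.logb 2 n))⌋₊ := by
  have hone := one_le_logb_two (show (2 : ℝ) ≤ n by exact_mod_cast h2)
  refine Nat.le_floor ?_
  push_cast
  calc ((phaseCount (params c u N b d) c N k : ℝ) + 1) * (params c u N b d).phase.length
      ≤ ((decayTime * (30 + 6 * c) + 2) * ((k : ℝ) * d / b ^ 2 + Real.logb 2 n)) *
          (2 * (fwdFactor c + 273) * n) := by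
        gcongr
        · exact phaseCount_params_add_one_le h2 hnN hNn hb hd hk hkd
        · exact length_params_phase_le (by omega) hNn
    _ = _ := by
        rw [roundConst]
        push_cast
        ring

theorem mul_add_logb_le_roundBound (h2 : 2 ≤ n) (hlog : Real.logb 2 n ≤ b) :
    (n : ℝ) * ((k : ℝ) * d / b ^ 2 + Real.logb 2 n) ≤ roundBound n k d b := by
  have hb := pos_of_logb_le h2 hlog
  have hone := one_le_logb_two (show (2 : ℝ) ≤ n by exact_mod_cast h2)
  refine le_min ?_ ?_
  · calc _ = (n : ℝ) * ((k : ℝ) * d / b ^ 2) + n * Real.logb 2 n := by ring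
      _ ≤ (n : ℝ) * ((k : ℝ) * d / b ^ 2) + n * b := by gcongr
      _ = _ := by field_simp
  · calc _ = 1 * ((n : ℝ) * ((k : ℝ) * d / b ^ 2)) + n * Real.logb 2 n := by ring
      _ ≤ Real.logb 2 n * ((n : ℝ) * ((k : ℝ) * d / b ^ 2)) + n * Real.logb 2 n := by gcongr
      _ = _ := by field_simp

end Choice

end NetCoding

theorem theorem3_general (c u : ℕ) :
    ∃ (K C : ℕ) (alg : (N b d : ℕ) → Algorithm (K * b) d),
      ∀ n N b d k : ℕ, 2 ≤ n → n ≤ 2 * N → N ≤ 2 * n →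
        Real.logb 2 (n : ℝ) ≤ (b : ℝ) → d ≤ b → k ≤ n →
        ∀ uid : Fin n → ℕ, Function.Injective uid → (∀ v, uid v < n ^ u) →
        ∀ tok : Fin n → Finset (Token d), (Finset.univ.biUnion tok).card = k →
        ∀ adv : Adversary n (alg N b d).Coin,
          (alg N b d).Disseminates uid tok adv ∧
          ∀ t : ℕ, ⌊C * (n * ((k : ℝ) * d / b ^ 2 + Real.logb 2 n))⌋₊ ≤ t →
            1 - 1 / (n : ℝ) ^ c ≤ (alg N b d).haltProb uid tok adv t := by
  refine ⟨6 * u + 126, NetCoding.roundConst c, fun N b d =>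
    (NetCoding.params c u N b d).machine ((6 * u + 126) * b), ?_⟩
  rintro n N b d k h2 hnN hNn hlog hd hk uid huid hU tok rfl adv
  have : NeZero n := ⟨by omega⟩
  have hb := NetCoding.pos_of_logb_le h2 hlog
  have hn := NetCoding.le_two_pow_of_logb_le (by omega) hlog
  have hkd : d = 0 → (Finset.univ.biUnion tok).card ≤ 1 := by
    rintro rfl
    exact (Finset.card_le_univ _).trans (by simp)
  have hid (v : Fin n) : uid v < (NetCoding.params c u N b d).idRange :=
    ((hU v).trans_le (Nat.pow_le_pow_left hnN u)).trans (Nat.lt_succ_self _)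
  have hfits := NetCoding.params_fits (c := c) (u := u) (by omega) hnN hb hn hd
  have henc := NetCoding.params_encode_injective (c := c) (u := u) hNn hb hn hd
  refine ⟨NetCoding.Params.machine_disseminates hfits huid hid adv henc, fun t ht => ?_⟩
  calc _ ≤ 1 - _ := sub_le_sub_left (NetCoding.failure_le (u := u) h2 hnN hNn hk hb) 1
    _ ≤ _ := NetCoding.Params.le_haltProb hfits huid hid adv henc hk _
      ((NetCoding.rounds_le h2 hnN hNn hb hd hk hkd).trans ht)

theorem theorem3 (c u : ℕ) :
    ∃ (K : ℕ) (C : ℝ) (alg : (N b d : ℕ) → Algorithm (K * b) d),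
      ∀ n N b d k : ℕ, 2 ≤ n → n ≤ 2 * N → N ≤ 2 * n →
        Real.logb 2 (n : ℝ) ≤ (b : ℝ) → d ≤ b → k ≤ n →
        ∀ uid : Fin n → ℕ, Function.Injective uid → (∀ v, uid v < n ^ u) →
        ∀ tok : Fin n → Finset (Token d), (Finset.univ.biUnion tok).card = k →
        ∀ adv : Adversary n (alg N b d).Coin,
          (alg N b d).Disseminates uid tok adv ∧
          1 - 1 / (n : ℝ) ^ c ≤
            (alg N b d).haltProb uid tok adv ⌊C * roundBound n k d b⌋₊ := by
  obtain ⟨K, C, alg, h⟩ := theorem3_general c u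
  refine ⟨K, C, alg, fun n N b d k h2 hnN hNn hlog hd hk uid huid hU tok htok adv =>
    (h n N b d k h2 hnN hNn hlog hd hk uid huid hU tok htok adv).imp_right fun hprob =>
      hprob _ (Nat.floor_mono ?_)⟩
  gcongr
  exact NetCoding.mul_add_logb_le_roundBound h2 hlog
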